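/- **Setting.** Let $\{Y_t\}_{t\in\mathbb Z}$ be an $\mathbb R^d$-valued process with $\mathrm E\|Y_t\|<\infty$, let $\mathcal F_t=\sigma(Y_s:s\le t)$, and suppose that $$\mathrm E(Y_t\mid\mathcal F_{t-1})=\lambda_t(\theta_0),\qquad \lambda_t(\theta)=\lambda(Y_{t-1},Y_{t-2},\dots;\theta),\qquad t\in\mathbb Z,$$ where $\lambda$ is measurable in the past and $\theta_0\in\Theta\subset\mathbb R^m$. Put $e_t(\theta)=Y_t-\lambda_t(\theta)$. For a sequence of $d\times d$ weight matrices $W=(W_t)$ put $$l_t(\theta,W_t)=e_t(\theta)'W_te_t(\theta),\qquad L_T(\theta,W)=\frac1T\sum_{t=1}^Tl_t(\theta,W_t).$$ *First step.* Let $W^{(1)}_t=W^{(1)}(Y_{t-1},Y_{t-2},\dots)$ be measurable weights and let $\hat\theta_1=\hat\theta_{1,T}\in\arg\min_{\theta\in\Theta}L_T(\theta,W^{(1)})$. Let $\hat\gamma=\hat\gamma_T\in\Gamma\subset\mathbb R^q$ be an estimator of some $\gamma_0\in\Gamma$. Put $\tau=(\theta',\gamma')'$, $\mathcal T=\Theta\times\Gamma$,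 $\tau_0=(\theta_0',\gamma_0')'$, $\hat\tau=(\hat\theta_1',\hat\gamma')'$. Assume that $\mathcal T$ contains the segment from $\tau_0$ to each of its points sufficiently close to $\tau_0$ (as it does if $\mathcal T$ is convex). *Second step.* For $\tau\in\mathcal T$ let $D_t(\tau)$ be the diagonal matrix of pseudo-variances $\nu_{i,t}(\tau)=\nu_i(Y_{t-1},Y_{t-2},\dots;\tau)\ge0$ ($\nu$ measurable in the past), let $P(\tau)$ be a working correlation matrix (symmetric, unit diagonal, off-diagonal entries in $(-1,1)$), and put $V_t(\tau)=D_t(\tau)^{1/2}P(\tau)D_t(\tau)^{1/2}$. Correlations computed from the sample enter $P$ through components of $\hat\gamma$. The two-stage MWLSE is any (measurable) $\hat\theta=\hat\theta_T\in\arg\min_{\theta\in\Theta}L_T(\theta,\hat W)$ with $\hat W_t=V_t(\hat\tau)^{-1}$. Let $W_t=V_t(\tau_0)^{-1}$. *Notation.* $\|\cdot\|$ is the Euclidean norm, $|||\cdot|||$ the spectral norm, and a subscript $\Theta$ or $\mathcal T$ denotes the supremum over that set; derivatives at boundary points are taken within the set. Let $k_t(\tau)=\mathrm{vec}(V_t(\tau)^{-1})$,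 let $s_t(\theta,W_t)=\big(\partial\lambda_t(\theta)/\partial\theta'\big)'W_te_t(\theta)$ be the score contribution (so that $\partial l_t/\partial\theta=-2s_t$), and let $$Z_t=\Big|\Big|\Big|\frac{\partial k_t(\tau)}{\partial\tau}\Big|\Big|\Big|_{\mathcal T}\,|||e_t(\theta)e_t(\theta)'|||_\Theta,\qquad X_t=\Big|\Big|\Big|\frac{\partial k_t(\tau)}{\partial\tau}\Big|\Big|\Big|_{\mathcal T}\,\Big|\Big|\Big|\frac{\partial\lambda_t(\theta)}{\partial\theta'}\Big|\Big|\Big|_\Theta\,\|e_t(\theta)\|_\Theta,$$ $$H=\mathrm E\Big[-\frac{\partial s_t(\theta_0,W_t)}{\partial\theta'}\Big]=\frac12\,\mathrm E\Big[\frac{\partial^2l_t(\theta_0,W_t)}{\partial\theta\,\partial\theta'}\Big],\qquad I=\mathrm E\big[s_t(\theta_0,W_t)s_t(\theta_0,W_t)'\big].$$ **Assumptions.** - **A1** $\{Y_t\}$ is strictly stationary and ergodic. - **A2** $\lambda_t(\cdot)$ is a.s. continuous on $\Theta$, $\Theta$ is compact, and $\mathrm E\sup_{\theta\in\Theta}|l_t(\theta,\cdot)|<\infty$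 both for the weights $W^{(1)}_t$ and for the weights $W_t$. - **A3** $W^{(1)}_t$ and $W_t$ are a.s. positive definite for all $t$. - **A4** For $\theta\in\Theta$: $\lambda_t(\theta)=\lambda_t(\theta_0)$ a.s. if and only if $\theta=\theta_0$. - **A5** $H$ and $I$ exist (are finite) and $H$ is positive definite. - **A6** $\lambda_t(\cdot)$ is a.s. twice continuously differentiable on $\Theta$, and $\mathrm E\,|||\partial^2l_t(\theta,W_t)/\partial\theta\partial\theta'|||_\Theta<\infty$. - **A7** $\theta_0$ is an interior point of $\Theta$. - **B1** $k_t(\cdot)$ is a.s. continuously differentiable on $\mathcal T$, and $\hat\gamma\to\gamma_0$ a.s. as $T\to\infty$. - **B2** $\mathrm E(Z_t)<\infty$. - **B3** For some $\delta>1/2$, a.s. $\|\hat\tau_T-\tau_0\|X_t=O(t^{-\delta})$ uniformly over $1\le t\le T$; that is, there are a.s. a finite (random) $C$ and $T_0$ with $\|\hat\tau_T-\tau_0\|X_t\le C\,t^{-\delta}$ for all $T\ge T_0$ and $1\le t\le T$. **Theorem.** Under A1–A4 and B1–B2, $\hat\theta\to\theta_0$ a.s. as $T\to\infty$. If moreover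 A5–A7 and B3 hold, then, as $T\to\infty$, $$\sqrt T\,(\hat\theta-\theta_0)\xrightarrow{d}N\big(0,\;H^{-1}IH^{-1}\big).$$ -/

import Mathlib

open MeasureTheory ProbabilityTheory Filter Topology
open scoped Matrix ENNReal

namespace MWLSE

noncomputable section

open scoped Matrix.Norms.L2Operator

/-- `ℝⁿ` with the Euclidean norm. -/
abbrev Vec (n : ℕ) : Type := EuclideanSpace ℝ (Fin n)

/-- The stacked parameter `τ = (θ', γ')' ∈ ℝ^{m+q}`, with the Euclidean norm. -/
abbrev Param (m q : ℕ) : Type := WithLp 2 (Vec m × Vec q)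

/-- `τ = (θ', γ')'`. -/
def stack {m q : ℕ} (θ : Vec m) (γ : Vec q) : Param m q := WithLp.toLp 2 (θ, γ)

/-- The parameter space `𝒯 = Θ × Γ`. -/
def paramSpace {m q : ℕ} (Θ : Set (Vec m)) (Γ : Set (Vec q)) : Set (Param m q) :=
  {τ | τ.fst ∈ Θ ∧ τ.snd ∈ Γ}

/-- `S` contains the segment from `τ₀` to each of its points that is close enough to `τ₀`
(true for convex `S`, and whenever `τ₀` is interior to `S`). -/
def LocallyStarShapedAt {m q : ℕ} (S : Set (Param m q)) (τ₀ : Param m q) : Prop :=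
  ∃ ε > 0, ∀ τ ∈ S, ‖τ - τ₀‖ < ε → segment ℝ τ₀ τ ⊆ S

section Basics

variable {Ω : Type*} {d m q : ℕ}

/-- The infinite past `(Y_{t-1}, Y_{t-2}, …)`. -/
def past (Y : ℤ → Ω → Vec d) (t : ℤ) (ω : Ω) : ℕ → Vec d := fun n => Y (t - 1 - n) ω

/-- The σ-field `ℱ_t` generated by `Y_s`, `s ≤ t`. -/
abbrev history (Y : ℤ → Ω → Vec d) (t : ℤ) : MeasurableSpace Ω :=
  ⨆ s : ℤ, ⨆ _ : s ≤ t, MeasurableSpace.comap (Y s) inferInstance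

/-- Strict stationarity and ergodicity: the shift on `(ℝ^d)^ℤ` preserves the law of the process
(this is part of `Ergodic`) and is ergodic for it. -/
def StationaryErgodic [MeasurableSpace Ω] (μ : Measure Ω) (Y : ℤ → Ω → Vec d) : Prop :=
  Ergodic (fun (x : ℤ → Vec d) (t : ℤ) => x (t + 1)) (μ.map fun ω t => Y t ω)

/-- The residual `e_t(θ) = Y_t - λ_t(θ)`, where `λ_t(θ) = λ(Y_{t-1}, Y_{t-2}, …; θ)`. -/
def resid (lam : (ℕ → Vec d) → Vec m → Vec d) (Y : ℤ → Ω → Vec d) (t : ℤ) (ω : Ω)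
    (θ : Vec m) : Vec d :=
  Y t ω - lam (past Y t ω) θ

/-- `l_t(θ, W_t) = e_t(θ)' W_t e_t(θ)` for a sequence of (random) weight matrices `W_t`. -/
def loss (lam : (ℕ → Vec d) → Vec m → Vec d) (Y : ℤ → Ω → Vec d)
    (W : ℤ → Ω → Matrix (Fin d) (Fin d) ℝ) (t : ℤ) (ω : Ω) (θ : Vec m) : ℝ :=
  (resid lam Y t ω θ).ofLp ⬝ᵥ (W t ω *ᵥ (resid lam Y t ω θ).ofLp)

/-- `L_T(θ, W) = T⁻¹ ∑_{t=1}^T l_t(θ, W_t)`. -/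
def objective (lam : (ℕ → Vec d) → Vec m → Vec d) (Y : ℤ → Ω → Vec d)
    (W : ℤ → Ω → Matrix (Fin d) (Fin d) ℝ) (T : ℕ) (ω : Ω) (θ : Vec m) : ℝ :=
  (T : ℝ)⁻¹ * ∑ t ∈ Finset.Icc 1 T, loss lam Y W (t : ℤ) ω θ

/-- `x ∈ argmin_{θ ∈ Θ} f(θ)`. -/
def IsArgmin (f : Vec m → ℝ) (Θ : Set (Vec m)) (x : Vec m) : Prop :=
  x ∈ Θ ∧ ∀ θ ∈ Θ, f x ≤ f θ

/-- Weights that are a function of the past, `W_t = W(Y_{t-1}, Y_{t-2}, …)`. -/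
def pastWeights (W : (ℕ → Vec d) → Matrix (Fin d) (Fin d) ℝ) (Y : ℤ → Ω → Vec d) (t : ℤ)
    (ω : Ω) : Matrix (Fin d) (Fin d) ℝ :=
  W (past Y t ω)

/-- A working correlation matrix. -/
def IsWorkingCorrelation (P : Matrix (Fin d) (Fin d) ℝ) : Prop :=
  P.IsSymm ∧ (∀ i, P i i = 1) ∧ ∀ i j, i ≠ j → |P i j| < 1

/-- The pseudo-covariance `V(y; τ) = D(y; τ)^{1/2} P(τ) D(y; τ)^{1/2}`, with `D(y; τ)` the
diagonal matrix of the pseudo-variances `ν_i(y; τ)`, as a function of the past `y`. -/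
def pseudoCov (ν : (ℕ → Vec d) → Param m q → Fin d → ℝ)
    (P : Param m q → Matrix (Fin d) (Fin d) ℝ) (y : ℕ → Vec d) (τ : Param m q) :
    Matrix (Fin d) (Fin d) ℝ :=
  Matrix.diagonal (fun i => Real.sqrt (ν y τ i)) * P τ *
    Matrix.diagonal (fun i => Real.sqrt (ν y τ i))

/-- The limiting weights `W_t = V_t(τ)⁻¹` for a fixed `τ`. -/
def limitWeights (ν : (ℕ → Vec d) → Param m q → Fin d → ℝ)
    (P : Param m q → Matrix (Fin d) (Fin d) ℝ) (Y : ℤ → Ω → Vec d) (τ : Param m q) (t : ℤ)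
    (ω : Ω) : Matrix (Fin d) (Fin d) ℝ :=
  (pseudoCov ν P (past Y t ω) τ)⁻¹

/-- The estimated weights `Ŵ_t = V_t(τ̂)⁻¹`, for a random `τ̂`. -/
def estWeights (ν : (ℕ → Vec d) → Param m q → Fin d → ℝ)
    (P : Param m q → Matrix (Fin d) (Fin d) ℝ) (Y : ℤ → Ω → Vec d) (τhat : Ω → Param m q)
    (t : ℤ) (ω : Ω) : Matrix (Fin d) (Fin d) ℝ :=
  (pseudoCov ν P (past Y t ω) (τhat ω))⁻¹

/-- `k_t(τ) = vec(V_t(τ)⁻¹)`. -/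
def kvec (ν : (ℕ → Vec d) → Param m q → Fin d → ℝ)
    (P : Param m q → Matrix (Fin d) (Fin d) ℝ) (Y : ℤ → Ω → Vec d) (t : ℤ) (ω : Ω)
    (τ : Param m q) : EuclideanSpace ℝ (Fin d × Fin d) :=
  WithLp.toLp 2 (Matrix.vec (pseudoCov ν P (past Y t ω) τ)⁻¹)

/-- The Hessian matrix `∂²f/∂θ∂θ'` (derivatives within `Θ`; the usual ones at interior points). -/
def hessian (f : Vec m → ℝ) (Θ : Set (Vec m)) (θ : Vec m) : Matrix (Fin m) (Fin m) ℝ :=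
  Matrix.of fun i j => fderivWithin ℝ (fderivWithin ℝ f Θ) Θ θ
    (EuclideanSpace.single i 1) (EuclideanSpace.single j 1)

/-- The score contribution `s_t(θ, W_t) = (∂λ_t(θ)/∂θ) W_t e_t(θ) ∈ ℝ^m`, where row `i` of the
`m × d` matrix `∂λ_t(θ)/∂θ` is the partial derivative of `λ_t` in `θ_i`. -/
def score (lam : (ℕ → Vec d) → Vec m → Vec d) (Y : ℤ → Ω → Vec d)
    (W : ℤ → Ω → Matrix (Fin d) (Fin d) ℝ) (Θ : Set (Vec m)) (t : ℤ) (ω : Ω) (θ : Vec m) :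
    Fin m → ℝ :=
  (Matrix.of fun (i : Fin m) (j : Fin d) =>
      (fderivWithin ℝ (lam (past Y t ω)) Θ θ (EuclideanSpace.single i 1)) j) *ᵥ
    (W t ω *ᵥ (resid lam Y t ω θ).ofLp)

/-- `sup_{τ ∈ 𝒯} ⦀∂k_t(τ)/∂τ⦀`, with values in `[0, ∞]`. -/
def supDk (ν : (ℕ → Vec d) → Param m q → Fin d → ℝ)
    (P : Param m q → Matrix (Fin d) (Fin d) ℝ) (Y : ℤ → Ω → Vec d) (Θ : Set (Vec m))
    (Γ : Set (Vec q)) (t : ℤ) (ω : Ω) : ℝ≥0∞ :=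
  ⨆ τ ∈ paramSpace Θ Γ, ‖fderivWithin ℝ (kvec ν P Y t ω) (paramSpace Θ Γ) τ‖ₑ

/-- `Z_t = sup_𝒯 ⦀∂k_t(τ)/∂τ⦀ · sup_Θ ⦀e_t(θ) e_t(θ)'⦀`. -/
def Zvar (lam : (ℕ → Vec d) → Vec m → Vec d) (ν : (ℕ → Vec d) → Param m q → Fin d → ℝ)
    (P : Param m q → Matrix (Fin d) (Fin d) ℝ) (Y : ℤ → Ω → Vec d) (Θ : Set (Vec m))
    (Γ : Set (Vec q)) (t : ℤ) (ω : Ω) : ℝ≥0∞ :=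
  supDk ν P Y Θ Γ t ω *
    ⨆ θ ∈ Θ, ‖Matrix.vecMulVec (resid lam Y t ω θ).ofLp (resid lam Y t ω θ).ofLp‖ₑ

/-- `X_t = sup_𝒯 ⦀∂k_t(τ)/∂τ⦀ · sup_Θ ⦀∂λ_t(θ)/∂θ'⦀ · sup_Θ ‖e_t(θ)‖`. -/
def Xvar (lam : (ℕ → Vec d) → Vec m → Vec d) (ν : (ℕ → Vec d) → Param m q → Fin d → ℝ)
    (P : Param m q → Matrix (Fin d) (Fin d) ℝ) (Y : ℤ → Ω → Vec d) (Θ : Set (Vec m))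
    (Γ : Set (Vec q)) (t : ℤ) (ω : Ω) : ℝ≥0∞ :=
  supDk ν P Y Θ Γ t ω * (⨆ θ ∈ Θ, ‖fderivWithin ℝ (lam (past Y t ω)) Θ θ‖ₑ) *
    ⨆ θ ∈ Θ, ‖resid lam Y t ω θ‖ₑ

variable [MeasurableSpace Ω]

/-- The conditional mean model: `Y_t` is integrable and `E(Y_t | ℱ_{t-1}) = λ_t(θ₀)` a.s. -/
def MeanModel (μ : Measure Ω) (lam : (ℕ → Vec d) → Vec m → Vec d) (Y : ℤ → Ω → Vec d)
    (θ₀ : Vec m) : Prop :=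
  ∀ t, Integrable (Y t) μ ∧ μ[Y t | history Y (t - 1)] =ᵐ[μ] fun ω => lam (past Y t ω) θ₀

/-- `E sup_{θ ∈ Θ} |l_t(θ, W_t)| < ∞`. -/
def LossMoment (μ : Measure Ω) (lam : (ℕ → Vec d) → Vec m → Vec d) (Y : ℤ → Ω → Vec d)
    (W : ℤ → Ω → Matrix (Fin d) (Fin d) ℝ) (Θ : Set (Vec m)) : Prop :=
  ∀ t, ∫⁻ ω, ⨆ θ ∈ Θ, ‖loss lam Y W t ω θ‖ₑ ∂μ < ∞

/-- `W_t > 0` a.s. for all `t`. -/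
def PosDefWeights (μ : Measure Ω) (W : ℤ → Ω → Matrix (Fin d) (Fin d) ℝ) : Prop :=
  ∀ t, ∀ᵐ ω ∂μ, (W t ω).PosDef

/-- `λ_t(θ) = λ_t(θ₀)` a.s. if and only if `θ = θ₀`. -/
def Identified (μ : Measure Ω) (lam : (ℕ → Vec d) → Vec m → Vec d) (Y : ℤ → Ω → Vec d)
    (Θ : Set (Vec m)) (θ₀ : Vec m) : Prop :=
  ∀ t, ∀ θ ∈ Θ, (∀ᵐ ω ∂μ, lam (past Y t ω) θ = lam (past Y t ω) θ₀) ↔ θ = θ₀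

/-- `H(θ₀, W) = E[-∂s_t(θ₀, W_t)/∂θ'] = ½ E[∂²l_t(θ₀, W_t)/∂θ∂θ']` (the gradient of `l_t` is
`-2 s_t`); by stationarity the time index is immaterial, and `t = 0` is used. -/
def Hmat (μ : Measure Ω) (lam : (ℕ → Vec d) → Vec m → Vec d) (Y : ℤ → Ω → Vec d)
    (W : ℤ → Ω → Matrix (Fin d) (Fin d) ℝ) (Θ : Set (Vec m)) (θ₀ : Vec m) :
    Matrix (Fin m) (Fin m) ℝ :=
  Matrix.of fun i j => (1 / 2 : ℝ) * ∫ ω, hessian (loss lam Y W 0 ω) Θ θ₀ i j ∂μ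

/-- `I(θ₀, W) = E[s_t(θ₀, W_t) s_t(θ₀, W_t)']`, again with `t = 0`. -/
def Imat (μ : Measure Ω) (lam : (ℕ → Vec d) → Vec m → Vec d) (Y : ℤ → Ω → Vec d)
    (W : ℤ → Ω → Matrix (Fin d) (Fin d) ℝ) (Θ : Set (Vec m)) (θ₀ : Vec m) :
    Matrix (Fin m) (Fin m) ℝ :=
  Matrix.of fun i j => ∫ ω, score lam Y W Θ 0 ω θ₀ i * score lam Y W Θ 0 ω θ₀ j ∂μ

/-- `H(θ₀, W)` and `I(θ₀, W)` exist, and `H(θ₀, W) > 0`. -/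
def InfoMatrices (μ : Measure Ω) (lam : (ℕ → Vec d) → Vec m → Vec d) (Y : ℤ → Ω → Vec d)
    (W : ℤ → Ω → Matrix (Fin d) (Fin d) ℝ) (Θ : Set (Vec m)) (θ₀ : Vec m) : Prop :=
  (∀ i j, Integrable (fun ω => hessian (loss lam Y W 0 ω) Θ θ₀ i j) μ) ∧
  (∀ i j, Integrable
    (fun ω => score lam Y W Θ 0 ω θ₀ i * score lam Y W Θ 0 ω θ₀ j) μ) ∧
  (Hmat μ lam Y W Θ θ₀).PosDef

/-- `λ_t` is a.s. twice continuously differentiable on `Θ`, and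
`E sup_{θ ∈ Θ} ⦀∂²l_t(θ, W_t)/∂θ∂θ'⦀ < ∞`. -/
def SecondDerivMoment (μ : Measure Ω) (lam : (ℕ → Vec d) → Vec m → Vec d)
    (Y : ℤ → Ω → Vec d) (W : ℤ → Ω → Matrix (Fin d) (Fin d) ℝ) (Θ : Set (Vec m)) : Prop :=
  ∀ t, (∀ᵐ ω ∂μ, ContDiffOn ℝ 2 (lam (past Y t ω)) Θ) ∧
    ∫⁻ ω, ⨆ θ ∈ Θ, ‖hessian (loss lam Y W t ω) Θ θ‖ₑ ∂μ < ∞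

/-- `‖τ̂ - τ₀‖ X_t = O(t^{-δ})` a.s. for some `δ > 1/2`. Here `τ̂ = τ̂_T` is computed from the
sample of size `T`, and the bound is uniform over `1 ≤ t ≤ T`, for all large `T`. -/
def WeightRate (μ : Measure Ω) (lam : (ℕ → Vec d) → Vec m → Vec d)
    (ν : (ℕ → Vec d) → Param m q → Fin d → ℝ)
    (P : Param m q → Matrix (Fin d) (Fin d) ℝ) (Y : ℤ → Ω → Vec d) (Θ : Set (Vec m))
    (Γ : Set (Vec q)) (τhat : ℕ → Ω → Param m q) (τ₀ : Param m q) : Prop :=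
  ∃ δ : ℝ, 1 / 2 < δ ∧ ∀ᵐ ω ∂μ, ∃ C : ℝ, ∀ᶠ T : ℕ in atTop, ∀ t ∈ Finset.Icc 1 T,
    ‖τhat T ω - τ₀‖ₑ * Xvar lam ν P Y Θ Γ (t : ℤ) ω ≤ ENNReal.ofReal (C * (t : ℝ) ^ (-δ))

/-- The asymptotic covariance `G(θ₀, W) = H⁻¹ I H⁻¹`. -/
def Gmat (μ : Measure Ω) (lam : (ℕ → Vec d) → Vec m → Vec d) (Y : ℤ → Ω → Vec d)
    (W : ℤ → Ω → Matrix (Fin d) (Fin d) ℝ) (Θ : Set (Vec m)) (θ₀ : Vec m) :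
    Matrix (Fin m) (Fin m) ℝ :=
  (Hmat μ lam Y W Θ θ₀)⁻¹ * Imat μ lam Y W Θ θ₀ * (Hmat μ lam Y W Θ θ₀)⁻¹

end Basics

end

end MWLSE

/-! Consistency. Write `e_t(θ) = e_t(θ₀) + Δ_t`, where `Δ_t = λ_t(θ₀) - λ_t(θ)` depends on the past
only. For weights `W_t` that depend on the past, the cross term `Δ_t' W_t e_t(θ₀)` has mean zero, so
the limit criterion at `θ` exceeds its value at `θ₀` by `E Δ_t' W_t Δ_t`. This is positive for `θ ≠
θ₀` by positive definiteness and identification (`integral_loss_lt`). A uniform ergodic law of large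
numbers on the compact set `Θ` turns this well-separated minimum into a.s. convergence of minimizers
(`ae_tendsto_argmin`). This applies directly to the first step. Hence `τ̂ → τ₀`, and by the mean
value inequality the second-step criterion differs from the one with weights `V_t(τ₀)⁻¹` by at most
`‖τ̂ - τ₀‖` times an average of integrable terms. That difference vanishes uniformly, and the same
consistency lemma applies again.

Asymptotic normality. At an interior minimizer the score with estimated weights vanishes. By the
rate assumption, exchanging the weights for the limiting ones costs at most `C ∑ t^{-δ} = o(√T)`
(`ae_tendsto_score_estimator`). Linearizing the score at `θ₀`, with a uniform law of large numbers
for the Hessian, gives `S_T = H u_T + o(1 + ‖u_T‖)`, where `u_T = √T (θ̂ - θ₀)` and `S_T` is the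
normalized score at `θ₀`. Inverting `H` absorbs the part of the error that involves `u_T`, so no
prior tightness of `u_T` is needed (`tendsto_normalized_error`). Slutsky's theorem then transfers
the limit law of `H⁻¹ S_T`.

The scores are stationary ergodic martingale differences with finite variance, and their limit law
follows from McLeish's method: factor `e^{ix} = (1 + ix) r(x)` with `r(x) ≈ e^{-x²/2}`. The product
of the first factors has mean one, and after stopping it is bounded in `L²`; the product of the
second converges by the ergodic theorem for the squares. All strong laws rest on Birkhoff's theorem,
deduced from the maximal ergodic theorem. -/

namespace MWLSE

/-! ### The pointwise ergodic theorem -/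

section Birkhoff

variable {α : Type*} {T : α → α} {f : α → ℝ}

/-- `maxSum T f n x = max_{0 ≤ k ≤ n} ∑_{j < k} f (T^j x)`. -/
noncomputable def maxSum (T : α → α) (f : α → ℝ) : ℕ → α → ℝ
  | 0, _ => 0
  | n + 1, x => max 0 (f x + maxSum T f n (T x))

theorem maxSum_nonneg (n : ℕ) (x : α) : 0 ≤ maxSum T f n x := by
  cases n <;> simp [maxSum]

theorem maxSum_le_succ (n : ℕ) (x : α) : maxSum T f n x ≤ maxSum T f (n + 1) x := by
  induction n generalizing x with
  | zero => simp [maxSum]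
  | succ n ih =>
    rw [maxSum, maxSum]
    gcongr
    exact ih _

theorem monotone_maxSum (x : α) : Monotone fun n => maxSum T f n x :=
  monotone_nat_of_le_succ fun n => maxSum_le_succ n x

theorem birkhoffSum_le_maxSum (n : ℕ) (x : α) : birkhoffSum T f n x ≤ maxSum T f n x := by
  induction n generalizing x with
  | zero => simp [maxSum, birkhoffSum]
  | succ n ih =>
    rw [birkhoffSum_succ', maxSum]
    exact le_max_of_le_right (by gcongr; exact ih _)

variable [MeasurableSpace α] {μ : Measure α}

theorem measurable_maxSum (hT : Measurable T) (hf : Measurable f) (n : ℕ) :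
    Measurable (maxSum T f n) := by
  induction n with
  | zero => exact measurable_const
  | succ n ih => exact measurable_const.max (hf.add (ih.comp hT))

theorem integrable_maxSum (hT : MeasurePreserving T μ μ) (hf : Integrable f μ) (n : ℕ) :
    Integrable (maxSum T f n) μ := by
  induction n with
  | zero => exact integrable_zero _ _ _
  | succ n ih =>
    exact (integrable_zero _ _ _).sup (hf.add (hT.integrable_comp_of_integrable ih))

/-- The maximal ergodic theorem. -/
theorem setIntegral_maxSum_pos_nonneg (hT : MeasurePreserving T μ μ) (hfm : Measurable f)
    (hf : Integrable f μ) (n : ℕ) : 0 ≤ ∫ x in {x | 0 < maxSum T f n x}, f x ∂μ := by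
  have hm := measurable_maxSum hT.measurable hfm n
  have hi := integrable_maxSum hT hf n
  have hiT := hT.integrable_comp_of_integrable hi
  have hs : MeasurableSet {x | 0 < maxSum T f n x} := measurableSet_lt measurable_const hm
  have h0 : ∫ x, (maxSum T f n x - maxSum T f n (T x)) ∂μ = 0 := by
    have : ∫ x, maxSum T f n (T x) ∂μ = ∫ x, maxSum T f n x ∂μ := by
      have := integral_map (μ := μ) hT.measurable.aemeasurable
        (f := maxSum T f n) (by rw [hT.map_eq]; exact hi.1)
      rw [← this, hT.map_eq]
    rw [integral_sub (g := fun x => maxSum T f n (T x)) hi hiT, this, sub_self]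
  rw [← integral_indicator hs]
  refine h0.symm.le.trans ?_
  -- With `M = maxSum T f n`, the claim is `M - M ∘ T ≤ f` on `{M > 0}` and `M - M ∘ T ≤ 0` off it;
  -- the left side has integral zero by invariance.
  refine integral_mono (hi.sub hiT) (hf.indicator hs) fun x => ?_
  by_cases hx : 0 < maxSum T f n x
  · rw [Set.indicator_of_mem (by exact hx)]
    cases n with
    | zero => simp [maxSum] at hx
    | succ n =>
      have h1 : maxSum T f (n + 1) x = f x + maxSum T f n (T x) := by
        rw [maxSum] at hx ⊢
        rcases lt_max_iff.1 hx with h | h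
        · exact absurd h (lt_irrefl _)
        · exact max_eq_right h.le
      have h2 := maxSum_le_succ (T := T) (f := f) n (T x)
      simp only
      linarith
  · rw [Set.indicator_of_notMem (by exact hx)]
    have := maxSum_nonneg (T := T) (f := f) n (T x)
    simp only
    linarith

/-- The set where the maximal sums are unbounded is invariant, hence null or full. Were it full, the
sets in the maximal ergodic theorem would exhaust the space and give `0 ≤ ∫ f`. -/
theorem ae_exists_birkhoffSum_le [IsProbabilityMeasure μ] (hT : Ergodic T μ)
    (hfm : Measurable f) (hf : Integrable f μ) (hneg : ∫ x, f x ∂μ < 0) :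
    ∀ᵐ x ∂μ, ∃ C, ∀ n, birkhoffSum T f n x ≤ C := by
  set A : Set α := {x | ∀ C : ℕ, ∃ n, (C : ℝ) < maxSum T f n x} with hA
  have hAm : MeasurableSet A := by
    rw [hA]
    simp only [Set.ofPred_forall, Set.ofPred_exists]
    exact MeasurableSet.iInter fun C => MeasurableSet.iUnion fun n =>
      measurableSet_lt measurable_const (measurable_maxSum hT.measurable hfm n)
  -- The recursion changes the maximal sums at `x` and at `T x` by a quantity bounded in terms of `f
  -- x`, which does not affect unboundedness.
  have hAinv : T ⁻¹' A = A := by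
    ext x
    simp only [hA, Set.mem_preimage, Set.mem_ofPred_eq]
    constructor
    · intro h C
      obtain ⟨K, hK⟩ := exists_nat_gt (C - f x)
      obtain ⟨n, hn⟩ := h K
      exact ⟨n + 1, by rw [maxSum]; exact lt_max_of_lt_right (by linarith)⟩
    · intro h C
      obtain ⟨K, hK⟩ := exists_nat_gt (C + |f x|)
      obtain ⟨n, hn⟩ := h K
      cases n with
      | zero =>
        have : (0 : ℝ) ≤ C := Nat.cast_nonneg C
        have := abs_nonneg (f x)
        simp only [maxSum] at hn
        linarith
      | succ n =>
        refine ⟨n, ?_⟩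
        rw [maxSum] at hn
        have : (0 : ℝ) ≤ C := Nat.cast_nonneg C
        have h1 := abs_nonneg (f x)
        have h2 := le_abs_self (f x)
        rcases lt_max_iff.1 hn with h | h <;> linarith
  rcases hT.toPreErgodic.ae_mem_or_ae_notMem hAm hAinv with h | h
  · exfalso
    have hlim : Tendsto (fun n => ∫ x in {x | 0 < maxSum T f n x}, f x ∂μ) atTop
        (𝓝 (∫ x, f x ∂μ)) := by
      have hs : ∀ n, MeasurableSet {x | 0 < maxSum T f n x} := fun n =>
        measurableSet_lt measurable_const (measurable_maxSum hT.measurable hfm n)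
      simp_rw [← fun n => integral_indicator (f := f) (μ := μ) (hs n)]
      refine tendsto_integral_of_dominated_convergence (fun x => |f x|)
        (fun n => (hf.indicator (hs n)).1) hf.abs (fun n => ae_of_all _ fun x => ?_) ?_
      · by_cases hx : x ∈ {x | 0 < maxSum T f n x} <;> simp [Set.indicator, hx]
      · filter_upwards [h] with x hx
        obtain ⟨n, hn⟩ := hx 0
        refine tendsto_const_nhds.congr' ?_
        filter_upwards [eventually_ge_atTop n] with k hk
        rw [Set.indicator_of_mem]
        have := monotone_maxSum (T := T) (f := f) x hk
        simp only [Nat.cast_zero] at hn this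
        exact lt_of_lt_of_le hn this
    have := ge_of_tendsto' hlim
      (setIntegral_maxSum_pos_nonneg hT.toMeasurePreserving hfm hf)
    linarith
  · filter_upwards [h] with x hx
    simp only [hA, Set.mem_ofPred_eq, not_forall, not_exists, not_lt] at hx
    obtain ⟨C, hC⟩ := hx
    exact ⟨C, fun n => (birkhoffSum_le_maxSum n x).trans (hC n)⟩

/-- After subtracting `∫ f + ε/2` the mean is negative, so the Birkhoff sums are bounded above;
dividing by `n` makes the bound negligible. -/
theorem ae_eventually_birkhoffAverage_lt [IsProbabilityMeasure μ] (hT : Ergodic T μ)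
    (hfm : Measurable f) (hf : Integrable f μ) {ε : ℝ} (hε : 0 < ε) :
    ∀ᵐ x ∂μ, ∀ᶠ n : ℕ in atTop, birkhoffAverage ℝ T f n x < ∫ x, f x ∂μ + ε := by
  set c := ∫ x, f x ∂μ + ε / 2 with hc
  have hneg : ∫ x, (f x - c) ∂μ < 0 := by
    rw [integral_sub hf (integrable_const _)]
    simp [hc, hε]
  filter_upwards [ae_exists_birkhoffSum_le hT (hfm.sub_const c) (hf.sub (integrable_const c)) hneg]
    with x ⟨C, hC⟩
  have hlim : Tendsto (fun n : ℕ => C / n) atTop (𝓝 0) := tendsto_const_div_atTop_nhds_zero_nat C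
  filter_upwards [hlim.eventually_lt_const (half_pos hε), eventually_gt_atTop 0] with n hn hn0
  have hn' : (0 : ℝ) < n := by exact_mod_cast hn0
  have h := hC n
  have hsum : birkhoffSum T (fun x => f x - c) n x = birkhoffSum T f n x - n * c := by
    simp [birkhoffSum, Finset.sum_sub_distrib]
  rw [hsum] at h
  rw [birkhoffAverage, smul_eq_mul, inv_mul_lt_iff₀ hn']
  rw [div_lt_iff₀ hn'] at hn
  rw [hc] at h
  nlinarith

/-- The pointwise ergodic theorem for an ergodic transformation. -/
theorem ae_tendsto_birkhoffAverage [IsProbabilityMeasure μ] (hT : Ergodic T μ)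
    (hfm : Measurable f) (hf : Integrable f μ) :
    ∀ᵐ x ∂μ, Tendsto (fun n => birkhoffAverage ℝ T f n x) atTop (𝓝 (∫ x, f x ∂μ)) := by
  have h1 : ∀ᵐ x ∂μ, ∀ k : ℕ, ∀ᶠ n : ℕ in atTop,
      birkhoffAverage ℝ T f n x < ∫ x, f x ∂μ + 1 / ((k : ℝ) + 1) :=
    ae_all_iff.2 fun k => ae_eventually_birkhoffAverage_lt hT hfm hf Nat.one_div_pos_of_nat
  have h2 : ∀ᵐ x ∂μ, ∀ k : ℕ, ∀ᶠ n : ℕ in atTop,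
      birkhoffAverage ℝ T (fun x => - f x) n x < ∫ x, - f x ∂μ + 1 / ((k : ℝ) + 1) :=
    ae_all_iff.2 fun k => ae_eventually_birkhoffAverage_lt hT hfm.neg hf.neg
      Nat.one_div_pos_of_nat
  filter_upwards [h1, h2] with x hx1 hx2
  rw [Metric.tendsto_nhds]
  intro ε hε
  obtain ⟨k, hk⟩ := exists_nat_one_div_lt hε
  filter_upwards [hx1 k, hx2 k] with n hn1 hn2
  have : birkhoffAverage ℝ T (fun x => - f x) n x = - birkhoffAverage ℝ T f n x := by
    simp [birkhoffAverage, birkhoffSum]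
  rw [this, integral_neg] at hn2
  rw [Real.dist_eq, abs_lt]
  constructor <;> linarith

end Birkhoff

/-! ### A central limit theorem for martingale differences -/

section ProductApproximation

theorem one_le_norm_one_add_mul_I (x : ℝ) : 1 ≤ ‖(1 : ℂ) + x * Complex.I‖ := by
  have := Complex.abs_re_le_norm ((1 : ℂ) + x * Complex.I)
  simpa using this

theorem norm_one_add_mul_I_sq (x : ℝ) : ‖(1 : ℂ) + x * Complex.I‖ ^ 2 = 1 + x ^ 2 := by
  rw [← Complex.normSq_eq_norm_sq, Complex.normSq_apply]
  simp
  ring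

/-- The square of the left side is `(1 + x²) e^{-x²}`, and `1 + x² ≤ e^{x²}`. -/
theorem norm_one_add_mul_I_mul_exp_le (x : ℝ) :
    ‖(1 : ℂ) + x * Complex.I‖ * Real.exp (-x ^ 2 / 2) ≤ 1 := by
  refine (sq_le_one_iff₀ (by positivity)).1 ?_
  rw [mul_pow, norm_one_add_mul_I_sq, ← Real.exp_nat_mul]
  have h : ((2 : ℕ) : ℝ) * (-x ^ 2 / 2) = - x ^ 2 := by push_cast; ring
  rw [h]
  calc (1 + x ^ 2) * Real.exp (-x ^ 2) ≤ Real.exp (x ^ 2) * Real.exp (-x ^ 2) := by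
        gcongr
        linarith [Real.add_one_le_exp (x ^ 2)]
    _ = 1 := by rw [← Real.exp_add]; simp

/-- For `|x| ≤ 1` the two expressions agree to second order in Taylor's formula, and the remainders
add up to at most `(2/9 + 1/4 + 1) |x|³`. For `|x| ≥ 1` both have norm at most one. -/
theorem norm_exp_mul_I_sub_le (x : ℝ) :
    ‖Complex.exp (x * Complex.I) - (1 + x * Complex.I) * Real.exp (-x ^ 2 / 2)‖
      ≤ 2 * |x| ^ 3 := by
  rcases le_total |x| 1 with hx | hx
  · have hxI : ‖(x * Complex.I : ℂ)‖ = |x| := by simp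
    have h1 := Complex.exp_bound (x := x * Complex.I) (by rw [hxI]; exact hx)
      (n := 3) (by norm_num)
    rw [hxI] at h1
    have hsum : (∑ m ∈ Finset.range 3, (x * Complex.I : ℂ) ^ m / (m.factorial : ℂ))
        = 1 + x * Complex.I - (x ^ 2 / 2 : ℝ) := by
      simp [Finset.sum_range_succ, mul_pow, Nat.factorial]
      ring
    rw [hsum] at h1
    set y : ℝ := -x ^ 2 / 2 with hy
    have hx2 : |x| ^ 2 = x ^ 2 := sq_abs x
    have hy1 : |y| ≤ 1 := by
      rw [hy, abs_div, abs_neg, abs_pow, abs_two]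
      nlinarith [abs_nonneg x]
    have h2 := Real.abs_exp_sub_one_sub_id_le hy1
    have h3 := Real.abs_exp_sub_one_le hy1
    have hdec : Complex.exp (x * Complex.I) - (1 + x * Complex.I) * Real.exp y
        = (Complex.exp (x * Complex.I) - (1 + x * Complex.I - (x ^ 2 / 2 : ℝ)))
          - ((Real.exp y - 1 - y : ℝ) : ℂ) - x * Complex.I * ((Real.exp y - 1 : ℝ) : ℂ) := by
      rw [hy]; push_cast; ring
    rw [hdec]
    refine (norm_sub_le _ _).trans ((add_le_add_left (norm_sub_le _ _) _).trans ?_)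
    rw [norm_mul, hxI, Complex.norm_real, Complex.norm_real, Real.norm_eq_abs, Real.norm_eq_abs]
    have hay : |y| = |x| ^ 2 / 2 := by
      rw [hy, abs_div, abs_neg, abs_pow, abs_two]
    have hyy : y ^ 2 = |x| ^ 4 / 4 := by rw [← sq_abs, hay]; ring
    rw [hay] at h3
    rw [hyy] at h2
    have h4 : |x| * |Real.exp y - 1| ≤ |x| * (2 * (|x| ^ 2 / 2)) := by gcongr
    have h5 : |x| ^ 4 ≤ |x| ^ 3 := pow_le_pow_of_le_one (abs_nonneg x) hx (by norm_num)
    have h6 : 0 ≤ |x| ^ 3 := by positivity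
    have h7 : |x| ^ 3 * (((Nat.succ 3 : ℕ) : ℝ) * ((Nat.factorial 3 : ℝ) * (3 : ℕ))⁻¹)
        = |x| ^ 3 * (2 / 9) := by norm_num [Nat.factorial]
    rw [h7] at h1
    nlinarith
  · have h1 : (1 : ℝ) ≤ |x| ^ 3 := one_le_pow₀ hx
    refine (norm_sub_le _ _).trans ?_
    rw [Complex.norm_exp_ofReal_mul_I, norm_mul, Complex.norm_real, Real.norm_eq_abs, Real.abs_exp]
    have := norm_one_add_mul_I_mul_exp_le x
    linarith

/-- Telescoping: one factor is exchanged at a time, and the remaining factors have norm at most one.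
-/
theorem norm_prod_sub_prod_le_sum {n : ℕ} {a b : ℕ → ℂ} (ha : ∀ j, ‖a j‖ ≤ 1)
    (hb : ∀ j, ‖b j‖ ≤ 1) :
    ‖∏ j ∈ Finset.range n, a j - ∏ j ∈ Finset.range n, b j‖
      ≤ ∑ j ∈ Finset.range n, ‖a j - b j‖ := by
  induction n with
  | zero => simp
  | succ n ih =>
    rw [Finset.prod_range_succ, Finset.prod_range_succ, Finset.sum_range_succ]
    have hdec : (∏ j ∈ Finset.range n, a j) * a n - (∏ j ∈ Finset.range n, b j) * b n
        = (∏ j ∈ Finset.range n, a j - ∏ j ∈ Finset.range n, b j) * a n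
          + (∏ j ∈ Finset.range n, b j) * (a n - b n) := by ring
    rw [hdec]
    refine (norm_add_le _ _).trans ?_
    rw [norm_mul, norm_mul]
    have hp : ‖∏ j ∈ Finset.range n, b j‖ ≤ 1 := by
      rw [norm_prod]
      exact Finset.prod_le_one (fun _ _ => norm_nonneg _) fun j _ => hb j
    have h1 := mul_le_mul_of_nonneg_left (ha n)
      (norm_nonneg (∏ j ∈ Finset.range n, a j - ∏ j ∈ Finset.range n, b j))
    have h2 := mul_le_mul_of_nonneg_right hp (norm_nonneg (a n - b n))
    linarith

/-- `e^{ix} / (1 + ix)`. -/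
noncomputable def expRatio (x : ℝ) : ℂ := Complex.exp (x * Complex.I) / (1 + x * Complex.I)

theorem one_add_mul_I_ne_zero (x : ℝ) : (1 : ℂ) + x * Complex.I ≠ 0 :=
  norm_pos_iff.1 (zero_lt_one.trans_le (one_le_norm_one_add_mul_I x))

theorem norm_expRatio_le (x : ℝ) : ‖expRatio x‖ ≤ 1 := by
  rw [expRatio, norm_div, Complex.norm_exp_ofReal_mul_I]
  exact div_le_one_of_le₀ (one_le_norm_one_add_mul_I x) (norm_nonneg _)

theorem norm_expRatio_sub_le (x : ℝ) :
    ‖expRatio x - Real.exp (-x ^ 2 / 2)‖ ≤ 2 * |x| ^ 3 := by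
  have h : expRatio x - Real.exp (-x ^ 2 / 2)
      = (Complex.exp (x * Complex.I) - (1 + x * Complex.I) * Real.exp (-x ^ 2 / 2))
        / (1 + x * Complex.I) := by
    rw [expRatio, sub_div, mul_div_cancel_left₀ _ (one_add_mul_I_ne_zero x)]
  rw [h, norm_div]
  exact (div_le_self (norm_nonneg _) (one_le_norm_one_add_mul_I x)).trans
    (norm_exp_mul_I_sub_le x)

theorem norm_prod_expRatio_sub_le (n : ℕ) (x : ℕ → ℝ) :
    ‖∏ j ∈ Finset.range n, expRatio (x j)
        - Real.exp (-(∑ j ∈ Finset.range n, x j ^ 2) / 2)‖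
      ≤ 2 * ∑ j ∈ Finset.range n, |x j| ^ 3 := by
  have h : (Real.exp (-(∑ j ∈ Finset.range n, x j ^ 2) / 2) : ℂ)
      = ∏ j ∈ Finset.range n, ((Real.exp (-(x j) ^ 2 / 2) : ℝ) : ℂ) := by
    rw [← Complex.ofReal_prod, ← Real.exp_sum, ← Finset.sum_div, Finset.sum_neg_distrib]
  rw [h, Finset.mul_sum]
  refine (norm_prod_sub_prod_le_sum (fun j => norm_expRatio_le _) fun j => ?_).trans
    (Finset.sum_le_sum fun j _ => norm_expRatio_sub_le _)
  rw [Complex.norm_real, Real.norm_eq_abs, Real.abs_exp]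
  exact Real.exp_le_one_iff.2 (by nlinarith [sq_nonneg (x j)])

end ProductApproximation

section Sequences

/-- Cesàro convergence of the squares makes the normalized third powers negligible. -/
theorem tendsto_sum_abs_div_sqrt_cube {x : ℕ → ℝ} {v : ℝ}
    (h : Tendsto (fun n : ℕ => (∑ j ∈ Finset.range n, x j ^ 2) / n) atTop (𝓝 v)) :
    Tendsto (fun n : ℕ => ∑ j ∈ Finset.range n, |x j / √n| ^ 3) atTop (𝓝 0) := by
  -- The last term of a convergent Cesàro sequence is the difference of two consecutive means, up to
  -- the factor `(n + 1) / n`.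
  have hlast : Tendsto (fun n : ℕ => x n ^ 2 / n) atTop (𝓝 0) := by
    have h1 : Tendsto (fun n : ℕ => (∑ j ∈ Finset.range (n + 1), x j ^ 2) / ((n + 1 : ℕ) : ℝ))
        atTop (𝓝 v) := h.comp (tendsto_add_atTop_nat 1)
    have h2 : Tendsto (fun n : ℕ => (((n + 1 : ℕ) : ℝ) / n)) atTop (𝓝 1) := by
      have : Tendsto (fun n : ℕ => (1 : ℝ) + 1 / n) atTop (𝓝 (1 + 0)) :=
        tendsto_const_nhds.add tendsto_one_div_atTop_nhds_zero_nat
      rw [add_zero] at this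
      refine this.congr' ?_
      filter_upwards [eventually_gt_atTop 0] with n hn
      have : (n : ℝ) ≠ 0 := by positivity
      push_cast
      field_simp
    have h3 := (h1.mul h2).sub h
    rw [mul_one, sub_self] at h3
    refine h3.congr' ?_
    filter_upwards [eventually_gt_atTop 0] with n hn
    have : (n : ℝ) ≠ 0 := by positivity
    rw [Finset.sum_range_succ]
    have : ((n + 1 : ℕ) : ℝ) ≠ 0 := by positivity
    field_simp
    ring
  rw [Metric.tendsto_nhds]
  intro ε hε
  have hv : 0 < |v| + 1 := by positivity
  -- For `N ≤ j < n` the terms satisfy `|x j / √n| ≤ η`, so their cubes sum to at most `η` times the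
  -- mean square, which is eventually below `|v| + 1`. The finitely many earlier terms vanish as `n`
  -- grows.
  set η := ε / (2 * (|v| + 1)) with hη
  have hηpos : 0 < η := by positivity
  obtain ⟨N, hN⟩ := eventually_atTop.1
    ((hlast.eventually_lt_const (show 0 < η ^ 2 by positivity)).and (eventually_gt_atTop 0))
  have hhead : Tendsto (fun n : ℕ => (∑ j ∈ Finset.range N, |x j| ^ 3) / n) atTop (𝓝 0) :=
    tendsto_const_div_atTop_nhds_zero_nat _
  filter_upwards [hhead.eventually_lt_const (half_pos hε),
    h.eventually_lt_const (show v < |v| + 1 by linarith [le_abs_self v]),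
    eventually_ge_atTop N, eventually_ge_atTop 1] with n hn1 hn2 hnN hn
  have hn' : (1 : ℝ) ≤ n := by exact_mod_cast hn
  have hs1 : 1 ≤ √(n : ℝ) := Real.one_le_sqrt.2 hn'
  have hs : √(n : ℝ) ^ 2 = n := Real.sq_sqrt (by positivity)
  rw [Real.dist_eq, sub_zero, abs_of_nonneg (Finset.sum_nonneg fun _ _ => by positivity)]
  rw [← Finset.sum_range_add_sum_Ico _ hnN]
  have hA : ∑ j ∈ Finset.range N, |x j / √n| ^ 3 < ε / 2 := by
    refine lt_of_le_of_lt ?_ hn1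
    rw [Finset.sum_div]
    refine Finset.sum_le_sum fun j _ => ?_
    rw [abs_div, abs_of_nonneg (Real.sqrt_nonneg _), div_pow]
    gcongr
    calc (n : ℝ) = √(n : ℝ) ^ 2 := hs.symm
      _ ≤ √(n : ℝ) ^ 3 := pow_le_pow_right₀ hs1 (by norm_num)
  have hB : ∑ j ∈ Finset.Ico N n, |x j / √n| ^ 3 ≤ ε / 2 := by
    calc ∑ j ∈ Finset.Ico N n, |x j / √n| ^ 3
        ≤ ∑ j ∈ Finset.Ico N n, η * (x j ^ 2 / n) := by
          refine Finset.sum_le_sum fun j hj => ?_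
          obtain ⟨hj1, hj2⟩ := Finset.mem_Ico.1 hj
          obtain ⟨h1, h2⟩ := hN j hj1
          have hj0 : (0 : ℝ) < j := by exact_mod_cast h2
          have hjn : (j : ℝ) ≤ n := by exact_mod_cast hj2.le
          have hsq : |x j / √n| ^ 2 = x j ^ 2 / n := by rw [sq_abs, div_pow, hs]
          have hle : |x j / √n| ≤ η := by
            refine abs_le_of_sq_le_sq ?_ hηpos.le
            rw [div_pow, hs]
            refine le_trans ?_ h1.le
            gcongr
          rw [pow_succ, hsq, mul_comm]
          gcongr
      _ ≤ ∑ j ∈ Finset.range n, η * (x j ^ 2 / n) := by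
          refine Finset.sum_le_sum_of_subset_of_nonneg (fun j hj => ?_) fun _ _ _ => by positivity
          exact Finset.mem_range.2 (Finset.mem_Ico.1 hj).2
      _ = η * ((∑ j ∈ Finset.range n, x j ^ 2) / n) := by rw [← Finset.mul_sum, Finset.sum_div]
      _ ≤ η * (|v| + 1) := by gcongr
      _ = ε / 2 := by rw [hη]; field_simp
  linarith

end Sequences

/-! ### The stopped martingale product -/

section Stopped

/-- The normalized sequence `x k / √n`, stopped once the sum of the squares exceeds `c n`. -/
noncomputable def stopped (c : ℝ) (n : ℕ) (x : ℕ → ℝ) (k : ℕ) : ℝ :=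
  -- The test involves only indices below `k`, so the switch is predictable; the term that crosses
  -- the level is still kept.
  if ∑ j ∈ Finset.range k, x j ^ 2 ≤ c * n then x k / √n else 0

/-- The exponential-type martingale `∏_{j < k} (1 + i z_j)` of the stopped sequence. -/
noncomputable def stoppedProd (c : ℝ) (n : ℕ) (x : ℕ → ℝ) (k : ℕ) : ℂ :=
  ∏ j ∈ Finset.range k, (1 + stopped c n x j * Complex.I)

theorem stopped_sq_le (c : ℝ) (n : ℕ) (x : ℕ → ℝ) (k : ℕ) : stopped c n x k ^ 2 ≤ x k ^ 2 / n := by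
  unfold stopped
  split_ifs
  · rw [div_pow, Real.sq_sqrt (Nat.cast_nonneg n)]
  · rw [zero_pow two_ne_zero]
    positivity

theorem stopped_eq {c : ℝ} {n : ℕ} {x : ℕ → ℝ}
    (h : ∑ j ∈ Finset.range n, x j ^ 2 ≤ c * n) {k : ℕ} (hk : k ≤ n) :
    stopped c n x k = x k / √n := by
  refine if_pos (le_trans ?_ h)
  exact Finset.sum_le_sum_of_subset_of_nonneg (Finset.range_mono hk) fun _ _ _ => sq_nonneg _

theorem norm_stoppedProd_sq_le_exp (c : ℝ) (n : ℕ) (x : ℕ → ℝ) (k : ℕ) :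
    ‖stoppedProd c n x k‖ ^ 2 ≤ Real.exp ((∑ j ∈ Finset.range k, x j ^ 2) / n) := by
  rw [stoppedProd, norm_prod, ← Finset.prod_pow, Finset.sum_div, Real.exp_sum]
  refine Finset.prod_le_prod (fun _ _ => by positivity) fun j _ => ?_
  rw [norm_one_add_mul_I_sq]
  linarith [stopped_sq_le c n x j, Real.add_one_le_exp (x j ^ 2 / n)]

theorem norm_stoppedProd_sq_le_of_le {c : ℝ} {n : ℕ} (hn : 0 < n) {x : ℕ → ℝ} {k : ℕ}
    (h : ∑ j ∈ Finset.range k, x j ^ 2 ≤ c * n) :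
    ‖stoppedProd c n x k‖ ^ 2 ≤ Real.exp c := by
  refine (norm_stoppedProd_sq_le_exp c n x k).trans (Real.exp_le_exp.2 ?_)
  rwa [div_le_iff₀ (by exact_mod_cast hn)]

/-- The factors before the level is crossed contribute at most `e^c`, the crossing factor at most `1
+ x_k² / n`, and all later factors equal one. The bound is linear in the squares, so second moments
suffice to integrate it. -/
theorem norm_stoppedProd_sq_le {c : ℝ} (hc : 0 ≤ c) {n : ℕ} (hn : 0 < n) (x : ℕ → ℝ) (k : ℕ) :
    ‖stoppedProd c n x k‖ ^ 2
      ≤ Real.exp c * (1 + (∑ j ∈ Finset.range k, x j ^ 2) / n) := by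
  induction k with
  | zero => simp [stoppedProd, hc]
  | succ k ih =>
    have hmono : (∑ j ∈ Finset.range k, x j ^ 2) / (n : ℝ)
        ≤ (∑ j ∈ Finset.range (k + 1), x j ^ 2) / n := by
      rw [Finset.sum_range_succ]
      gcongr
      linarith [sq_nonneg (x k)]
    rw [stoppedProd, Finset.prod_range_succ, ← stoppedProd]
    by_cases h : ∑ j ∈ Finset.range k, x j ^ 2 ≤ c * n
    · rw [norm_mul, mul_pow, norm_one_add_mul_I_sq]
      have h0 : 0 ≤ (∑ j ∈ Finset.range k, x j ^ 2) / (n : ℝ) :=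
        div_nonneg (Finset.sum_nonneg fun _ _ => sq_nonneg _) (Nat.cast_nonneg n)
      have h1 : stopped c n x k ^ 2 ≤ (∑ j ∈ Finset.range (k + 1), x j ^ 2) / n := by
        rw [Finset.sum_range_succ, add_div]
        linarith [stopped_sq_le c n x k]
      exact mul_le_mul (norm_stoppedProd_sq_le_of_le hn h) (by linarith) (by positivity)
        (Real.exp_pos c).le
    · have h2 : stopped c n x k = 0 := if_neg h
      rw [h2]
      simp only [Complex.ofReal_zero, zero_mul, add_zero, mul_one]
      exact ih.trans (by gcongr)

theorem stoppedProd_mul_prod_expRatio (c : ℝ) (n : ℕ) (x : ℕ → ℝ) (k : ℕ) :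
    stoppedProd c n x k * ∏ j ∈ Finset.range k, expRatio (stopped c n x j)
      = Complex.exp ((∑ j ∈ Finset.range k, stopped c n x j : ℝ) * Complex.I) := by
  rw [stoppedProd, ← Finset.prod_mul_distrib, Complex.ofReal_sum, Finset.sum_mul, Complex.exp_sum]
  refine Finset.prod_congr rfl fun j _ => ?_
  rw [expRatio, mul_div_cancel₀ _ (one_add_mul_I_ne_zero _)]

variable {α : Type*} [MeasurableSpace α]

theorem measurable_stopped (c : ℝ) (n : ℕ) {X : ℕ → α → ℝ} {k : ℕ}
    (hX : ∀ j ≤ k, Measurable (X j)) : Measurable fun a => stopped c n (fun j => X j a) k := by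
  refine Measurable.ite (measurableSet_le ?_ measurable_const) ((hX k le_rfl).div_const _)
    measurable_const
  exact Finset.measurable_fun_sum _ fun j hj => (hX j (Finset.mem_range.1 hj).le).pow_const 2

theorem measurable_stoppedProd (c : ℝ) (n : ℕ) {X : ℕ → α → ℝ} {k : ℕ}
    (hX : ∀ j < k, Measurable (X j)) :
    Measurable fun a => stoppedProd c n (fun j => X j a) k := by
  refine Finset.measurable_fun_prod _ fun j hj => ?_
  have := measurable_stopped c n (k := j) (X := X)
    fun i hi => hX i (hi.trans_lt (Finset.mem_range.1 hj))
  fun_prop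

/-- This expression is the coefficient of `X k` in the increment of the product; it depends only on
the earlier variables. -/
theorem measurable_stoppedProd_ite (c : ℝ) (n : ℕ) (w : ℂ) {X : ℕ → α → ℝ} {k : ℕ}
    (hX : ∀ j < k, Measurable (X j)) :
    Measurable fun a => if ∑ j ∈ Finset.range k, X j a ^ 2 ≤ c * n then
      stoppedProd c n (fun j => X j a) k * w else 0 := by
  refine Measurable.ite (measurableSet_le ?_ measurable_const) ?_ measurable_const
  · exact Finset.measurable_fun_sum _ fun j hj => (hX j (Finset.mem_range.1 hj)).pow_const 2
  · exact (measurable_stoppedProd c n hX).mul_const _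

theorem measurable_expRatio : Measurable expRatio := by
  unfold expRatio
  fun_prop

end Stopped

/-! ### McLeish's argument -/

section MartingaleCLT

/-- A bilinear expression `B(f, g)` with `f` measurable and `E(g | m) = 0` has mean zero,
as soon as it is integrable. -/
theorem condExp_bilin_eq_zero {Ω E F G : Type*} {m mΩ : MeasurableSpace Ω} {μ : Measure Ω}
    [NormedAddCommGroup E] [NormedSpace ℝ E] [CompleteSpace E]
    [NormedAddCommGroup F] [NormedSpace ℝ F]
    [NormedAddCommGroup G] [NormedSpace ℝ G] [CompleteSpace G]
    (B : F →L[ℝ] E →L[ℝ] G) {f : Ω → F} {g : Ω → E} (hf : StronglyMeasurable[m] f)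
    (hfg : Integrable (fun ω => B (f ω) (g ω)) μ) (hg : Integrable g μ)
    (h0 : μ[g | m] =ᵐ[μ] 0) : μ[fun ω => B (f ω) (g ω) | m] =ᵐ[μ] 0 := by
  filter_upwards [condExp_bilin_of_stronglyMeasurable_left B hf hfg hg, h0] with ω h1 h2
  rw [h1, h2]
  simp

theorem integral_eq_zero_of_condExp_eq_zero {Ω G : Type*} {m mΩ : MeasurableSpace Ω}
    {μ : Measure Ω} [IsFiniteMeasure μ]
    [NormedAddCommGroup G] [NormedSpace ℝ G] [CompleteSpace G] (hm : m ≤ mΩ) {f : Ω → G}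
    (h : μ[f | m] =ᵐ[μ] 0) : ∫ ω, f ω ∂μ = 0 := by
  rw [← integral_condExp hm, integral_congr_ae h]
  simp

variable {Ω : Type*} {mΩ : MeasurableSpace Ω} {μ : Measure Ω} [IsProbabilityMeasure μ]
  {ℱ : Filtration ℕ mΩ} {X : ℕ → Ω → ℝ} {v : ℝ}

theorem integrable_stoppedProd {c : ℝ} (hc : 0 ≤ c) {n : ℕ} (hn : 0 < n)
    (hX : ∀ k, Measurable (X k)) (h2 : ∀ k, MemLp (X k) 2 μ) (k : ℕ) :
    Integrable (fun ω => ‖stoppedProd c n (fun j => X j ω) k‖ ^ 2) μ := by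
  have hm := measurable_stoppedProd c n (X := X) (k := k) fun j _ => hX j
  have hi : Integrable (fun ω => Real.exp c *
      (1 + (∑ j ∈ Finset.range k, X j ω ^ 2) / n)) μ :=
    ((integrable_const _).add
      ((integrable_finsetSum _ fun j _ => (h2 j).integrable_sq).div_const _)).const_mul _
  refine hi.mono' (hm.norm.pow_const 2).aestronglyMeasurable (ae_of_all _ fun ω => ?_)
  rw [Real.norm_of_nonneg (by positivity)]
  exact norm_stoppedProd_sq_le hc hn _ _

/-- The product is a martingale started at one: each increment is `X k` times a bounded variable
known at time `k`. -/
theorem integral_stoppedProd {c : ℝ} (hc : 0 ≤ c) {n : ℕ} (hn : 0 < n)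
    (hX : ∀ k, Measurable[ℱ (k + 1)] (X k)) (h2 : ∀ k, MemLp (X k) 2 μ)
    (hcond : ∀ k, μ[X k | ℱ k] =ᵐ[μ] 0) (k : ℕ) :
    ∫ ω, stoppedProd c n (fun j => X j ω) k ∂μ = 1 := by
  have hXm : ∀ k, Measurable (X k) := fun k => (hX k).mono (ℱ.le _) le_rfl
  have hinteg : ∀ k, Integrable (fun ω => stoppedProd c n (fun j => X j ω) k) μ := fun k => by
    have hm := measurable_stoppedProd c n (X := X) (k := k) fun j _ => hXm j
    have := (memLp_two_iff_integrable_sq_norm hm.aestronglyMeasurable).2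
      (integrable_stoppedProd hc hn hXm h2 k)
    exact this.integrable one_le_two
  induction k with
  | zero => simp [stoppedProd]
  | succ k ih =>
    -- As long as the level is not crossed, the product has norm at most `e^{c/2}`, which makes this
    -- coefficient bounded although the product itself need not be.
    set b : Ω → ℂ := fun ω => if ∑ j ∈ Finset.range k, X j ω ^ 2 ≤ c * n then
      stoppedProd c n (fun j => X j ω) k * (((√n)⁻¹ : ℝ) * Complex.I) else 0 with hb
    have hstep : ∀ ω, stoppedProd c n (fun j => X j ω) (k + 1)
        = stoppedProd c n (fun j => X j ω) k + X k ω • b ω := fun ω => by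
      rw [stoppedProd, Finset.prod_range_succ, ← stoppedProd]
      simp only [hb, stopped]
      split_ifs
      · rw [Complex.real_smul, div_eq_mul_inv]
        push_cast
        ring
      · simp
    have hadapt : ∀ j < k, Measurable[ℱ k] (X j) := fun j hj =>
      (hX j).mono (ℱ.mono hj) le_rfl
    have hbm : Measurable[ℱ k] b :=
      @measurable_stoppedProd_ite Ω (ℱ k) c n _ X k hadapt
    have hbb : ∀ ω, ‖b ω‖ ≤ √(Real.exp c) * ‖(((√n)⁻¹ : ℝ) * Complex.I : ℂ)‖ := fun ω => by
      simp only [hb]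
      split_ifs with h
      · rw [norm_mul]
        gcongr
        exact Real.le_sqrt_of_sq_le (norm_stoppedProd_sq_le_of_le hn h)
      · simp only [norm_zero]
        positivity
    have hXi := (h2 k).integrable one_le_two
    have hprod : Integrable (fun ω => X k ω • b ω) μ := by
      have := hXi.smul_bdd _ (hbm.mono (ℱ.le k) le_rfl).aestronglyMeasurable
        (ae_of_all _ hbb)
      exact this
    have h0 := integral_eq_zero_of_condExp_eq_zero (ℱ.le k)
      (condExp_bilin_eq_zero (ContinuousLinearMap.lsmul ℝ ℝ (E := ℂ)).flip
        hbm.stronglyMeasurable hprod hXi (hcond k))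
    simp_rw [hstep]
    rw [integral_add (hinteg k) hprod, ih]
    simpa using h0

/-- **Martingale central limit theorem**, in terms of characteristic functions. -/
theorem tendsto_integral_exp_sum_martingaleDiff
    (hX : ∀ k, Measurable[ℱ (k + 1)] (X k)) (h2 : ∀ k, MemLp (X k) 2 μ)
    (hcond : ∀ k, μ[X k | ℱ k] =ᵐ[μ] 0) (hv : ∀ k, ∫ ω, X k ω ^ 2 ∂μ = v)
    (hlim : ∀ᵐ ω ∂μ, Tendsto (fun n : ℕ => (∑ j ∈ Finset.range n, X j ω ^ 2) / n) atTop (𝓝 v)) :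
    Tendsto (fun n : ℕ => ∫ ω, Complex.exp
      (((∑ j ∈ Finset.range n, X j ω) / √n : ℝ) * Complex.I) ∂μ) atTop
      (𝓝 (Real.exp (-v / 2) : ℂ)) := by
  have hXm : ∀ k, Measurable (X k) := fun k => (hX k).mono (ℱ.le _) le_rfl
  have hv0 : 0 ≤ v := hv 0 ▸ integral_nonneg fun ω => sq_nonneg _
  -- Any level above `v` works: the mean squares tend to `v`, so a.s. stopping is eventually
  -- inactive.
  set c := v + 1 with hc
  have hc0 : 0 ≤ c := by positivity
  set T : ℕ → Ω → ℂ := fun n ω => stoppedProd c n (fun j => X j ω) n with hT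
  set U : ℕ → Ω → ℂ := fun n ω => ∏ j ∈ Finset.range n,
    expRatio (stopped c n (fun j => X j ω) j) with hU
  set a : ℂ := (Real.exp (-v / 2) : ℂ) with ha
  have hTm : ∀ n, Measurable (T n) := fun n => measurable_stoppedProd c n fun j _ => hXm j
  have hUm : ∀ n, Measurable (U n) := fun n => Finset.measurable_fun_prod _ fun j _ =>
    measurable_expRatio.comp (measurable_stopped c n fun i _ => hXm i)
  have hUb : ∀ n ω, ‖U n ω‖ ≤ 1 := fun n ω => by
    simp only [hU, norm_prod]
    exact Finset.prod_le_one (fun _ _ => norm_nonneg _) fun j _ => norm_expRatio_le _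
  have hab : ‖a‖ ≤ 1 := by
    rw [ha, Complex.norm_real, Real.norm_eq_abs, Real.abs_exp]
    exact Real.exp_le_one_iff.2 (by linarith)
  have hgood : ∀ᵐ ω ∂μ, ∀ᶠ n : ℕ in atTop, ∀ k ≤ n,
      stopped c n (fun j => X j ω) k = X k ω / √n := by
    filter_upwards [hlim] with ω hω
    filter_upwards [hω.eventually_lt_const (show v < c by linarith), eventually_gt_atTop 0]
      with n hn hn0 k hk
    refine stopped_eq ?_ hk
    rw [div_lt_iff₀ (by exact_mod_cast hn0)] at hn
    exact hn.le
  have hUlim : ∀ᵐ ω ∂μ, Tendsto (fun n => U n ω) atTop (𝓝 a) := by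
    filter_upwards [hlim, hgood] with ω hω hg
    have h1 : Tendsto (fun n : ℕ => ((Real.exp
        (-((∑ j ∈ Finset.range n, X j ω ^ 2) / n) / 2) : ℝ) : ℂ)) atTop (𝓝 a) :=
      (Complex.continuous_ofReal.tendsto _).comp
        ((Real.continuous_exp.tendsto _).comp ((hω.neg).div_const 2))
    have h3 := (tendsto_sum_abs_div_sqrt_cube hω).const_mul 2
    rw [mul_zero] at h3
    have h2 : Tendsto (fun n : ℕ => U n ω - ((Real.exp
        (-((∑ j ∈ Finset.range n, X j ω ^ 2) / n) / 2) : ℝ) : ℂ)) atTop (𝓝 0) := by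
      refine squeeze_zero_norm' ?_ h3
      filter_upwards [hg] with n hn
      have := norm_prod_expRatio_sub_le n fun j => X j ω / √n
      simp only [div_pow, Real.sq_sqrt (Nat.cast_nonneg n), ← Finset.sum_div] at this
      have hUn : U n ω = ∏ j ∈ Finset.range n, expRatio (X j ω / √n) :=
        Finset.prod_congr rfl fun j hj => by rw [hn j (Finset.mem_range.1 hj).le]
      rw [hUn]
      exact this
    simpa using h2.add h1
  -- Bounded convergence: both `U n` and `a` have norm at most one, whence the constant 4.
  have hV : Tendsto (fun n => ∫ ω, ‖U n ω - a‖ ^ 2 ∂μ) atTop (𝓝 0) := by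
    have : Tendsto (fun n => ∫ ω, ‖U n ω - a‖ ^ 2 ∂μ) atTop (𝓝 (∫ _, (0 : ℝ) ∂μ)) := by
      refine tendsto_integral_of_dominated_convergence (fun _ => 4)
        (fun n => (((hUm n).sub_const a).norm.pow_const 2).aestronglyMeasurable)
        (integrable_const _) (fun n => ae_of_all _ fun ω => ?_) ?_
      · rw [Real.norm_of_nonneg (by positivity)]
        have := (norm_sub_le (U n ω) a).trans (add_le_add (hUb n ω) hab)
        nlinarith [norm_nonneg (U n ω - a)]
      · filter_upwards [hUlim] with ω hω
        have := ((hω.sub_const a).norm).pow 2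
        simpa using this
    simpa using this
  have hTint : ∀ n, 0 < n → Integrable (fun ω => ‖T n ω‖ ^ 2) μ := fun n hn =>
    integrable_stoppedProd hc0 hn hXm h2 n
  have hTb : ∀ n, 0 < n → ∫ ω, ‖T n ω‖ ^ 2 ∂μ ≤ Real.exp c * (1 + v) := fun n hn => by
    have hn' : (n : ℝ) ≠ 0 := by positivity
    have hi : Integrable (fun ω => (∑ j ∈ Finset.range n, X j ω ^ 2) / (n : ℝ)) μ :=
      (integrable_finsetSum _ fun j _ => (h2 j).integrable_sq).div_const _
    refine (integral_mono (hTint n hn) (((integrable_const _).add hi).const_mul (Real.exp c))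
      fun ω => norm_stoppedProd_sq_le hc0 hn _ _).trans_eq ?_
    simp only [Pi.add_apply]
    rw [integral_const_mul, integral_add (integrable_const _) hi, integral_div,
      integral_finsetSum _ fun j _ => (h2 j).integrable_sq]
    simp [hv, hn']
  have hmain : Tendsto (fun n => ∫ ω, T n ω * (U n ω - a) ∂μ) atTop (𝓝 0) := by
    rw [Metric.tendsto_nhds]
    intro ε hε
    set K := Real.exp c * (1 + v) with hK
    have hKpos : 0 < K := by positivity
    -- Young's inequality `‖T‖ ‖U - a‖ ≤ (η ‖T‖² + η⁻¹ ‖U - a‖²) / 2`, balanced so that the part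
    -- with `T`, whose second moment is at most `K`, contributes at most `ε / 4`.
    set η := ε / (2 * K) with hη
    have hηpos : 0 < η := by positivity
    filter_upwards [hV.eventually_lt_const (show 0 < ε * η / 2 by positivity),
      eventually_gt_atTop 0] with n hn hn0
    have hVi : Integrable (fun ω => ‖U n ω - a‖ ^ 2) μ := by
      refine Integrable.of_bound (((hUm n).sub_const a).norm.pow_const 2).aestronglyMeasurable 4
        (ae_of_all _ fun ω => ?_)
      rw [Real.norm_of_nonneg (by positivity)]
      have := (norm_sub_le (U n ω) a).trans (add_le_add (hUb n ω) hab)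
      nlinarith [norm_nonneg (U n ω - a)]
    rw [dist_zero_right]
    have hle : ‖∫ ω, T n ω * (U n ω - a) ∂μ‖
        ≤ ∫ ω, (η * ‖T n ω‖ ^ 2 + η⁻¹ * ‖U n ω - a‖ ^ 2) / 2 ∂μ := by
      refine norm_integral_le_of_norm_le
        ((((hTint n hn0).const_mul η).add (hVi.const_mul η⁻¹)).div_const 2)
        (ae_of_all _ fun ω => ?_)
      rw [norm_mul]
      have h : 0 ≤ η⁻¹ * (η * ‖T n ω‖ - ‖U n ω - a‖) ^ 2 := by positivity
      have h' : η⁻¹ * (η * ‖T n ω‖ - ‖U n ω - a‖) ^ 2 = η * ‖T n ω‖ ^ 2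
          + η⁻¹ * ‖U n ω - a‖ ^ 2 - 2 * (‖T n ω‖ * ‖U n ω - a‖) := by
        field_simp
        ring
      linarith
    refine hle.trans_lt ?_
    rw [integral_div, integral_add ((hTint n hn0).const_mul η) (hVi.const_mul η⁻¹),
      integral_const_mul, integral_const_mul]
    have h1 : η * ∫ ω, ‖T n ω‖ ^ 2 ∂μ ≤ ε / 2 := by
      calc η * ∫ ω, ‖T n ω‖ ^ 2 ∂μ ≤ η * K := by gcongr; exact hTb n hn0
        _ = ε / 2 := by rw [hη]; field_simp
    have h2 : η⁻¹ * ∫ ω, ‖U n ω - a‖ ^ 2 ∂μ < ε / 2 := by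
      rw [inv_mul_lt_iff₀ hηpos]
      linarith
    linarith
  have hlim_stopped : Tendsto (fun n : ℕ => ∫ ω, Complex.exp
      ((∑ j ∈ Finset.range n, stopped c n (fun j => X j ω) j : ℝ) * Complex.I) ∂μ) atTop
      (𝓝 a) := by
    have h := hmain.add_const a
    rw [zero_add] at h
    -- Since `T n` has mean one, `E[T (U - a)] + a = E[T U]`, and `T U` is the exponential of the
    -- stopped sum.
    refine h.congr' ?_
    filter_upwards [eventually_gt_atTop 0] with n hn
    have hTi : Integrable (T n) μ :=
      ((memLp_two_iff_integrable_sq_norm (hTm n).aestronglyMeasurable).2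
        (hTint n hn)).integrable one_le_two
    have h1 : ∫ ω, T n ω * a ∂μ = a := by
      rw [integral_mul_const, integral_stoppedProd hc0 hn hX h2 hcond n, one_mul]
    have hTUi : Integrable (fun ω => T n ω * (U n ω - a)) μ := by
      refine (hTi.norm.const_mul 2).mono' ((hTm n).mul ((hUm n).sub_const a)).aestronglyMeasurable
        (ae_of_all _ fun ω => ?_)
      rw [norm_mul, mul_comm]
      have := (norm_sub_le (U n ω) a).trans (add_le_add (hUb n ω) hab)
      gcongr
      linarith
    refine (congrArg (∫ ω, T n ω * (U n ω - a) ∂μ + ·) h1.symm).trans ?_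
    rw [← integral_add hTUi (hTi.mul_const a)]
    refine integral_congr_ae (ae_of_all _ fun ω => ?_)
    simp only
    rw [← stoppedProd_mul_prod_expRatio]
    simp only [hT, hU]
    ring
  have hdiff : Tendsto (fun n : ℕ => ∫ ω, (Complex.exp
        (((∑ j ∈ Finset.range n, X j ω) / √n : ℝ) * Complex.I)
      - Complex.exp ((∑ j ∈ Finset.range n, stopped c n (fun j => X j ω) j : ℝ) * Complex.I)) ∂μ)
      atTop (𝓝 (∫ _, (0 : ℂ) ∂μ)) := by
    have hm1 : ∀ n : ℕ, Measurable fun ω => (∑ j ∈ Finset.range n, X j ω) / √n := fun n =>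
      (Finset.measurable_fun_sum _ fun j _ => hXm j).div_const _
    have hm2 : ∀ n : ℕ, Measurable fun ω => ∑ j ∈ Finset.range n, stopped c n (fun j => X j ω) j :=
      fun n => Finset.measurable_fun_sum _ fun j _ => measurable_stopped c n fun i _ => hXm i
    refine tendsto_integral_of_dominated_convergence (fun _ => 2) (fun n => ?_)
      (integrable_const _) (fun n => ae_of_all _ fun ω => ?_) ?_
    · have := hm1 n
      have := hm2 n
      exact Measurable.aestronglyMeasurable (by fun_prop)
    · refine (norm_sub_le _ _).trans ?_
      rw [Complex.norm_exp_ofReal_mul_I, Complex.norm_exp_ofReal_mul_I]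
      norm_num
    · filter_upwards [hgood] with ω hω
      refine tendsto_const_nhds.congr' ?_
      filter_upwards [hω] with n hn
      rw [eq_comm, sub_eq_zero, Finset.sum_div]
      congr 3
      exact Finset.sum_congr rfl fun j hj => (hn j (Finset.mem_range.1 hj).le).symm
  have hfin := hdiff.add hlim_stopped
  rw [integral_zero, zero_add] at hfin
  refine hfin.congr fun n => ?_
  have hm1 : Measurable fun ω => (∑ j ∈ Finset.range n, X j ω) / √n :=
    (Finset.measurable_fun_sum _ fun j _ => hXm j).div_const _
  have hm2 : Measurable fun ω => ∑ j ∈ Finset.range n, stopped c n (fun j => X j ω) j :=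
    Finset.measurable_fun_sum _ fun j _ => measurable_stopped c n fun i _ => hXm i
  have hi : ∀ {g : Ω → ℝ}, Measurable g →
      Integrable (fun ω => Complex.exp ((g ω : ℂ) * Complex.I)) μ := fun {g} hg =>
    Integrable.of_bound (Measurable.aestronglyMeasurable (by fun_prop)) 1
      (ae_of_all _ fun ω => by rw [Complex.norm_exp_ofReal_mul_I])
  rw [integral_sub (hi hm1) (hi hm2)]
  ring

end MartingaleCLT

/-! ### Stationary processes obtained by a fixed function of the past -/

section Factor

variable {Ω S β β' : Type*} [MeasurableSpace Ω] [MeasurableSpace S] [MeasurableSpace β]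
  [MeasurableSpace β'] {μ : Measure Ω} {ξ : ℤ → Ω → S}

/-- `Z_t` is a.s. a fixed measurable function of `ξ_t`. -/
def IsFactor (μ : Measure Ω) (ξ : ℤ → Ω → S) (Z : ℤ → Ω → β) : Prop :=
  ∃ G : S → β, Measurable G ∧ ∀ t, Z t =ᵐ[μ] fun ω => G (ξ t ω)

theorem isFactor_of_measurable {G : S → β} (hG : Measurable G) :
    IsFactor μ ξ fun t ω => G (ξ t ω) :=
  ⟨G, hG, fun _ => EventuallyEq.rfl⟩

theorem IsFactor.congr {Z Z' : ℤ → Ω → β} (hZ : IsFactor μ ξ Z) (h : ∀ t, Z' t =ᵐ[μ] Z t) :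
    IsFactor μ ξ Z' := by
  obtain ⟨G, hG, h'⟩ := hZ
  exact ⟨G, hG, fun t => (h t).trans (h' t)⟩

theorem IsFactor.comp {Z : ℤ → Ω → β} (hZ : IsFactor μ ξ Z) {g : β → β'} (hg : Measurable g) :
    IsFactor μ ξ fun t ω => g (Z t ω) := by
  obtain ⟨G, hG, h⟩ := hZ
  exact ⟨g ∘ G, hg.comp hG, fun t => (h t).fun_comp g⟩

theorem IsFactor.prodMk {Z : ℤ → Ω → β} {Z' : ℤ → Ω → β'} (hZ : IsFactor μ ξ Z)
    (hZ' : IsFactor μ ξ Z') : IsFactor μ ξ fun t ω => (Z t ω, Z' t ω) := by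
  obtain ⟨G, hG, h⟩ := hZ
  obtain ⟨G', hG', h'⟩ := hZ'
  exact ⟨fun s => (G s, G' s), hG.prodMk hG', fun t => (h t).prodMk (h' t)⟩

theorem IsFactor.aemeasurable {Z : ℤ → Ω → β} (hξ : ∀ t, Measurable (ξ t))
    (hZ : IsFactor μ ξ Z) (t : ℤ) : AEMeasurable (Z t) μ := by
  obtain ⟨G, hG, h⟩ := hZ
  exact ⟨_, hG.comp (hξ t), h t⟩

/-- An a.s. limit of factors is a factor. -/
theorem IsFactor.lim [TopologicalSpace β] [TopologicalSpace.IsCompletelyMetrizableSpace β]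
    [SecondCountableTopology β] [BorelSpace β] [Nonempty β] {Z : ℕ → ℤ → Ω → β}
    {Z' : ℤ → Ω → β} (hZ : ∀ n, IsFactor μ ξ (Z n))
    (h : ∀ t, ∀ᵐ ω ∂μ, Tendsto (fun n => Z n t ω) atTop (𝓝 (Z' t ω))) : IsFactor μ ξ Z' := by
  choose G hG h' using hZ
  refine ⟨fun s => limUnder atTop fun n => G n s, ?_, fun t => ?_⟩
  · exact (StronglyMeasurable.limUnder fun n => (hG n).stronglyMeasurable).measurable
  · filter_upwards [h t, ae_all_iff.2 fun n => h' n t] with ω h1 h2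
    refine (Tendsto.limUnder_eq ?_).symm
    simpa only [h2] using h1

/-- A countable dense subset of `s` serves all continuous functions at once. This independence of
`f` is what makes suprema over uncountable parameter sets measurable. -/
theorem exists_countable_subset_biSup_eq {E : Type*} [TopologicalSpace E]
    [SecondCountableTopology E] (s : Set E) :
    ∃ D ⊆ s, D.Countable ∧ ∀ f : E → ℝ≥0∞, ContinuousOn f s → ⨆ x ∈ s, f x = ⨆ x ∈ D, f x := by
  obtain ⟨D, hDc, hDd⟩ := TopologicalSpace.exists_countable_dense s
  refine ⟨Subtype.val '' D, by simp, hDc.image _, fun f hf => le_antisymm ?_ ?_⟩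
  · have hcl : IsClosed {x : s | f x ≤ ⨆ y ∈ Subtype.val '' D, f y} :=
      isClosed_le hf.domRestrict continuous_const
    have h : ∀ x : s, f x ≤ ⨆ y ∈ Subtype.val '' D, f y := fun x => by
      have : closure D ⊆ {x : s | f x ≤ ⨆ y ∈ Subtype.val '' D, f y} :=
        closure_minimal (fun z hz => le_biSup f (Set.mem_image_of_mem _ hz)) hcl
      exact this (hDd x)
    exact iSup₂_le fun x hx => h ⟨x, hx⟩
  · refine biSup_mono fun i hi => ?_
    obtain ⟨x, _, rfl⟩ := hi
    exact x.2

theorem IsFactor.biSup_of_continuousOn {E : Type*} [TopologicalSpace E]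
    [SecondCountableTopology E] {s : Set E} {Z : E → ℤ → Ω → ℝ≥0∞}
    (hZ : ∀ x ∈ s, IsFactor μ ξ (Z x))
    (hc : ∀ t, ∀ᵐ ω ∂μ, ContinuousOn (fun x => Z x t ω) s) :
    IsFactor μ ξ fun t ω => ⨆ x ∈ s, Z x t ω := by
  obtain ⟨D, hDs, hDc, hD⟩ := exists_countable_subset_biSup_eq s
  choose! G hG h using hZ
  refine ⟨fun a => ⨆ x ∈ D, G x a, Measurable.biSup D hDc fun x hx => hG x (hDs hx), fun t => ?_⟩
  filter_upwards [hc t, (ae_ball_iff hDc).2 fun x hx => h x (hDs hx) t] with ω h1 h2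
  rw [hD _ h1]
  exact iSup_congr fun x => iSup_congr fun hx => h2 x hx

end Factor

/-! ### The strong law along the process -/

section LawOfLargeNumbers

variable {Ω : Type*} [MeasurableSpace Ω] {μ : Measure Ω} {d : ℕ} {Y : ℤ → Ω → Vec d}

/-- The present and the past of the process. -/
def window (Y : ℤ → Ω → Vec d) (t : ℤ) (ω : Ω) : Vec d × (ℕ → Vec d) := (Y t ω, past Y t ω)

theorem measurable_past (hY : ∀ t, Measurable (Y t)) (t : ℤ) : Measurable (past Y t) :=
  measurable_pi_lambda _ fun _ => hY _

theorem measurable_window (hY : ∀ t, Measurable (Y t)) (t : ℤ) : Measurable (window Y t) :=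
  (hY t).prodMk (measurable_past hY t)

/-- The time-zero window of a path. -/
def pathWindow (x : ℤ → Vec d) : Vec d × (ℕ → Vec d) := (x 0, fun n => x (0 - 1 - n))

theorem measurable_pathWindow : Measurable (pathWindow (d := d)) := by
  unfold pathWindow
  fun_prop

/-- The shift of paths. -/
def shift (x : ℤ → Vec d) (t : ℤ) : Vec d := x (t + 1)

theorem iterate_shift (k : ℕ) (x : ℤ → Vec d) (t : ℤ) : shift^[k] x t = x (t + k) := by
  induction k generalizing x with
  | zero => simp
  | succ k ih =>
    rw [Function.iterate_succ_apply, ih]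
    simp only [shift, Nat.cast_succ]
    congr 1
    ring

theorem pathWindow_iterate_shift {Ω : Type*} {Y : ℤ → Ω → Vec d} (k : ℕ) (ω : Ω) :
    pathWindow (shift^[k] fun t => Y t ω) = window Y k ω := by
  simp only [pathWindow, iterate_shift, window, Prod.mk.injEq]
  refine ⟨by congr 1; ring, funext fun n => ?_⟩
  congr 1
  ring

/-- The window at time `k` is the time-zero window of the `k`-fold shifted path, and the shift
preserves the law of the path. -/
theorem map_window (hY : ∀ t, Measurable (Y t)) (hE : StationaryErgodic μ Y) (k : ℕ) :
    μ.map (window Y k) = μ.map (window Y 0) := by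
  have hpath : Measurable fun ω t => Y t ω := measurable_pi_lambda _ hY
  have hs : MeasurePreserving (shift (d := d)) (μ.map fun ω t => Y t ω) (μ.map fun ω t => Y t ω) :=
    hE.toMeasurePreserving
  have h : ∀ j : ℕ, μ.map (window Y j) = (μ.map fun ω t => Y t ω).map pathWindow := fun j => by
    conv_rhs => rw [← (hs.iterate j).map_eq]
    rw [Measure.map_map (hs.iterate j).measurable hpath, Measure.map_map measurable_pathWindow
      ((hs.iterate j).measurable.comp hpath)]
    congr 1
    ext1 ω
    exact (pathWindow_iterate_shift j ω).symm
  rw [h k, ← Nat.cast_zero, h 0]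

theorem IsFactor.lintegral_eq (hY : ∀ t, Measurable (Y t)) (hE : StationaryErgodic μ Y)
    {Z : ℤ → Ω → ℝ≥0∞} (hZ : IsFactor μ (window Y) Z) (k : ℕ) :
    ∫⁻ ω, Z k ω ∂μ = ∫⁻ ω, Z 0 ω ∂μ := by
  obtain ⟨G, hG, h⟩ := hZ
  rw [lintegral_congr_ae (h k), lintegral_congr_ae (h 0),
    ← lintegral_map hG (measurable_window hY k), ← lintegral_map hG (measurable_window hY 0),
    map_window hY hE]

theorem IsFactor.identDistrib (hY : ∀ t, Measurable (Y t)) (hE : StationaryErgodic μ Y)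
    {β : Type*} [MeasurableSpace β] {Z : ℤ → Ω → β} (hZ : IsFactor μ (window Y) Z) (k : ℕ) :
    IdentDistrib (Z k) (Z 0) μ μ := by
  refine ⟨hZ.aemeasurable (measurable_window hY) k, hZ.aemeasurable (measurable_window hY) 0, ?_⟩
  obtain ⟨G, hG, h⟩ := hZ
  rw [Measure.map_congr (h k), Measure.map_congr (h 0)]
  have h' : ∀ j : ℤ, μ.map (fun ω => G (window Y j ω)) = (μ.map (window Y j)).map G := fun j =>
    (Measure.map_map hG (measurable_window hY j)).symm
  rw [h', h', map_window hY hE]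

theorem sum_Icc_one_eq_sum_range {M : Type*} [AddCommMonoid M] (f : ℕ → M) (n : ℕ) :
    ∑ t ∈ Finset.Icc 1 n, f t = ∑ k ∈ Finset.range n, f (k + 1) := by
  rw [Finset.range_eq_Ico, Finset.sum_Ico_add' f 0 n 1]
  rfl

variable [IsProbabilityMeasure μ]

/-- The strong law of large numbers for a factor of a stationary ergodic process. -/
theorem IsFactor.ae_tendsto_average (hY : ∀ t, Measurable (Y t)) (hE : StationaryErgodic μ Y)
    {Z : ℤ → Ω → ℝ} (hZ : IsFactor μ (window Y) Z) (hi : Integrable (Z 0) μ) :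
    ∀ᵐ ω ∂μ, Tendsto (fun T : ℕ => (T : ℝ)⁻¹ * ∑ t ∈ Finset.Icc 1 T, Z t ω) atTop
      (𝓝 (∫ ω, Z 0 ω ∂μ)) := by
  have hid := hZ.identDistrib hY hE 1
  obtain ⟨G, hG, h⟩ := hZ
  have hpath : Measurable fun ω t => Y t ω := measurable_pi_lambda _ hY
  have hs : Ergodic (shift (d := d)) (μ.map fun ω t => Y t ω) := hE
  have : IsProbabilityMeasure (μ.map fun ω t => Y t ω) :=
    Measure.isProbabilityMeasure_map hpath.aemeasurable
  -- The additional shift aligns Birkhoff sums, which start at index 0, with sample averages, which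
  -- start at `t = 1`.
  set F : (ℤ → Vec d) → ℝ := fun x => G (pathWindow (shift x)) with hF
  have hFm : Measurable F := hG.comp (measurable_pathWindow.comp hs.measurable)
  have hFY : ∀ (k : ℕ) ω, F (shift^[k] fun t => Y t ω) = G (window Y (k + 1 : ℕ) ω) :=
    fun k ω => by
      simp only [hF]
      rw [← Function.iterate_succ_apply' shift, pathWindow_iterate_shift]
  have hF1 : (fun ω => F fun t => Y t ω) =ᵐ[μ] Z 1 := by
    filter_upwards [h 1] with ω hω
    have := hFY 0 ω
    simp only [Function.iterate_zero, id_eq, zero_add, Nat.cast_one] at this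
    rw [this, hω]
  have hFi : Integrable F (μ.map fun ω t => Y t ω) := by
    rw [integrable_map_measure hFm.aestronglyMeasurable hpath.aemeasurable]
    exact ((hid.symm.integrable_snd hi).congr hF1.symm)
  have hinteg : ∫ x, F x ∂(μ.map fun ω t => Y t ω) = ∫ ω, Z 0 ω ∂μ := by
    rw [integral_map hpath.aemeasurable hFm.aestronglyMeasurable, integral_congr_ae hF1]
    exact hid.integral_eq
  filter_upwards [ae_of_ae_map hpath.aemeasurable (ae_tendsto_birkhoffAverage hs hFm hFi),
    ae_all_iff.2 h] with ω h1 h2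
  rw [hinteg] at h1
  refine h1.congr fun n => ?_
  rw [birkhoffAverage, birkhoffSum, smul_eq_mul, sum_Icc_one_eq_sum_range]
  simp only [hFY, h2]

theorem IsFactor.ae_tendsto_average_toReal (hY : ∀ t, Measurable (Y t))
    (hE : StationaryErgodic μ Y) {Z : ℤ → Ω → ℝ≥0∞} (hZ : IsFactor μ (window Y) Z)
    (hi : ∫⁻ ω, Z 0 ω ∂μ < ∞) :
    ∀ᵐ ω ∂μ, (∀ t : ℕ, Z t ω < ∞) ∧
      Tendsto (fun T : ℕ => (T : ℝ)⁻¹ * ∑ t ∈ Finset.Icc 1 T, (Z t ω).toReal) atTop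
        (𝓝 (∫⁻ ω, Z 0 ω ∂μ).toReal) := by
  have hm := hZ.aemeasurable (measurable_window hY)
  have hfin : ∀ᵐ ω ∂μ, ∀ t : ℕ, Z t ω < ∞ := ae_all_iff.2 fun t =>
    ae_lt_top' (hm t) (by rw [hZ.lintegral_eq hY hE]; exact hi.ne)
  have hlim := (hZ.comp ENNReal.measurable_toReal).ae_tendsto_average hY hE
    (integrable_toReal_of_lintegral_ne_top (hm 0) hi.ne)
  rw [integral_toReal (hm 0) (ae_lt_top' (hm 0) hi.ne)] at hlim
  filter_upwards [hfin, hlim] with ω h1 h2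
  exact ⟨h1, h2⟩

end LawOfLargeNumbers

/-! ### The uniform strong law over a compact parameter set -/

section UniformLaw

variable {E : Type*} [PseudoMetricSpace E]

/-- The pairs of points of `K` at distance less than `1 / (n + 1)`. -/
def closePairs (K : Set E) (n : ℕ) : Set (E × E) :=
  {p : E × E | p.1 ∈ K ∧ p.2 ∈ K ∧ dist p.1 p.2 < 1 / ((n : ℝ) + 1)}

/-- The modulus of continuity of `g` on `K` at scale `1 / (n + 1)`. -/
noncomputable def modulus (K : Set E) (n : ℕ) (g : E → ℝ) : ℝ≥0∞ :=
  ⨆ p ∈ closePairs K n, ‖g p.1 - g p.2‖ₑ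

theorem enorm_sub_le_modulus {K : Set E} {n : ℕ} {p : E × E} (hp : p ∈ closePairs K n)
    (g : E → ℝ) : ‖g p.1 - g p.2‖ₑ ≤ modulus K n g :=
  le_biSup (fun p : E × E => ‖g p.1 - g p.2‖ₑ) hp

theorem modulus_le (K : Set E) (n : ℕ) (g : E → ℝ) :
    modulus K n g ≤ 2 * ⨆ θ ∈ K, ‖g θ‖ₑ := by
  refine iSup₂_le fun p hp => ?_
  rw [two_mul]
  have h1 : ‖g p.1‖ₑ ≤ ⨆ θ ∈ K, ‖g θ‖ₑ := le_biSup (fun θ => ‖g θ‖ₑ) hp.1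
  have h2 : ‖g p.2‖ₑ ≤ ⨆ θ ∈ K, ‖g θ‖ₑ := le_biSup (fun θ => ‖g θ‖ₑ) hp.2.1
  exact enorm_sub_le.trans (add_le_add h1 h2)

theorem tendsto_modulus {K : Set E} (hK : IsCompact K) {g : E → ℝ} (hg : ContinuousOn g K) :
    Tendsto (fun n => modulus K n g) atTop (𝓝 0) := by
  have hu := hK.uniformContinuousOn_of_continuous hg
  rw [Metric.uniformContinuousOn_iff] at hu
  rw [ENNReal.tendsto_nhds_zero]
  intro ε hε
  rcases eq_or_ne ε ∞ with rfl | hε'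
  · simp
  obtain ⟨δ, hδ, h⟩ := hu ε.toReal (ENNReal.toReal_pos hε.ne' hε')
  filter_upwards [tendsto_one_div_add_atTop_nhds_zero_nat.eventually_lt_const hδ] with n hn
  refine iSup₂_le fun p hp => ?_
  have := h p.1 hp.1 p.2 hp.2.1 (hp.2.2.trans hn)
  rw [Real.dist_eq, ← Real.norm_eq_abs] at this
  rw [← ofReal_norm, ← ENNReal.ofReal_toReal hε']
  exact ENNReal.ofReal_le_ofReal this.le

theorem isFactor_modulus {Ω S : Type*} [MeasurableSpace Ω] [MeasurableSpace S] {μ : Measure Ω}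
    {ξ : ℤ → Ω → S} [SecondCountableTopology E] {K : Set E} {f : E → ℤ → Ω → ℝ}
    (hf : ∀ θ ∈ K, IsFactor μ ξ (f θ))
    (hc : ∀ t, ∀ᵐ ω ∂μ, ContinuousOn (fun θ => f θ t ω) K) (n : ℕ) :
    IsFactor μ ξ fun t ω => modulus K n fun θ => f θ t ω := by
  refine IsFactor.biSup_of_continuousOn (s := closePairs K n)
    (Z := fun p t ω => ‖f p.1 t ω - f p.2 t ω‖ₑ) (fun p hp => ?_) fun t => ?_
  · have hg : Measurable fun q : ℝ × ℝ => ‖q.1 - q.2‖ₑ := by fun_prop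
    exact ((hf _ hp.1).prodMk (hf _ hp.2.1)).comp hg
  · filter_upwards [hc t] with ω h
    have h1 : ContinuousOn (fun p : E × E => f p.1 t ω) (closePairs K n) :=
      h.comp (f := Prod.fst) continuousOn_fst fun p hp => hp.1
    have h2 : ContinuousOn (fun p : E × E => f p.2 t ω) (closePairs K n) :=
      h.comp (f := Prod.snd) continuousOn_snd fun p hp => hp.2.1
    exact (h1.sub h2).enorm

/-- The uniform strong law of large numbers over a compact set, for a factor of a stationary
ergodic process that depends continuously on a parameter. -/
theorem ae_tendstoUniformlyOn_average {Ω : Type*} [MeasurableSpace Ω] {μ : Measure Ω}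
    [IsProbabilityMeasure μ] {d : ℕ} {Y : ℤ → Ω → Vec d} [SecondCountableTopology E]
    (hY : ∀ t, Measurable (Y t)) (hE : StationaryErgodic μ Y) {K : Set E} (hK : IsCompact K)
    {f : E → ℤ → Ω → ℝ}
    (hf : ∀ θ ∈ K, IsFactor μ (window Y) (f θ))
    (hc : ∀ t, ∀ᵐ ω ∂μ, ContinuousOn (fun θ => f θ t ω) K)
    (hi : ∫⁻ ω, ⨆ θ ∈ K, ‖f θ 0 ω‖ₑ ∂μ < ∞) :
    ∀ᵐ ω ∂μ, TendstoUniformlyOn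
      (fun (T : ℕ) θ => (T : ℝ)⁻¹ * ∑ t ∈ Finset.Icc 1 T, f θ t ω)
      (fun θ => ∫ ω, f θ 0 ω ∂μ) atTop K := by
  have hwf := isFactor_modulus hf hc
  have hsupf : IsFactor μ (window Y) fun t ω => ⨆ θ ∈ K, ‖f θ t ω‖ₑ :=
    IsFactor.biSup_of_continuousOn (Z := fun θ t ω => ‖f θ t ω‖ₑ)
      (fun θ hθ => (hf θ hθ).comp measurable_enorm) fun t => (hc t).mono fun ω h => h.enorm
  have hmw := fun n => (hwf n).aemeasurable (measurable_window hY) 0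
  have hms := hsupf.aemeasurable (measurable_window hY) 0
  have hfin2 : ∫⁻ ω, 2 * ⨆ θ ∈ K, ‖f θ 0 ω‖ₑ ∂μ ≠ ∞ := by
    rw [lintegral_const_mul'' _ hms]
    exact ENNReal.mul_ne_top (by simp) hi.ne
  have hwfin : ∀ n, ∫⁻ ω, modulus K n (fun θ => f θ 0 ω) ∂μ < ∞ := fun n =>
    (lintegral_mono fun ω => modulus_le K n _).trans_lt hfin2.lt_top
  -- The modulus vanishes pathwise by uniform continuity on `K` and is dominated by twice the
  -- integrable envelope.
  have hwlim : Tendsto (fun n => ∫⁻ ω, modulus K n (fun θ => f θ 0 ω) ∂μ) atTop (𝓝 0) := by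
    have hpt : ∀ᵐ ω ∂μ, Tendsto (fun n => modulus K n (fun θ => f θ 0 ω)) atTop (𝓝 0) := by
      filter_upwards [hc 0] with ω h
      exact tendsto_modulus hK h
    have := tendsto_lintegral_of_dominated_convergence' (μ := μ)
      (F := fun n ω => modulus K n (fun θ => f θ 0 ω))
      (f := fun _ => 0) (fun ω => 2 * ⨆ θ ∈ K, ‖f θ 0 ω‖ₑ) hmw
      (fun n => ae_of_all _ fun ω => modulus_le K n _) hfin2 hpt
    rwa [lintegral_zero] at this
  have hfi : ∀ θ ∈ K, Integrable (f θ 0) μ := fun θ hθ =>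
    ⟨((hf θ hθ).aemeasurable (measurable_window hY) 0).aestronglyMeasurable,
      (lintegral_mono fun ω => le_biSup (fun θ => ‖f θ 0 ω‖ₑ) hθ).trans_lt hi⟩
  have hnet : ∀ n : ℕ, ∃ N : Set E, N ⊆ K ∧ N.Finite ∧
      K ⊆ ⋃ x ∈ N, Metric.ball x (1 / ((n : ℝ) + 1)) := fun n =>
    hK.finite_cover_balls Nat.one_div_pos_of_nat
  choose N hNK hNf hNc using hnet
  have hLw := ae_all_iff.2 fun n => (hwf n).ae_tendsto_average_toReal hY hE (hwfin n)
  have hLf : ∀ᵐ ω ∂μ, ∀ n, ∀ θ ∈ N n, Tendsto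
      (fun T : ℕ => (T : ℝ)⁻¹ * ∑ t ∈ Finset.Icc 1 T, f θ t ω) atTop (𝓝 (∫ ω, f θ 0 ω ∂μ)) :=
    ae_all_iff.2 fun n => (ae_ball_iff (hNf n).countable).2 fun θ hθ =>
      (hf θ (hNK n hθ)).ae_tendsto_average hY hE (hfi θ (hNK n hθ))
  have hmean : ∀ n, ∀ p ∈ closePairs K n, |∫ ω, f p.1 0 ω ∂μ - ∫ ω, f p.2 0 ω ∂μ|
      ≤ (∫⁻ ω, modulus K n (fun θ => f θ 0 ω) ∂μ).toReal := fun n p hp => by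
    rw [← integral_sub (hfi _ hp.1) (hfi _ hp.2.1), ← Real.norm_eq_abs]
    refine (norm_integral_le_lintegral_norm _).trans ?_
    refine ENNReal.toReal_mono (hwfin n).ne (lintegral_mono fun ω => ?_)
    rw [ofReal_norm]
    exact enorm_sub_le_modulus hp fun θ => f θ 0 ω
  filter_upwards [hLw, hLf] with ω h1 h2
  rw [Metric.tendstoUniformlyOn_iff]
  intro ε hε
  have hwlim' : Tendsto (fun n => (∫⁻ ω, modulus K n (fun θ => f θ 0 ω) ∂μ).toReal) atTop
      (𝓝 0) := by
    have h := (ENNReal.tendsto_toReal ENNReal.zero_ne_top).comp hwlim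
    rwa [ENNReal.toReal_zero] at h
  -- Passing from `θ` to the nearest point of a finite net costs one modulus in the sample average
  -- and one in the mean; the law of large numbers at the net point costs a third `ε / 4`.
  obtain ⟨n, hn⟩ := (hwlim'.eventually_lt_const (show 0 < ε / 4 by positivity)).exists
  have hev : ∀ᶠ T : ℕ in atTop, ∀ θ ∈ N n,
      dist ((T : ℝ)⁻¹ * ∑ t ∈ Finset.Icc 1 T, f θ t ω) (∫ ω, f θ 0 ω ∂μ) < ε / 4 :=
    (hNf n).eventually_all.2 fun θ hθ => (Metric.tendsto_nhds.1 (h2 n θ hθ)) _ (by positivity)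
  filter_upwards [(h1 n).2.eventually_lt_const hn, hev] with T hT1 hT2 θ hθ
  obtain ⟨η, hη, hθη⟩ := Set.mem_iUnion₂.1 (hNc n hθ)
  have hp : (θ, η) ∈ closePairs K n := ⟨hθ, hNK n hη, hθη⟩
  have hA1 := hmean n _ hp
  have hA2 := hT2 η hη
  have hA3 : |(T : ℝ)⁻¹ * ∑ t ∈ Finset.Icc 1 T, f θ t ω
      - (T : ℝ)⁻¹ * ∑ t ∈ Finset.Icc 1 T, f η t ω|
      ≤ (T : ℝ)⁻¹ * ∑ t ∈ Finset.Icc 1 T, (modulus K n fun θ => f θ t ω).toReal := by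
    rw [← mul_sub, ← Finset.sum_sub_distrib, abs_mul, abs_of_nonneg (by positivity)]
    gcongr
    refine (Finset.abs_sum_le_sum_abs _ _).trans (Finset.sum_le_sum fun t _ => ?_)
    rw [← Real.norm_eq_abs, ← toReal_enorm]
    exact ENNReal.toReal_mono ((h1 n).1 t).ne
      (enorm_sub_le_modulus hp fun θ => f θ t ω)
  rw [Real.dist_eq, abs_lt] at hA2 ⊢
  rw [abs_le] at hA1 hA3
  constructor <;> linarith [hA1.1, hA1.2, hA2.1, hA2.2, hA3.1, hA3.2]

end UniformLaw

/-! ### The weighted bilinear form -/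

section BilinearForm

variable {d : ℕ}

/-- `x' W y`. -/
def wform (W : Matrix (Fin d) (Fin d) ℝ) (x y : Vec d) : ℝ := x.ofLp ⬝ᵥ (W *ᵥ y.ofLp)

theorem continuous_wform :
    Continuous fun p : (Fin d → Fin d → ℝ) × Vec d × Vec d =>
      wform (Matrix.of p.1) p.2.1 p.2.2 := by
  have h : Continuous fun p : Matrix (Fin d) (Fin d) ℝ × Vec d × Vec d =>
      wform p.1 p.2.1 p.2.2 := by
    unfold wform
    fun_prop
  exact h

theorem wform_add_left (W : Matrix (Fin d) (Fin d) ℝ) (x x' y : Vec d) :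
    wform W (x + x') y = wform W x y + wform W x' y := by
  simp [wform, add_dotProduct]

theorem wform_add_right (W : Matrix (Fin d) (Fin d) ℝ) (x y y' : Vec d) :
    wform W x (y + y') = wform W x y + wform W x y' := by
  simp [wform, Matrix.mulVec_add, dotProduct_add]

theorem wform_sub_left (W : Matrix (Fin d) (Fin d) ℝ) (x x' y : Vec d) :
    wform W (x - x') y = wform W x y - wform W x' y := by
  simp [wform, sub_dotProduct]

theorem wform_sub_right (W : Matrix (Fin d) (Fin d) ℝ) (x y y' : Vec d) :
    wform W x (y - y') = wform W x y - wform W x y' := by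
  simp [wform, Matrix.mulVec_sub, dotProduct_sub]

theorem wform_sub_matrix (W W' : Matrix (Fin d) (Fin d) ℝ) (x y : Vec d) :
    wform (W - W') x y = wform W x y - wform W' x y := by
  simp [wform, Matrix.sub_mulVec, dotProduct_sub]

theorem wform_comm {W : Matrix (Fin d) (Fin d) ℝ} (hW : W.IsSymm) (x y : Vec d) :
    wform W x y = wform W y x := by
  rw [wform, wform, Matrix.dotProduct_mulVec, dotProduct_comm, ← Matrix.mulVec_transpose, hW.eq]

theorem wform_eq_inner (W : Matrix (Fin d) (Fin d) ℝ) (x y : Vec d) :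
    wform W x y = inner ℝ (WithLp.toLp 2 (x.ofLp ᵥ* W) : Vec d) y := by
  rw [EuclideanSpace.inner_eq_star_dotProduct, wform, Matrix.dotProduct_mulVec, dotProduct_comm]
  simp

theorem wform_self_nonneg {W : Matrix (Fin d) (Fin d) ℝ} (hW : W.PosDef) (x : Vec d) :
    0 ≤ wform W x x :=
  hW.posSemidef.dotProduct_mulVec_nonneg x.ofLp

theorem eq_zero_of_wform_self {W : Matrix (Fin d) (Fin d) ℝ} (hW : W.PosDef) {x : Vec d}
    (h : wform W x x = 0) : x = 0 := by
  by_contra hx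
  have hx' : x.ofLp ≠ 0 := fun h' => hx (by simpa using h')
  have := hW.dotProduct_mulVec_pos hx'
  simp only [star_trivial] at this
  exact this.ne' h

/-- Expand the nonnegative values of the form at `x - y` and `x + y`. The lemma gives integrability
of cross terms from that of the losses alone. -/
theorem two_mul_abs_wform_le {W : Matrix (Fin d) (Fin d) ℝ} (hW : W.PosDef) (x y : Vec d) :
    2 * |wform W x y| ≤ wform W x x + wform W y y := by
  have hs : W.IsSymm := by simpa using hW.isHermitian
  have h1 := wform_self_nonneg hW (x - y)
  have h2 := wform_self_nonneg hW (x + y)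
  simp only [wform_sub_left, wform_sub_right, wform_add_left, wform_add_right,
    wform_comm hs y x] at h1 h2
  rcases abs_cases (wform W x y) with ⟨h, _⟩ | ⟨h, _⟩ <;> rw [h] <;> linarith

/-- `|x' D y| ≤ ‖vec D‖ ‖x‖ ‖y‖`. -/
theorem abs_wform_le (D : Matrix (Fin d) (Fin d) ℝ) (x y : Vec d) :
    |wform D x y| ≤ ‖(WithLp.toLp 2 (Matrix.vec D) : EuclideanSpace ℝ (Fin d × Fin d))‖
      * ‖x‖ * ‖y‖ := by
  refine abs_le_of_sq_le_sq ?_ (by positivity)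
  rw [mul_pow, mul_pow, EuclideanSpace.norm_sq_eq, EuclideanSpace.norm_sq_eq,
    EuclideanSpace.norm_sq_eq]
  -- Cauchy–Schwarz over the `d²` entries. Since `vec` stacks columns, the first index of `p` is the
  -- column.
  have h1 : wform D x y = ∑ p : Fin d × Fin d, Matrix.vec D p * (x p.2 * y p.1) := by
    rw [Fintype.sum_prod_type_right]
    simp only [wform, dotProduct, Matrix.mulVec, Matrix.vec, Finset.mul_sum]
    exact Finset.sum_congr rfl fun i _ => Finset.sum_congr rfl fun j _ => by ring
  have h2 : ∑ p : Fin d × Fin d, (x p.2 * y p.1) ^ 2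
      = (∑ i, ‖x.ofLp i‖ ^ 2) * ∑ i, ‖y.ofLp i‖ ^ 2 := by
    rw [Fintype.sum_prod_type_right, Finset.sum_mul_sum]
    simp [mul_pow]
  rw [h1, mul_assoc, ← h2]
  refine (Finset.sum_mul_sq_le_sq_mul_sq _ _ _).trans_eq ?_
  simp

-- The vector `x` is an eigenvector of `x x'` with eigenvalue `‖x‖²`.
open scoped Matrix.Norms.L2Operator in
theorem sq_norm_le_norm_vecMulVec (x : Vec d) :
    ‖x‖ ^ 2 ≤ ‖Matrix.vecMulVec x.ofLp x.ofLp‖ := by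
  rcases eq_or_ne x 0 with rfl | hx
  · simp
  have h := Matrix.l2_opNorm_mulVec (Matrix.vecMulVec x.ofLp x.ofLp) x
  have h1 : (EuclideanSpace.equiv (Fin d) ℝ).symm (Matrix.vecMulVec x.ofLp x.ofLp *ᵥ x.ofLp)
      = ‖x‖ ^ 2 • x := by
    ext i
    have : x.ofLp ⬝ᵥ x.ofLp = ‖x‖ ^ 2 := by
      rw [EuclideanSpace.norm_sq_eq, dotProduct]
      exact Finset.sum_congr rfl fun i _ => by rw [Real.norm_eq_abs, sq_abs, sq]
    simp [Matrix.vecMulVec_mulVec, this, mul_comm]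
  rw [h1, norm_smul, Real.norm_of_nonneg (by positivity)] at h
  exact le_of_mul_le_mul_right h (norm_pos_iff.2 hx)

end BilinearForm

/-! ### Convergence of minimizers and the mean value inequality -/

section Deterministic

/-- Minimizers of functions that converge uniformly on a compact set converge to the unique
minimizer of the limit. -/
theorem tendsto_of_isArgmin {m : ℕ} {K : Set (Vec m)} (hK : IsCompact K) {θ₀ : Vec m}
    (hθ₀ : θ₀ ∈ K) {g : ℕ → Vec m → ℝ} {M : Vec m → ℝ} (hM : ContinuousOn M K)
    (hmin : ∀ θ ∈ K, θ ≠ θ₀ → M θ₀ < M θ) (hg : TendstoUniformlyOn g M atTop K)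
    {x : ℕ → Vec m} (hx : ∀ T, 1 ≤ T → IsArgmin (g T) K (x T)) :
    Tendsto x atTop (𝓝 θ₀) := by
  rw [tendsto_nhds]
  intro U hU hθU
  have hC : IsCompact (K \ U) := hK.diff hU
  rcases (K \ U).eq_empty_or_nonempty with he | hne
  · filter_upwards [eventually_ge_atTop 1] with T hT
    by_contra hxU
    have : x T ∈ K \ U := ⟨(hx T hT).1, hxU⟩
    rw [he] at this
    exact this
  · obtain ⟨y, hy, hymin⟩ := hC.exists_isMinOn hne (hM.mono Set.sdiff_subset)
    have hlt := hmin y hy.1 fun h => hy.2 (h ▸ hθU)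
    rw [Metric.tendstoUniformlyOn_iff] at hg
    filter_upwards [hg ((M y - M θ₀) / 2) (by linarith), eventually_ge_atTop 1] with T hT hT1
    by_contra hxU
    have hxT := hx T hT1
    have h1 := hT _ hxT.1
    have h2 := hT _ hθ₀
    have h3 := hxT.2 θ₀ hθ₀
    have h4 : M y ≤ M (x T) := hymin ⟨hxT.1, hxU⟩
    rw [Real.dist_eq, abs_lt] at h1 h2
    linarith [h1.1, h1.2, h2.1, h2.2]

/-- The mean value inequality along a segment contained in a set, with derivatives taken within
the set. -/
theorem enorm_image_sub_le_biSup_fderivWithin {E F : Type*} [NormedAddCommGroup E]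
    [NormedSpace ℝ E] [NormedAddCommGroup F] [NormedSpace ℝ F] {f : E → F} {s : Set E}
    (hf : DifferentiableOn ℝ f s) {x y : E} (hs : segment ℝ x y ⊆ s) :
    ‖f y - f x‖ₑ ≤ (⨆ z ∈ s, ‖fderivWithin ℝ f s z‖ₑ) * ‖y - x‖ₑ := by
  rcases eq_or_ne y x with rfl | hne
  · simp
  set S := ⨆ z ∈ s, ‖fderivWithin ℝ f s z‖ₑ with hS
  rcases eq_or_ne S ∞ with h | h
  · rw [h, ENNReal.top_mul]
    · exact le_top
    · simpa [sub_eq_zero] using hne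
  have hb : ∀ z ∈ s, ‖fderivWithin ℝ f s z‖ ≤ S.toReal := fun z hz => by
    rw [← toReal_enorm]
    exact ENNReal.toReal_mono h (le_biSup (fun z => ‖fderivWithin ℝ f s z‖ₑ) hz)
  -- A derivative within `s` is also one within the segment, which is convex. Neither convexity of
  -- `s` nor uniqueness of derivatives within `s` is needed.
  have := (convex_segment x y).norm_image_sub_le_of_norm_hasFDerivWithin_le (f := f)
    (fun z hz => ((hf z (hs hz)).hasFDerivWithinAt).mono hs) (fun z hz => hb z (hs hz))
    (left_mem_segment ℝ x y) (right_mem_segment ℝ x y)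
  rw [← ofReal_norm, ← ofReal_norm (y - x), ← ENNReal.ofReal_toReal h,
    ← ENNReal.ofReal_mul ENNReal.toReal_nonneg]
  exact ENNReal.ofReal_le_ofReal this

end Deterministic

/-! ### Measurability of the model -/

section Measurability

variable {Ω : Type*} [MeasurableSpace Ω] {μ : Measure Ω} {d m q : ℕ} {Y : ℤ → Ω → Vec d}
  {Θ : Set (Vec m)} {lam : (ℕ → Vec d) → Vec m → Vec d}

theorem measurable_wform {α : Type*} [MeasurableSpace α] {W : α → Matrix (Fin d) (Fin d) ℝ}
    (hW : ∀ i j, Measurable fun a => W a i j) {x y : α → Vec d} (hx : Measurable x)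
    (hy : Measurable y) : Measurable fun a => wform (W a) (x a) (y a) := by
  have hW' : Measurable fun a i j => W a i j :=
    measurable_pi_lambda _ fun i => measurable_pi_lambda _ fun j => hW i j
  exact (continuous_wform (d := d)).measurable.comp (hW'.prodMk (hx.prodMk hy))

theorem measurable_toLp_vecMul {α : Type*} [MeasurableSpace α]
    {W : α → Matrix (Fin d) (Fin d) ℝ} (hW : ∀ i j, Measurable fun a => W a i j)
    {x : α → Vec d} (hx : Measurable x) :
    Measurable fun a => (WithLp.toLp 2 ((x a).ofLp ᵥ* W a) : Vec d) := by
  refine (PiLp.continuous_toLp 2 _).measurable.comp (measurable_pi_lambda _ fun j => ?_)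
  simp only [Matrix.vecMul, dotProduct]
  refine Finset.measurable_fun_sum _ fun i _ => Measurable.mul ?_ (hW i j)
  exact (EuclideanSpace.proj (𝕜 := ℝ) i).continuous.measurable.comp hx

/-- By Cramer's rule the entries are a quotient of polynomials in those of `A`; the convention `0⁻¹
= 0` covers singular matrices on both sides. -/
theorem measurable_matrix_inv {α : Type*} [MeasurableSpace α] {A : α → Matrix (Fin d) (Fin d) ℝ}
    (hA : ∀ i j, Measurable fun a => A a i j) (i j : Fin d) :
    Measurable fun a => (A a)⁻¹ i j := by
  have hA' : Measurable fun a i j => A a i j :=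
    measurable_pi_lambda _ fun i => measurable_pi_lambda _ fun j => hA i j
  have h1 : Continuous fun M : Matrix (Fin d) (Fin d) ℝ => M.adjugate i j := by fun_prop
  have h2 : Continuous fun M : Matrix (Fin d) (Fin d) ℝ => M.det := by fun_prop
  have h1c : Continuous fun M : Fin d → Fin d → ℝ => (Matrix.of M).adjugate i j := h1
  have h2c : Continuous fun M : Fin d → Fin d → ℝ => (Matrix.of M).det := h2
  have h3 : (fun a => (A a)⁻¹ i j) = fun a => (A a).det⁻¹ * (A a).adjugate i j := by
    ext a
    rw [Matrix.inv_def, Ring.inverse_eq_inv', Matrix.smul_apply, smul_eq_mul]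
  rw [h3]
  exact (h2c.measurable.comp hA').inv.mul (h1c.measurable.comp hA')

theorem measurable_inv_pseudoCov {ν : (ℕ → Vec d) → Param m q → Fin d → ℝ}
    {P : Param m q → Matrix (Fin d) (Fin d) ℝ} {τ : Param m q}
    (hν : ∀ i, Measurable fun y => ν y τ i) (i j : Fin d) :
    Measurable fun y => (pseudoCov ν P y τ)⁻¹ i j := by
  refine measurable_matrix_inv (fun i j => ?_) i j
  simp only [pseudoCov, Matrix.mul_diagonal, Matrix.diagonal_mul]
  exact ((hν i).sqrt.mul_const _).mul (hν j).sqrt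

theorem isFactor_loss {W : (ℕ → Vec d) → Matrix (Fin d) (Fin d) ℝ}
    (hW : ∀ i j, Measurable fun y => W y i j) {θ : Vec m} (hlam : Measurable fun y => lam y θ) :
    IsFactor μ (window Y) fun t ω => loss lam Y (pastWeights W Y) t ω θ := by
  have hr : Measurable fun s : Vec d × (ℕ → Vec d) => s.1 - lam s.2 θ :=
    measurable_fst.sub (hlam.comp measurable_snd)
  exact isFactor_of_measurable (measurable_wform (fun i j => (hW i j).comp measurable_snd) hr hr)

theorem history_le (hY : ∀ t, Measurable (Y t)) (t : ℤ) :
    history Y t ≤ (inferInstance : MeasurableSpace Ω) :=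
  iSup₂_le fun s _ => (hY s).comap_le

theorem measurable_history {Ω : Type*} (Y : ℤ → Ω → Vec d) {s t : ℤ} (h : s ≤ t) :
    Measurable[history Y t] (Y s) :=
  Measurable.mono (comap_measurable (Y s))
    (le_iSup₂_of_le (f := fun s (_ : s ≤ t) => MeasurableSpace.comap (Y s) inferInstance) s h
      le_rfl) le_rfl

theorem measurable_past_history {Ω : Type*} (Y : ℤ → Ω → Vec d) (t : ℤ) :
    Measurable[history Y (t - 1)] (past Y t) :=
  @measurable_pi_lambda _ _ _ (history Y (t - 1)) _ _ fun n =>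
    measurable_history Y (by have : (0 : ℤ) ≤ n := Int.natCast_nonneg n
                             linarith)

theorem history_mono {Ω : Type*} (Y : ℤ → Ω → Vec d) {s t : ℤ} (h : s ≤ t) :
    history Y s ≤ history Y t :=
  iSup₂_le fun r hr => le_iSup₂_of_le
    (f := fun s (_ : s ≤ t) => MeasurableSpace.comap (Y s) inferInstance) r (hr.trans h) le_rfl

variable {θ₀ : Vec m}

theorem integrable_resid (hmean : MeanModel μ lam Y θ₀) (t : ℤ) :
    Integrable (fun ω => resid lam Y t ω θ₀) μ :=
  (hmean t).1.sub (integrable_condExp.congr (hmean t).2)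

theorem condExp_resid [IsProbabilityMeasure μ] (hY : ∀ t, Measurable (Y t))
    (hlam : Measurable fun y => lam y θ₀)
    (hmean : MeanModel μ lam Y θ₀) (t : ℤ) :
    μ[fun ω => resid lam Y t ω θ₀ | history Y (t - 1)] =ᵐ[μ] 0 := by
  have hi : Integrable (fun ω => lam (past Y t ω) θ₀) μ := integrable_condExp.congr (hmean t).2
  have h1 := condExp_sub (hmean t).1 hi (history Y (t - 1))
  have hm : StronglyMeasurable[history Y (t - 1)] fun ω => lam (past Y t ω) θ₀ :=
    (hlam.comp (measurable_past_history Y t)).stronglyMeasurable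
  have h2 := condExp_of_stronglyMeasurable (history_le hY (t - 1)) hm hi
  filter_upwards [h1, (hmean t).2] with ω h3 h4
  have h5 : (μ[fun ω => resid lam Y t ω θ₀ | history Y (t - 1)]) ω
      = (μ[Y t - fun ω => lam (past Y t ω) θ₀ | history Y (t - 1)]) ω := rfl
  rw [h5, h3, Pi.sub_apply, h2, h4, sub_self]
  rfl

end Measurability

/-! ### Consistency -/

section Consistency

variable {Ω : Type*} [MeasurableSpace Ω] {μ : Measure Ω} [IsProbabilityMeasure μ] {d m q : ℕ}
  {Y : ℤ → Ω → Vec d} {Θ : Set (Vec m)} {θ₀ : Vec m} {lam : (ℕ → Vec d) → Vec m → Vec d}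
  {W : (ℕ → Vec d) → Matrix (Fin d) (Fin d) ℝ}

theorem continuousOn_loss {Ω : Type*} {Y : ℤ → Ω → Vec d} {t : ℤ} {ω : Ω}
    (W : ℤ → Ω → Matrix (Fin d) (Fin d) ℝ) (h : ContinuousOn (lam (past Y t ω)) Θ) :
    ContinuousOn (fun θ => loss lam Y W t ω θ) Θ := by
  have hr : ContinuousOn (fun θ => resid lam Y t ω θ) Θ := continuousOn_const.sub h
  exact (continuous_wform (d := d)).comp_continuousOn
    ((continuousOn_const (c := W t ω)).prodMk (hr.prodMk hr))

/-- The limit objective has its unique minimum at `θ₀`. -/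
theorem integral_loss_lt (hY : ∀ t, Measurable (Y t)) (hθ₀ : θ₀ ∈ Θ)
    (hlam : ∀ θ ∈ Θ, Measurable fun y => lam y θ) (hmean : MeanModel μ lam Y θ₀)
    (hW : ∀ i j, Measurable fun y => W y i j) (hmom : LossMoment μ lam Y (pastWeights W Y) Θ)
    (hpos : PosDefWeights μ (pastWeights W Y)) (hid : Identified μ lam Y Θ θ₀)
    {θ : Vec m} (hθ : θ ∈ Θ) (hne : θ ≠ θ₀) :
    ∫ ω, loss lam Y (pastWeights W Y) 0 ω θ₀ ∂μ < ∫ ω, loss lam Y (pastWeights W Y) 0 ω θ ∂μ := by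
  have hi : ∀ θ ∈ Θ, Integrable (fun ω => loss lam Y (pastWeights W Y) 0 ω θ) μ := fun θ hθ =>
    ⟨((isFactor_loss hW (hlam θ hθ)).aemeasurable (measurable_window hY) 0).aestronglyMeasurable,
      (lintegral_mono fun ω =>
        le_biSup (fun θ => ‖loss lam Y (pastWeights W Y) 0 ω θ‖ₑ) hθ).trans_lt
        (hmom 0)⟩
  set e : Ω → Vec d := fun ω => resid lam Y 0 ω θ₀ with he
  set Δ : Ω → Vec d := fun ω => lam (past Y 0 ω) θ₀ - lam (past Y 0 ω) θ with hΔ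
  set V : Ω → Matrix (Fin d) (Fin d) ℝ := fun ω => W (past Y 0 ω) with hV
  have hres : ∀ ω, resid lam Y 0 ω θ = e ω + Δ ω := fun ω => by
    simp only [he, hΔ, resid]
    abel
  have hl0 : ∀ ω, loss lam Y (pastWeights W Y) 0 ω θ₀ = wform (V ω) (e ω) (e ω) := fun ω => rfl
  have hl : ∀ ω, loss lam Y (pastWeights W Y) 0 ω θ = wform (V ω) (e ω + Δ ω) (e ω + Δ ω) :=
    fun ω => by rw [← hres]; rfl
  have hmp := measurable_past_history Y 0
  have hpast := measurable_past hY 0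
  have hΔm : Measurable Δ :=
    ((hlam θ₀ hθ₀).comp hpast).sub ((hlam θ hθ).comp hpast)
  have hem : Measurable e := (hY 0).sub ((hlam θ₀ hθ₀).comp hpast)
  have hVm : ∀ i j, Measurable fun ω => V ω i j := fun i j => (hW i j).comp hpast
  -- Only first moments of `Y` are available, so integrability comes from the losses: `|Δ'Ve| ≤ |(e
  -- + Δ)'Ve| + e'Ve`, and the first term is at most half the sum of the losses at `θ` and `θ₀`.
  have hcross : Integrable (fun ω => wform (V ω) (Δ ω) (e ω)) μ := by
    refine (((hi θ hθ).add (hi θ₀ hθ₀)).add (hi θ₀ hθ₀)).mono'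
      (measurable_wform hVm hΔm hem).aestronglyMeasurable ?_
    filter_upwards [hpos 0] with ω hω
    have h1 := two_mul_abs_wform_le hω (e ω + Δ ω) (e ω)
    have h2 := wform_self_nonneg hω (e ω)
    have h3 := wform_self_nonneg hω (e ω + Δ ω)
    have h4 : wform (V ω) (Δ ω) (e ω)
        = wform (V ω) (e ω + Δ ω) (e ω) - wform (V ω) (e ω) (e ω) := by
      rw [wform_add_left]
      ring
    simp only [Pi.add_apply]
    rw [hl, hl0, Real.norm_eq_abs, h4]
    have hVW : pastWeights W Y 0 ω = V ω := rfl
    rw [hVW] at h1 h2 h3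
    rw [abs_le]
    constructor <;> linarith [neg_abs_le (wform (V ω) (e ω + Δ ω) (e ω)),
      le_abs_self (wform (V ω) (e ω + Δ ω) (e ω))]
  -- The vector `Δ'V` is a function of the past, while `e` has conditional mean zero given the past.
  have hcross0 : ∫ ω, wform (V ω) (Δ ω) (e ω) ∂μ = 0 := by
    have hf : StronglyMeasurable[history Y (0 - 1)] fun ω =>
        (WithLp.toLp 2 ((Δ ω).ofLp ᵥ* V ω) : Vec d) := by
      have hG : Measurable fun y : ℕ → Vec d =>
          (WithLp.toLp 2 ((lam y θ₀ - lam y θ).ofLp ᵥ* W y) : Vec d) :=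
        measurable_toLp_vecMul hW ((hlam θ₀ hθ₀).sub (hlam θ hθ))
      exact (hG.comp hmp).stronglyMeasurable
    have heq : (fun ω => wform (V ω) (Δ ω) (e ω)) = fun ω =>
        innerSL ℝ (WithLp.toLp 2 ((Δ ω).ofLp ᵥ* V ω) : Vec d) (e ω) := by
      ext ω
      rw [wform_eq_inner]
      rfl
    rw [heq] at hcross ⊢
    exact integral_eq_zero_of_condExp_eq_zero (history_le hY (0 - 1))
      (condExp_bilin_eq_zero (innerSL ℝ) hf hcross (integrable_resid hmean 0)
        (condExp_resid hY (hlam θ₀ hθ₀) hmean 0))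
  have hdec : (fun ω => wform (V ω) (Δ ω) (Δ ω)) =ᵐ[μ] fun ω =>
      loss lam Y (pastWeights W Y) 0 ω θ - loss lam Y (pastWeights W Y) 0 ω θ₀
        - 2 * wform (V ω) (Δ ω) (e ω) := by
    filter_upwards [hpos 0] with ω hω
    have hs : (pastWeights W Y 0 ω).IsSymm := by simpa using hω.isHermitian
    change (V ω).IsSymm at hs
    rw [hl, hl0]
    simp only [wform_add_left, wform_add_right, wform_comm hs (e ω) (Δ ω)]
    ring
  have hΔi : Integrable (fun ω => wform (V ω) (Δ ω) (Δ ω)) μ :=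
    (((hi θ hθ).sub (hi θ₀ hθ₀)).sub (hcross.const_mul 2)).congr hdec.symm
  have hΔ0 : 0 ≤ᵐ[μ] fun ω => wform (V ω) (Δ ω) (Δ ω) := by
    filter_upwards [hpos 0] with ω hω
    exact wform_self_nonneg hω _
  have hval : ∫ ω, wform (V ω) (Δ ω) (Δ ω) ∂μ = ∫ ω, loss lam Y (pastWeights W Y) 0 ω θ ∂μ
      - ∫ ω, loss lam Y (pastWeights W Y) 0 ω θ₀ ∂μ := by
    have hsub := (hi θ hθ).sub (hi θ₀ hθ₀)
    rw [integral_congr_ae hdec, integral_sub (f := fun ω => loss lam Y (pastWeights W Y) 0 ω θ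
      - loss lam Y (pastWeights W Y) 0 ω θ₀) hsub (hcross.const_mul 2),
      integral_sub (hi θ hθ) (hi θ₀ hθ₀), integral_const_mul, hcross0]
    ring
  by_contra hle
  have hz : ∫ ω, wform (V ω) (Δ ω) (Δ ω) ∂μ = 0 :=
    le_antisymm (by rw [hval]; linarith) (integral_nonneg_of_ae hΔ0)
  rw [integral_eq_zero_iff_of_nonneg_ae hΔ0 hΔi] at hz
  -- A vanishing mean of the nonnegative variable `Δ'VΔ` forces `Δ = 0` a.s., which identification
  -- excludes.
  refine hne ((hid 0 θ hθ).1 ?_)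
  filter_upwards [hz, hpos 0] with ω h1 h2
  have := eq_zero_of_wform_self h2 h1
  exact (sub_eq_zero.1 this).symm

theorem ae_tendstoUniformlyOn_objective (hY : ∀ t, Measurable (Y t))
    (hE : StationaryErgodic μ Y) (hlam : ∀ θ ∈ Θ, Measurable fun y => lam y θ)
    (hW : ∀ i j, Measurable fun y => W y i j)
    (hcont : ∀ t, ∀ᵐ ω ∂μ, ContinuousOn (lam (past Y t ω)) Θ) (hΘ : IsCompact Θ)
    (hmom : LossMoment μ lam Y (pastWeights W Y) Θ) :
    ∀ᵐ ω ∂μ, TendstoUniformlyOn (fun T θ => objective lam Y (pastWeights W Y) T ω θ)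
      (fun θ => ∫ ω, loss lam Y (pastWeights W Y) 0 ω θ ∂μ) atTop Θ :=
  ae_tendstoUniformlyOn_average hY hE hΘ
    (f := fun θ t ω => loss lam Y (pastWeights W Y) t ω θ)
    (fun θ hθ => isFactor_loss hW (hlam θ hθ))
    (fun t => (hcont t).mono fun _ h => continuousOn_loss _ h) (hmom 0)

/-- Strong consistency of minimizers of any criterion that is uniformly close to the weighted
least squares criterion with weights depending on the past. -/
theorem ae_tendsto_argmin (hY : ∀ t, Measurable (Y t))
    (hE : StationaryErgodic μ Y) (hθ₀ : θ₀ ∈ Θ) (hlam : ∀ θ ∈ Θ, Measurable fun y => lam y θ)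
    (hmean : MeanModel μ lam Y θ₀) (hW : ∀ i j, Measurable fun y => W y i j)
    (hcont : ∀ t, ∀ᵐ ω ∂μ, ContinuousOn (lam (past Y t ω)) Θ) (hΘ : IsCompact Θ)
    (hmom : LossMoment μ lam Y (pastWeights W Y) Θ)
    (hpos : PosDefWeights μ (pastWeights W Y)) (hid : Identified μ lam Y Θ θ₀)
    {g : ℕ → Ω → Vec m → ℝ}
    (hg : ∀ᵐ ω ∂μ, TendstoUniformlyOn
      (fun T θ => g T ω θ - objective lam Y (pastWeights W Y) T ω θ) 0 atTop Θ)
    {x : ℕ → Ω → Vec m} (hx : ∀ᵐ ω ∂μ, ∀ T, 1 ≤ T → IsArgmin (g T ω) Θ (x T ω)) :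
    ∀ᵐ ω ∂μ, Tendsto (fun T => x T ω) atTop (𝓝 θ₀) := by
  filter_upwards [ae_tendstoUniformlyOn_objective hY hE hlam hW hcont hΘ hmom, hg, hx,
    ae_all_iff.2 hcont] with ω h1 h2 h3 h4
  have hcM : ContinuousOn (fun θ => ∫ ω, loss lam Y (pastWeights W Y) 0 ω θ ∂μ) Θ := by
    refine h1.continuousOn (Frequently.of_forall fun T => ?_)
    exact continuousOn_const.mul (continuousOn_finsetSum _ fun t _ => continuousOn_loss _ (h4 _))
  refine tendsto_of_isArgmin hΘ hθ₀ hcM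
    (fun θ hθ hne => integral_loss_lt hY hθ₀ hlam hmean hW hmom hpos hid hθ hne) ?_ h3
  have := h2.add h1
  simpa [Pi.add_def] using this

end Consistency

/-! ### Replacing the limit weights by estimated ones -/

section SecondStep

variable {Ω : Type*} {d m q : ℕ} {Y : ℤ → Ω → Vec d} {Θ : Set (Vec m)} {Γ : Set (Vec q)}
  {lam : (ℕ → Vec d) → Vec m → Vec d} {ν : (ℕ → Vec d) → Param m q → Fin d → ℝ}
  {P : Param m q → Matrix (Fin d) (Fin d) ℝ} {τ τ₀ : Param m q}

/-- The weights as functions of the past. -/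
noncomputable def invCov (ν : (ℕ → Vec d) → Param m q → Fin d → ℝ)
    (P : Param m q → Matrix (Fin d) (Fin d) ℝ) (τ : Param m q) (y : ℕ → Vec d) :
    Matrix (Fin d) (Fin d) ℝ :=
  (pseudoCov ν P y τ)⁻¹

theorem toLp_vec_invCov_sub (t : ℤ) (ω : Ω) :
    (WithLp.toLp 2 (Matrix.vec (invCov ν P τ (past Y t ω) - invCov ν P τ₀ (past Y t ω))) :
      EuclideanSpace ℝ (Fin d × Fin d)) = kvec ν P Y t ω τ - kvec ν P Y t ω τ₀ := by
  ext p
  simp [kvec, invCov, Matrix.vec]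

/-- The weights are Lipschitz at `τ₀` with constant `sup ⦀∂k/∂τ⦀`. -/
theorem enorm_kvec_sub_le {t : ℤ} {ω : Ω}
    (hk : ContDiffOn ℝ 1 (kvec ν P Y t ω) (paramSpace Θ Γ))
    (hseg : segment ℝ τ₀ τ ⊆ paramSpace Θ Γ) :
    ‖kvec ν P Y t ω τ - kvec ν P Y t ω τ₀‖ₑ ≤ supDk ν P Y Θ Γ t ω * ‖τ - τ₀‖ₑ :=
  enorm_image_sub_le_biSup_fderivWithin (hk.differentiableOn one_ne_zero) hseg

theorem enorm_wform_invCov_sub_le (t : ℤ) (ω : Ω) (x y : Vec d) :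
    ‖wform (invCov ν P τ (past Y t ω)) x y - wform (invCov ν P τ₀ (past Y t ω)) x y‖ₑ
      ≤ ‖kvec ν P Y t ω τ - kvec ν P Y t ω τ₀‖ₑ * ‖x‖ₑ * ‖y‖ₑ := by
  rw [← wform_sub_matrix, ← toLp_vec_invCov_sub, ← ofReal_norm, ← ofReal_norm x, ← ofReal_norm y,
    ← ofReal_norm (WithLp.toLp 2 _), ← ENNReal.ofReal_mul (by positivity),
    ← ENNReal.ofReal_mul (by positivity)]
  exact ENNReal.ofReal_le_ofReal (abs_wform_le _ x y)

/-- The loss with weights computed at `τ`. -/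
noncomputable def paramLoss (lam : (ℕ → Vec d) → Vec m → Vec d)
    (ν : (ℕ → Vec d) → Param m q → Fin d → ℝ) (P : Param m q → Matrix (Fin d) (Fin d) ℝ)
    (Y : ℤ → Ω → Vec d) (t : ℤ) (ω : Ω) (τ : Param m q) (θ : Vec m) : ℝ :=
  loss lam Y (pastWeights (invCov ν P τ) Y) t ω θ

open scoped Matrix.Norms.L2Operator in
theorem enorm_paramLoss_sub_le {t : ℤ} {ω : Ω}
    (hk : ContDiffOn ℝ 1 (kvec ν P Y t ω) (paramSpace Θ Γ))
    (hseg : segment ℝ τ₀ τ ⊆ paramSpace Θ Γ) {θ : Vec m} (hθ : θ ∈ Θ) :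
    ‖paramLoss lam ν P Y t ω τ θ - paramLoss lam ν P Y t ω τ₀ θ‖ₑ
      ≤ Zvar lam ν P Y Θ Γ t ω * ‖τ - τ₀‖ₑ := by
  refine (enorm_wform_invCov_sub_le t ω (resid lam Y t ω θ) (resid lam Y t ω θ)).trans ?_
  have h1 := enorm_kvec_sub_le hk hseg
  have h2 : ‖resid lam Y t ω θ‖ₑ * ‖resid lam Y t ω θ‖ₑ ≤ ⨆ θ ∈ Θ,
      ‖Matrix.vecMulVec (resid lam Y t ω θ).ofLp (resid lam Y t ω θ).ofLp‖ₑ := by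
    refine le_trans ?_ (le_biSup (fun θ =>
      ‖Matrix.vecMulVec (resid lam Y t ω θ).ofLp (resid lam Y t ω θ).ofLp‖ₑ) hθ)
    rw [← ofReal_norm, ← ofReal_norm (Matrix.vecMulVec _ _), ← ENNReal.ofReal_mul (by positivity),
      ← sq]
    exact ENNReal.ofReal_le_ofReal (sq_norm_le_norm_vecMulVec _)
  rw [mul_assoc, Zvar, mul_right_comm]
  exact mul_le_mul' h1 h2

theorem continuousOn_paramLoss {t : ℤ} {ω : Ω}
    (hk : ContinuousOn (kvec ν P Y t ω) (paramSpace Θ Γ))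
    (hlam : ContinuousOn (lam (past Y t ω)) Θ) :
    ContinuousOn (fun p : Param m q × Vec m => paramLoss lam ν P Y t ω p.1 p.2)
      (paramSpace Θ Γ ×ˢ Θ) := by
  have hr : ContinuousOn (fun p : Param m q × Vec m => resid lam Y t ω p.2)
      (paramSpace Θ Γ ×ˢ Θ) :=
    continuousOn_const.sub (hlam.comp continuousOn_snd fun p hp => hp.2)
  have hW : ContinuousOn (fun (p : Param m q × Vec m) i j => invCov ν P p.1 (past Y t ω) i j)
      (paramSpace Θ Γ ×ˢ Θ) := by
    refine continuousOn_pi.2 fun i => continuousOn_pi.2 fun j => ?_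
    have h : ContinuousOn (fun τ => (kvec ν P Y t ω τ) (j, i)) (paramSpace Θ Γ) :=
      (EuclideanSpace.proj (𝕜 := ℝ) (j, i)).continuous.comp_continuousOn hk
    exact h.comp continuousOn_fst fun p hp => hp.1
  exact (continuous_wform (d := d)).comp_continuousOn (hW.prodMk (hr.prodMk hr))

variable [MeasurableSpace Ω] {μ : Measure Ω} [IsProbabilityMeasure μ]

/-- The criterion with estimated weights is uniformly close to the one with the limit weights. -/
theorem ae_tendstoUniformlyOn_objective_sub (hY : ∀ t, Measurable (Y t))
    (hE : StationaryErgodic μ Y) (hlam : ∀ θ ∈ Θ, Measurable fun y => lam y θ)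
    (hτ₀ : τ₀ ∈ paramSpace Θ Γ) (hstar : LocallyStarShapedAt (paramSpace Θ Γ) τ₀)
    (hν : ∀ τ ∈ paramSpace Θ Γ, ∀ i, Measurable fun y => ν y τ i)
    (hcont : ∀ t, ∀ᵐ ω ∂μ, ContinuousOn (lam (past Y t ω)) Θ)
    (hk : ∀ t, ∀ᵐ ω ∂μ, ContDiffOn ℝ 1 (kvec ν P Y t ω) (paramSpace Θ Γ))
    (hZ : ∀ t, ∫⁻ ω, Zvar lam ν P Y Θ Γ t ω ∂μ < ∞) {τhat : ℕ → Ω → Param m q}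
    (hτmem : ∀ᵐ ω ∂μ, ∀ T, 1 ≤ T → τhat T ω ∈ paramSpace Θ Γ)
    (hτlim : ∀ᵐ ω ∂μ, Tendsto (fun T => τhat T ω) atTop (𝓝 τ₀)) :
    ∀ᵐ ω ∂μ, TendstoUniformlyOn
      (fun T θ => objective lam Y (estWeights ν P Y (τhat T)) T ω θ
        - objective lam Y (pastWeights (invCov ν P τ₀) Y) T ω θ) 0 atTop Θ := by
  obtain ⟨ε, hε, hseg⟩ := hstar
  -- The law of large numbers is applied to the supremum over `S` of difference quotients of the
  -- loss in `τ`, rather than to `Z_t`. This supremum is a factor by continuity on `S`, whereas no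
  -- measurability of the derivatives within `𝒯` is at hand. Excluding `τ₀` keeps the quotient
  -- continuous.
  set S : Set (Param m q × Vec m) :=
    {p | p ∈ paramSpace Θ Γ ×ˢ Θ ∧ ‖p.1 - τ₀‖ < ε ∧ p.1 ≠ τ₀} with hS
  set r : Param m q × Vec m → ℤ → Ω → ℝ := fun p t ω =>
    (paramLoss lam ν P Y t ω p.1 p.2 - paramLoss lam ν P Y t ω τ₀ p.2) / ‖p.1 - τ₀‖ with hr
  have hfac : ∀ τ ∈ paramSpace Θ Γ, ∀ θ ∈ Θ,
      IsFactor μ (window Y) fun t ω => paramLoss lam ν P Y t ω τ θ := fun τ hτ θ hθ =>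
    isFactor_loss (fun i j => measurable_inv_pseudoCov (hν τ hτ) i j) (hlam θ hθ)
  have hRf : IsFactor μ (window Y) fun t ω => ⨆ p ∈ S, ‖r p t ω‖ₑ := by
    refine IsFactor.biSup_of_continuousOn (s := S) (Z := fun p t ω => ‖r p t ω‖ₑ)
      (fun p hp => ?_) fun t => ?_
    · have hg : Measurable fun z : ℝ × ℝ => ‖(z.1 - z.2) / ‖p.1 - τ₀‖‖ₑ := by fun_prop
      exact ((hfac _ hp.1.1 _ hp.1.2).prodMk (hfac _ hτ₀ _ hp.1.2)).comp hg
    · filter_upwards [hcont t, hk t] with ω h1 h2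
      have hc := continuousOn_paramLoss h2.continuousOn h1
      have hc1 : ContinuousOn (fun p : Param m q × Vec m => paramLoss lam ν P Y t ω p.1 p.2) S :=
        hc.mono fun p hp => hp.1
      have hc2 : ContinuousOn (fun p : Param m q × Vec m => paramLoss lam ν P Y t ω τ₀ p.2) S :=
        hc.comp (f := fun p : Param m q × Vec m => (τ₀, p.2)) (by fun_prop)
          fun p hp => ⟨hτ₀, hp.1.2⟩
      have hc3 : ContinuousOn (fun p : Param m q × Vec m => ‖p.1 - τ₀‖) S := by fun_prop
      exact ((hc1.sub hc2).div hc3 fun p hp => norm_ne_zero_iff.2 (sub_ne_zero.2 hp.2.2)).enorm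
  have hmulr : ∀ (p : Param m q × Vec m) t ω, p.1 ≠ τ₀ → ‖r p t ω‖ₑ * ‖p.1 - τ₀‖ₑ =
      ‖paramLoss lam ν P Y t ω p.1 p.2 - paramLoss lam ν P Y t ω τ₀ p.2‖ₑ := fun p t ω hp => by
    rw [← enorm_norm (p.1 - τ₀), ← enorm_mul, hr]
    simp only
    rw [div_mul_cancel₀ _ (norm_ne_zero_iff.2 (sub_ne_zero.2 hp))]
  -- By the mean value inequality on the segment from `τ₀`, every quotient is at most `Z_t`.
  have hRi : ∫⁻ ω, ⨆ p ∈ S, ‖r p 0 ω‖ₑ ∂μ < ∞ := by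
    refine (lintegral_mono_ae ?_).trans_lt (hZ 0)
    filter_upwards [hk 0] with ω h
    refine iSup₂_le fun p hp => ?_
    have h1 := enorm_paramLoss_sub_le (lam := lam) h (hseg p.1 hp.1.1 hp.2.1) hp.1.2
    rw [← hmulr p 0 ω hp.2.2] at h1
    refine (ENNReal.mul_le_mul_iff_left ?_ enorm_ne_top).1 h1
    simpa [sub_eq_zero] using hp.2.2
  filter_upwards [hRf.ae_tendsto_average_toReal hY hE hRi, hτmem, hτlim] with ω h1 h2 h3
  have h3' : Tendsto (fun T => ‖τhat T ω - τ₀‖) atTop (𝓝 0) := by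
    simpa using (h3.sub_const τ₀).norm
  have h4 := h3'.mul h1.2
  rw [zero_mul] at h4
  rw [Metric.tendstoUniformlyOn_iff]
  intro η hη
  filter_upwards [h4.eventually_lt_const hη, h3'.eventually_lt_const hε,
    eventually_ge_atTop 1] with T hT1 hT2 hT3 θ hθ
  rw [Pi.zero_apply, dist_zero_left, Real.norm_eq_abs]
  refine lt_of_le_of_lt ?_ hT1
  rw [objective, objective, ← mul_sub, ← Finset.sum_sub_distrib, abs_mul,
    abs_of_nonneg (by positivity), mul_left_comm, Finset.mul_sum]
  gcongr
  refine (Finset.abs_sum_le_sum_abs _ _).trans (Finset.sum_le_sum fun t _ => ?_)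
  change |paramLoss lam ν P Y t ω (τhat T ω) θ - paramLoss lam ν P Y t ω τ₀ θ| ≤ _
  rcases eq_or_ne (τhat T ω) τ₀ with h | h
  · rw [h, sub_self, abs_zero]
    positivity
  · have hp : (τhat T ω, θ) ∈ S := ⟨⟨h2 T hT3, hθ⟩, hT2, h⟩
    rw [← Real.norm_eq_abs, ← toReal_enorm, ← hmulr (τhat T ω, θ) t ω h, ENNReal.toReal_mul,
      toReal_enorm (τhat T ω - τ₀), mul_comm]
    gcongr
    · exact (h1.1 t).ne
    · exact le_biSup (fun p => ‖r p t ω‖ₑ) hp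

end SecondStep

/-! ### Derivatives of the loss -/

section Derivatives

variable {d m : ℕ}

/-- `wform` as a continuous bilinear map. -/
noncomputable def wformL (W : Matrix (Fin d) (Fin d) ℝ) : Vec d →L[ℝ] Vec d →L[ℝ] ℝ :=
  LinearMap.mkContinuous₂
    (LinearMap.mk₂ ℝ (wform W) (wform_add_left W) (fun c x y => by simp [wform])
      (wform_add_right W) fun c x y => by simp [wform, Matrix.mulVec_smul])
    ‖(WithLp.toLp 2 (Matrix.vec W) : EuclideanSpace ℝ (Fin d × Fin d))‖
    fun x y => abs_wform_le W x y

@[simp]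
theorem wformL_apply (W : Matrix (Fin d) (Fin d) ℝ) (x y : Vec d) :
    wformL W x y = wform W x y := rfl

variable {l : Vec m → Vec d} {U : Set (Vec m)} {W : Matrix (Fin d) (Fin d) ℝ}

theorem contDiffOn_wform {n : ℕ∞} (W : Matrix (Fin d) (Fin d) ℝ) (y : Vec d)
    (hl : ContDiffOn ℝ n l U) :
    ContDiffOn ℝ n (fun θ => wform W (y - l θ) (y - l θ)) U := by
  have he : ContDiffOn ℝ n (fun θ => y - l θ) U := contDiffOn_const.sub hl
  exact (wformL W).isBoundedBilinearMap.contDiff.comp_contDiffOn (he.prodMk he)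

/-- Product rule; the symmetry of `W` merges the two terms into the factor `-2`. -/
theorem hasFDerivAt_wform (hW : W.IsSymm) (y : Vec d) {θ : Vec m} (hl : DifferentiableAt ℝ l θ) :
    HasFDerivAt (fun θ => wform W (y - l θ) (y - l θ))
      ((-2 : ℝ) • ((wformL W).flip (y - l θ)).comp (fderiv ℝ l θ)) θ := by
  have he : HasFDerivAt (fun θ => y - l θ) (-fderiv ℝ l θ) θ := hl.hasFDerivAt.const_sub y
  have h := (wformL W).hasFDerivAt_of_bilinear he he
  refine h.congr_fderiv ?_
  ext v
  change wformL W (y - l θ) (-(fderiv ℝ l θ v)) + wformL W (-(fderiv ℝ l θ v)) (y - l θ)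
    = -2 * wformL W (fderiv ℝ l θ v) (y - l θ)
  rw [map_neg, map_neg, neg_apply, wformL_apply, wformL_apply, wform_comm hW (y - l θ)]
  ring

theorem hessian_eq_of_mem_interior {f : Vec m → ℝ} {Θ : Set (Vec m)} {θ : Vec m}
    (hθ : θ ∈ interior Θ) (i j : Fin m) :
    hessian f Θ θ i j = fderiv ℝ (fderiv ℝ f) θ (EuclideanSpace.single i 1)
      (EuclideanSpace.single j 1) := by
  have h : fderivWithin ℝ f Θ =ᶠ[𝓝 θ] fderiv ℝ f := by
    filter_upwards [isOpen_interior.mem_nhds hθ] with η hη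
    exact fderivWithin_of_mem_nhds (mem_interior_iff_mem_nhds.1 hη)
  rw [hessian, Matrix.of_apply, fderivWithin_of_mem_nhds (mem_interior_iff_mem_nhds.1 hθ),
    h.fderiv_eq]

open scoped Matrix.Norms.L2Operator in
theorem abs_entry_le_l2_opNorm {n : ℕ} (A : Matrix (Fin n) (Fin n) ℝ) (i j : Fin n) :
    |A i j| ≤ ‖A‖ := by
  have h := Matrix.l2_opNorm_mulVec A (EuclideanSpace.single j 1)
  have h1 : ‖(EuclideanSpace.single j 1 : Vec n)‖ = 1 := by simp
  rw [h1, mul_one] at h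
  refine le_trans ?_ h
  have := PiLp.norm_apply_le
    ((EuclideanSpace.equiv (Fin n) ℝ).symm (A *ᵥ (EuclideanSpace.single j (1 : ℝ)).ofLp)) i
  simpa using this

theorem eq_sum_smul_single (x : Vec m) : x = ∑ i, x i • EuclideanSpace.single i (1 : ℝ) := by
  ext k
  simp [Finset.sum_apply, Pi.single_apply]

theorem clm_apply_eq_sum (φ : Vec m →L[ℝ] ℝ) (x : Vec m) :
    φ x = ∑ i, x i * φ (EuclideanSpace.single i 1) := by
  conv_lhs => rw [eq_sum_smul_single x]
  rw [map_sum]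
  exact Finset.sum_congr rfl fun i _ => by rw [map_smul, smul_eq_mul]

theorem norm_le_sum_abs (x : Vec m) : ‖x‖ ≤ ∑ i, |x i| := by
  conv_lhs => rw [eq_sum_smul_single x]
  refine (norm_sum_le _ _).trans (Finset.sum_le_sum fun i _ => ?_)
  rw [norm_smul]
  simp

/-- A linear functional on `ℝᵐ` is bounded by the sum of the absolute values of its
coordinates. -/
theorem norm_le_sum_abs_single (φ : Vec m →L[ℝ] ℝ) :
    ‖φ‖ ≤ ∑ i, |φ (EuclideanSpace.single i 1)| := by
  refine φ.opNorm_le_bound (Finset.sum_nonneg fun _ _ => abs_nonneg _) fun x => ?_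
  rw [Real.norm_eq_abs, clm_apply_eq_sum, Finset.sum_mul]
  refine (Finset.abs_sum_le_sum_abs _ _).trans (Finset.sum_le_sum fun i _ => ?_)
  rw [abs_mul, mul_comm]
  gcongr
  exact PiLp.norm_apply_le x i

end Derivatives

/-! ### Derivatives as factors of the process -/

section FactorDerivatives

variable {Ω S : Type*} [MeasurableSpace Ω] [MeasurableSpace S] {μ : Measure Ω} {ξ : ℤ → Ω → S}
  {m : ℕ} {F : Type*} [NormedAddCommGroup F] [NormedSpace ℝ F] [FiniteDimensional ℝ F]
  [MeasurableSpace F] [BorelSpace F]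

/-- A directional derivative is the limit of difference quotients along `θ + v / (n + 1)`, each of
which is a factor. -/
theorem isFactor_fderiv {f : Vec m → ℤ → Ω → F} {U : Set (Vec m)}
    (hf : ∀ θ ∈ U, IsFactor μ ξ (f θ)) {θ : Vec m} (hθ : U ∈ 𝓝 θ)
    (hd : ∀ t, ∀ᵐ ω ∂μ, DifferentiableAt ℝ (fun θ => f θ t ω) θ) (v : Vec m) :
    IsFactor μ ξ fun t ω => fderiv ℝ (fun θ => f θ t ω) θ v := by
  classical
  have : ProperSpace F := FiniteDimensional.proper ℝ F
  have hlim : Tendsto (fun n : ℕ => θ + ((n : ℝ) + 1)⁻¹ • v) atTop (𝓝 θ) := by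
    have h : Tendsto (fun n : ℕ => ((n : ℝ) + 1)⁻¹) atTop (𝓝 0) := by
      simpa using tendsto_one_div_add_atTop_nhds_zero_nat (𝕜 := ℝ)
    simpa using (h.smul_const v).const_add θ
  refine IsFactor.lim (Z := fun n t ω => if θ + ((n : ℝ) + 1)⁻¹ • v ∈ U then
    ((n : ℝ) + 1) • (f (θ + ((n : ℝ) + 1)⁻¹ • v) t ω - f θ t ω) else 0) (fun n => ?_) fun t => ?_
  · by_cases h : θ + ((n : ℝ) + 1)⁻¹ • v ∈ U
    · simp only [h, if_true]
      have hg : Measurable fun p : F × F => ((n : ℝ) + 1) • (p.1 - p.2) := by fun_prop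
      exact ((hf _ h).prodMk (hf θ (mem_of_mem_nhds hθ))).comp hg
    · simp only [h, if_false]
      exact isFactor_of_measurable (G := fun _ => (0 : F)) measurable_const
  · filter_upwards [hd t] with ω hω
    have hc : Tendsto (fun n : ℕ => ‖(n : ℝ) + 1‖) atTop atTop :=
      tendsto_norm_atTop_atTop.comp (tendsto_atTop_add_const_right _ _ tendsto_natCast_atTop_atTop)
    refine (hω.hasFDerivAt.lim v hc).congr' ?_
    filter_upwards [hlim.eventually_mem hθ] with n hn
    rw [if_pos hn]

end FactorDerivatives

/-! ### Normalized sums of powers -/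

section Rate

theorem sum_inv_sqrt_le (n : ℕ) :
    ∑ k ∈ Finset.range n, (√((k : ℝ) + 1))⁻¹ ≤ 2 * √n := by
  induction n with
  | zero => simp
  | succ n ih =>
    rw [Finset.sum_range_succ]
    have h1 : 0 < √((n : ℝ) + 1) := by positivity
    have h2 : √(n : ℝ) ^ 2 = n := Real.sq_sqrt (by positivity)
    have h3 : √((n : ℝ) + 1) ^ 2 = n + 1 := Real.sq_sqrt (by positivity)
    have h4 : (√((n : ℝ) + 1))⁻¹ ≤ 2 * (√((n : ℝ) + 1) - √n) := by
      rw [inv_le_iff_one_le_mul₀ h1]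
      nlinarith [sq_nonneg (√((n : ℝ) + 1) - √n)]
    push_cast
    linarith

theorem sqrt_le_sum_inv_sqrt (n : ℕ) :
    √n ≤ ∑ k ∈ Finset.range n, (√((k : ℝ) + 1))⁻¹ := by
  induction n with
  | zero => simp
  | succ n ih =>
    rw [Finset.sum_range_succ]
    have h1 : 0 < √((n : ℝ) + 1) := by positivity
    have h2 : √(n : ℝ) ^ 2 = n := Real.sq_sqrt (by positivity)
    have h3 : √((n : ℝ) + 1) ^ 2 = n + 1 := Real.sq_sqrt (by positivity)
    have h5 : √(n : ℝ) ≤ √((n : ℝ) + 1) := Real.sqrt_le_sqrt (by linarith)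
    have h4 : √((n : ℝ) + 1) - √n ≤ (√((n : ℝ) + 1))⁻¹ := by
      rw [← one_div, le_div_iff₀ h1]
      nlinarith [Real.sqrt_nonneg (n : ℝ)]
    push_cast
    linarith

/-- Since `t^{-δ} = o(t^{-1/2})` and `∑ t^{-1/2}` diverges, the partial sums inherit the little-o;
those of `t^{-1/2}` are at most `2 √T`. -/
theorem tendsto_inv_sqrt_mul_sum_rpow_neg {δ : ℝ} (hδ : 1 / 2 < δ) :
    Tendsto (fun T : ℕ => (√(T : ℝ))⁻¹ * ∑ t ∈ Finset.Icc 1 T, (t : ℝ) ^ (-δ)) atTop (𝓝 0) := by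
  have ho : (fun k : ℕ => ((k : ℝ) + 1) ^ (-δ)) =o[atTop] fun k : ℕ => (√((k : ℝ) + 1))⁻¹ := by
    refine Asymptotics.isLittleO_of_tendsto (fun k hk => ?_) ?_
    · have : 0 < (√((k : ℝ) + 1))⁻¹ := by positivity
      exact absurd hk this.ne'
    · have h1 : Tendsto (fun x : ℝ => x ^ (-(δ - 1 / 2))) atTop (𝓝 0) :=
        tendsto_rpow_neg_atTop (by linarith)
      have h2 : Tendsto (fun k : ℕ => (k : ℝ) + 1) atTop atTop :=
        tendsto_atTop_add_const_right _ _ tendsto_natCast_atTop_atTop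
      refine (h1.comp h2).congr fun k => ?_
      have hk : (0 : ℝ) < (k : ℝ) + 1 := by positivity
      rw [div_inv_eq_mul, Real.sqrt_eq_rpow, ← Real.rpow_add hk]
      simp only [Function.comp]
      congr 1
      ring
  have hdiv : Tendsto (fun n => ∑ k ∈ Finset.range n, (√((k : ℝ) + 1))⁻¹) atTop atTop :=
    tendsto_atTop_mono sqrt_le_sum_inv_sqrt
      (Real.tendsto_sqrt_atTop.comp tendsto_natCast_atTop_atTop)
  have hsum := ho.sum_range (fun k => by positivity) hdiv
  have hO : (fun n : ℕ => ∑ k ∈ Finset.range n, (√((k : ℝ) + 1))⁻¹) =O[atTop]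
      fun n : ℕ => √(n : ℝ) := by
    refine Asymptotics.IsBigO.of_bound 2 (Eventually.of_forall fun n => ?_)
    rw [Real.norm_of_nonneg (Finset.sum_nonneg fun _ _ => by positivity),
      Real.norm_of_nonneg (Real.sqrt_nonneg _)]
    exact sum_inv_sqrt_le n
  refine ((hsum.trans_isBigO hO).tendsto_div_nhds_zero).congr fun n => ?_
  rw [sum_Icc_one_eq_sum_range, div_eq_inv_mul]
  push_cast
  rfl

end Rate

/-! ### The estimating equation and its linearization -/

section Linearization

variable {m : ℕ}

/-- Near `θ₀` the derivative of `g T` is close to the limit derivative at `θ₀`, by uniform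
convergence and continuity of the limit. The mean value inequality for `g T` minus its linearization
then needs no intermediate point. -/
theorem eventually_abs_sub_linear_le {g : ℕ → Vec m → ℝ} {D : ℕ → Vec m → Vec m →L[ℝ] ℝ}
    {θ₀ : Vec m} {ρ : ℝ} (hρ : 0 < ρ)
    (hg : ∀ T, ∀ θ ∈ Metric.closedBall θ₀ ρ, HasFDerivAt (g T) (D T θ) θ)
    {h : Fin m → Vec m → ℝ} (hc : ∀ i, ContinuousOn (h i) (Metric.closedBall θ₀ ρ))
    (hu : ∀ i, TendstoUniformlyOn (fun T θ => D T θ (EuclideanSpace.single i 1)) (h i) atTop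
      (Metric.closedBall θ₀ ρ))
    {x : ℕ → Vec m} (hx : Tendsto x atTop (𝓝 θ₀)) {η : ℝ} (hη : 0 < η) :
    ∀ᶠ T in atTop, |g T (x T) - g T θ₀ - ∑ i, h i θ₀ * (x T - θ₀) i| ≤ η * ‖x T - θ₀‖ := by
  -- Each coordinate incurs two errors, from uniform convergence and from continuity; `m + 1` in
  -- place of `m` allows `m = 0`.
  set η' := η / (2 * ((m : ℝ) + 1)) with hη'
  have hη'pos : 0 < η' := by positivity
  have hcont : ∀ i, ∃ r > 0, ∀ θ ∈ Metric.closedBall θ₀ ρ, dist θ θ₀ < r →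
      dist (h i θ) (h i θ₀) < η' := fun i =>
    Metric.continuousOn_iff.1 (hc i) θ₀ (Metric.mem_closedBall_self hρ.le) η' hη'pos
  choose r hr hr' using hcont
  have hev1 : ∀ᶠ T in atTop, ∀ i, ∀ θ ∈ Metric.closedBall θ₀ ρ,
      dist (h i θ) (D T θ (EuclideanSpace.single i 1)) < η' :=
    eventually_all.2 fun i => Metric.tendstoUniformlyOn_iff.1 (hu i) η' hη'pos
  have hev2 : ∀ᶠ T in atTop, ∀ i, dist (x T) θ₀ < r i :=
    eventually_all.2 fun i => (Metric.tendsto_nhds.1 hx) _ (hr i)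
  filter_upwards [hev1, hev2, Metric.tendsto_nhds.1 hx ρ hρ] with T h1 h2 h3
  set A : Vec m →L[ℝ] ℝ := ∑ i, h i θ₀ • EuclideanSpace.proj (𝕜 := ℝ) i with hA
  have hAv : ∀ v : Vec m, A v = ∑ i, h i θ₀ * v i := fun v => by
    simp [hA]
  set s := Metric.closedBall θ₀ (dist (x T) θ₀) with hs
  have hsρ : s ⊆ Metric.closedBall θ₀ ρ := Metric.closedBall_subset_closedBall h3.le
  have hbound : ∀ θ ∈ s, ‖D T θ - A‖ ≤ η := fun θ hθ => by
    refine (norm_le_sum_abs_single _).trans ?_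
    have hi : ∀ i, |(D T θ - A) (EuclideanSpace.single i 1)| ≤ 2 * η' := fun i => by
      have hAi : A (EuclideanSpace.single i 1) = h i θ₀ := by
        rw [hAv]
        simp
      have e1 := h1 i θ (hsρ hθ)
      have e2 := hr' i θ (hsρ hθ) ((Metric.mem_closedBall.1 hθ).trans_lt (h2 i))
      rw [sub_apply, hAi]
      rw [Real.dist_eq, abs_lt] at e1 e2
      rw [abs_le]
      constructor <;> linarith [e1.1, e1.2, e2.1, e2.2]
    refine (Finset.sum_le_sum fun i _ => hi i).trans ?_
    rw [Finset.sum_const, Finset.card_univ, Fintype.card_fin, nsmul_eq_mul, hη']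
    have : (m : ℝ) * (2 * (η / (2 * ((m : ℝ) + 1)))) = η * (m / ((m : ℝ) + 1)) := by
      field_simp
    rw [this]
    exact mul_le_of_le_one_right hη.le (div_le_one_of_le₀ (by linarith) (by positivity))
  have := (convex_closedBall θ₀ (dist (x T) θ₀)).norm_image_sub_le_of_norm_hasFDerivWithin_le
    (f := fun θ => g T θ - A θ) (f' := fun θ => D T θ - A)
    (fun θ hθ => ((hg T θ (hsρ hθ)).sub A.hasFDerivAt).hasFDerivWithinAt) hbound
    (Metric.mem_closedBall_self dist_nonneg) (Metric.mem_closedBall.2 le_rfl)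
  rw [← hAv, map_sub]
  rw [Real.norm_eq_abs] at this
  convert this using 2
  ring

end Linearization

/-! ### Gradient and Hessian of the loss on the interior -/

section LossDerivatives

variable {Ω : Type*} {d m : ℕ} {Y : ℤ → Ω → Vec d} {Θ : Set (Vec m)}
  {lam : (ℕ → Vec d) → Vec m → Vec d} {W : ℤ → Ω → Matrix (Fin d) (Fin d) ℝ} {t : ℤ} {ω : Ω}

theorem contDiffOn_loss (hC : ContDiffOn ℝ 2 (lam (past Y t ω)) Θ) :
    ContDiffOn ℝ 2 (loss lam Y W t ω) (interior Θ) :=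
  contDiffOn_wform (n := 2) (W t ω) (Y t ω) (hC.mono interior_subset)

theorem differentiableAt_lam (hC : ContDiffOn ℝ 2 (lam (past Y t ω)) Θ) {θ : Vec m}
    (hθ : θ ∈ interior Θ) : DifferentiableAt ℝ (lam (past Y t ω)) θ :=
  (hC.contDiffAt (mem_interior_iff_mem_nhds.1 hθ)).differentiableAt two_ne_zero

theorem hasFDerivAt_loss (hC : ContDiffOn ℝ 2 (lam (past Y t ω)) Θ) (hW : (W t ω).IsSymm)
    {θ : Vec m} (hθ : θ ∈ interior Θ) :
    HasFDerivAt (loss lam Y W t ω) ((-2 : ℝ) • ((wformL (W t ω)).flip (resid lam Y t ω θ)).comp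
      (fderiv ℝ (lam (past Y t ω)) θ)) θ :=
  hasFDerivAt_wform hW (Y t ω) (differentiableAt_lam hC hθ)

theorem fderiv_loss_apply (hC : ContDiffOn ℝ 2 (lam (past Y t ω)) Θ) (hW : (W t ω).IsSymm)
    {θ : Vec m} (hθ : θ ∈ interior Θ) (v : Vec m) :
    fderiv ℝ (loss lam Y W t ω) θ v
      = -2 * wform (W t ω) (fderiv ℝ (lam (past Y t ω)) θ v) (resid lam Y t ω θ) := by
  rw [(hasFDerivAt_loss hC hW hθ).fderiv]
  rfl

theorem contDiffAt_loss (hC : ContDiffOn ℝ 2 (lam (past Y t ω)) Θ) {θ : Vec m}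
    (hθ : θ ∈ interior Θ) : ContDiffAt ℝ 2 (loss lam Y W t ω) θ :=
  (contDiffOn_loss hC).contDiffAt (isOpen_interior.mem_nhds hθ)

theorem hasFDerivAt_fderiv_loss (hC : ContDiffOn ℝ 2 (lam (past Y t ω)) Θ) {θ : Vec m}
    (hθ : θ ∈ interior Θ) (v : Vec m) :
    HasFDerivAt (fun θ => fderiv ℝ (loss lam Y W t ω) θ v)
      ((fderiv ℝ (fderiv ℝ (loss lam Y W t ω)) θ).flip v) θ := by
  have h : DifferentiableAt ℝ (fderiv ℝ (loss lam Y W t ω)) θ :=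
    ((contDiffAt_loss hC hθ).fderiv_right (m := 1) (by norm_num)).differentiableAt one_ne_zero
  exact (h.hasFDerivAt.clm_apply (hasFDerivAt_const v θ)).congr_fderiv (by ext; simp)

theorem continuousOn_hessian_loss (hC : ContDiffOn ℝ 2 (lam (past Y t ω)) Θ) (i j : Fin m) :
    ContinuousOn (fun θ => hessian (loss lam Y W t ω) Θ θ i j) (interior Θ) := by
  have h1 : ContDiffOn ℝ 1 (fderiv ℝ (loss lam Y W t ω)) (interior Θ) :=
    (contDiffOn_loss hC).fderiv_of_isOpen isOpen_interior (by norm_num)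
  have h2 : ContinuousOn (fderiv ℝ (fderiv ℝ (loss lam Y W t ω))) (interior Θ) :=
    h1.continuousOn_fderiv_of_isOpen isOpen_interior le_rfl
  refine ContinuousOn.congr ?_ fun θ hθ => hessian_eq_of_mem_interior hθ i j
  exact (h2.clm_apply continuousOn_const).clm_apply continuousOn_const

theorem score_apply (θ : Vec m) (i : Fin m) : score lam Y W Θ t ω θ i
    = wform (W t ω) (fderivWithin ℝ (lam (past Y t ω)) Θ θ (EuclideanSpace.single i 1))
      (resid lam Y t ω θ) := rfl

theorem score_eq (hC : ContDiffOn ℝ 2 (lam (past Y t ω)) Θ) (hW : (W t ω).IsSymm)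
    {θ : Vec m} (hθ : θ ∈ interior Θ) (i : Fin m) : score lam Y W Θ t ω θ i
    = -(1 / 2) * fderiv ℝ (loss lam Y W t ω) θ (EuclideanSpace.single i 1) := by
  rw [score_apply, fderiv_loss_apply hC hW hθ,
    fderivWithin_of_mem_nhds (mem_interior_iff_mem_nhds.1 hθ)]
  ring

/-- The first-order condition at an interior minimizer. -/
theorem sum_wform_eq_zero_of_isArgmin {T : ℕ}
    (hC : ∀ t : ℕ, ContDiffOn ℝ 2 (lam (past Y t ω)) Θ) (hW : ∀ t : ℕ, (W t ω).IsSymm)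
    (hT : 1 ≤ T) {θ : Vec m} (hθ : θ ∈ interior Θ) (hmin : IsArgmin (objective lam Y W T ω) Θ θ)
    (v : Vec m) :
    ∑ t ∈ Finset.Icc 1 T, wform (W t ω) (fderiv ℝ (lam (past Y t ω)) θ v)
      (resid lam Y t ω θ) = 0 := by
  have hloc : IsLocalMin (objective lam Y W T ω) θ := by
    filter_upwards [isOpen_interior.mem_nhds hθ] with η hη
    exact hmin.2 η (interior_subset hη)
  have hd : HasFDerivAt (objective lam Y W T ω) ((T : ℝ)⁻¹ • ∑ t ∈ Finset.Icc 1 T,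
      (-2 : ℝ) • ((wformL (W t ω)).flip (resid lam Y t ω θ)).comp
        (fderiv ℝ (lam (past Y t ω)) θ)) θ :=
    (HasFDerivAt.fun_sum fun (t : ℕ) _ => hasFDerivAt_loss (hC t) (hW t) hθ).const_mul _
  have h0 := congrArg (fun φ : Vec m →L[ℝ] ℝ => φ v) (hloc.hasFDerivAt_eq_zero hd)
  have hT' : (T : ℝ) ≠ 0 := by positivity
  simp only [smul_apply, sum_apply, ContinuousLinearMap.comp_apply,
    ContinuousLinearMap.flip_apply, wformL_apply, smul_eq_mul, ← Finset.mul_sum,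
    zero_apply, mul_eq_zero, inv_eq_zero, hT', false_or] at h0
  simpa using h0

end LossDerivatives

/-! ### The uniform law for the Hessian -/

section HessianLaw

variable {Ω : Type*} [MeasurableSpace Ω] {μ : Measure Ω} {d m : ℕ} {Y : ℤ → Ω → Vec d}
  {Θ : Set (Vec m)} {θ₀ : Vec m} {lam : (ℕ → Vec d) → Vec m → Vec d}
  {W : (ℕ → Vec d) → Matrix (Fin d) (Fin d) ℝ}

theorem isFactor_hessian_loss (hlam : ∀ θ ∈ Θ, Measurable fun y => lam y θ)
    (hW : ∀ i j, Measurable fun y => W y i j)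
    (hC : ∀ t, ∀ᵐ ω ∂μ, ContDiffOn ℝ 2 (lam (past Y t ω)) Θ) {θ : Vec m}
    (hθ : θ ∈ interior Θ) (i j : Fin m) :
    IsFactor μ (window Y) fun t ω => hessian (loss lam Y (pastWeights W Y) t ω) Θ θ i j := by
  have h1 : ∀ θ ∈ interior Θ, IsFactor μ (window Y) fun t ω =>
      fderiv ℝ (loss lam Y (pastWeights W Y) t ω) θ (EuclideanSpace.single j 1) := fun θ hθ =>
    isFactor_fderiv (f := fun θ t ω => loss lam Y (pastWeights W Y) t ω θ)
      (fun θ hθ => isFactor_loss hW (hlam θ (interior_subset hθ))) (isOpen_interior.mem_nhds hθ)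
      (fun t => (hC t).mono fun ω h => (contDiffAt_loss h hθ).differentiableAt two_ne_zero) _
  have h2 := isFactor_fderiv
    (f := fun θ t ω => fderiv ℝ (loss lam Y (pastWeights W Y) t ω) θ (EuclideanSpace.single j 1))
    h1 (isOpen_interior.mem_nhds hθ)
    (fun t => (hC t).mono fun ω h => (hasFDerivAt_fderiv_loss h hθ _).differentiableAt)
    (EuclideanSpace.single i 1)
  refine h2.congr fun t => ?_
  filter_upwards [hC t] with ω h
  rw [(hasFDerivAt_fderiv_loss h hθ _).fderiv, hessian_eq_of_mem_interior hθ]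
  rfl

open scoped Matrix.Norms.L2Operator in
theorem ae_tendstoUniformlyOn_hessian [IsProbabilityMeasure μ] (hY : ∀ t, Measurable (Y t))
    (hE : StationaryErgodic μ Y) (hlam : ∀ θ ∈ Θ, Measurable fun y => lam y θ)
    (hW : ∀ i j, Measurable fun y => W y i j)
    (hM : SecondDerivMoment μ lam Y (pastWeights W Y) Θ) {K : Set (Vec m)} (hK : IsCompact K)
    (hKΘ : K ⊆ interior Θ) (i j : Fin m) :
    ∀ᵐ ω ∂μ, TendstoUniformlyOn
      (fun (T : ℕ) θ => (T : ℝ)⁻¹ * ∑ t ∈ Finset.Icc 1 T,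
        hessian (loss lam Y (pastWeights W Y) t ω) Θ θ i j)
      (fun θ => ∫ ω, hessian (loss lam Y (pastWeights W Y) 0 ω) Θ θ i j ∂μ) atTop K := by
  refine ae_tendstoUniformlyOn_average hY hE hK
    (f := fun θ t ω => hessian (loss lam Y (pastWeights W Y) t ω) Θ θ i j)
    (fun θ hθ => isFactor_hessian_loss hlam hW (fun t => (hM t).1) (hKΘ hθ) i j)
    (fun t => (hM t).1.mono fun ω h => (continuousOn_hessian_loss h i j).mono hKΘ)
    ((lintegral_mono fun ω => ?_).trans_lt (hM 0).2)
  refine iSup₂_le fun θ hθ => le_trans ?_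
    (le_biSup (fun θ => ‖hessian (loss lam Y (pastWeights W Y) 0 ω) Θ θ‖ₑ)
      (interior_subset (hKΘ hθ)))
  rw [← ofReal_norm, ← ofReal_norm (hessian _ _ _)]
  exact ENNReal.ofReal_le_ofReal (abs_entry_le_l2_opNorm _ i j)

end HessianLaw

/-! ### Asymptotic normality -/

section EstimatedWeights

variable {Ω : Type*} {d m q : ℕ} {Y : ℤ → Ω → Vec d} {Θ : Set (Vec m)} {Γ : Set (Vec q)}
  {θ₀ : Vec m} {lam : (ℕ → Vec d) → Vec m → Vec d} {ν : (ℕ → Vec d) → Param m q → Fin d → ℝ}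
  {P : Param m q → Matrix (Fin d) (Fin d) ℝ} {τ τ₀ : Param m q}

theorem isSymm_invCov (hP : (P τ).IsSymm) (y : ℕ → Vec d) : (invCov ν P τ y).IsSymm := by
  rw [Matrix.IsSymm, invCov, Matrix.transpose_nonsing_inv]
  congr 1
  rw [pseudoCov, Matrix.transpose_mul, Matrix.transpose_mul, Matrix.diagonal_transpose, hP.eq,
    Matrix.mul_assoc]

/-- The Lipschitz bound for the weights is combined with the suprema of the gradient and of the
residual; their product is `X_t`. -/
theorem enorm_wform_fderiv_sub_le {t : ℤ} {ω : Ω}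
    (hk : ContDiffOn ℝ 1 (kvec ν P Y t ω) (paramSpace Θ Γ))
    (hseg : segment ℝ τ₀ τ ⊆ paramSpace Θ Γ) {θ : Vec m} (hθ : θ ∈ interior Θ) {v : Vec m}
    (hv : ‖v‖ ≤ 1) :
    ‖wform (invCov ν P τ (past Y t ω)) (fderiv ℝ (lam (past Y t ω)) θ v) (resid lam Y t ω θ)
      - wform (invCov ν P τ₀ (past Y t ω)) (fderiv ℝ (lam (past Y t ω)) θ v)
        (resid lam Y t ω θ)‖ₑ ≤ ‖τ - τ₀‖ₑ * Xvar lam ν P Y Θ Γ t ω := by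
  refine (enorm_wform_invCov_sub_le t ω _ _).trans ?_
  have h1 := enorm_kvec_sub_le hk hseg
  have h2 : ‖fderiv ℝ (lam (past Y t ω)) θ v‖ₑ
      ≤ ⨆ θ ∈ Θ, ‖fderivWithin ℝ (lam (past Y t ω)) Θ θ‖ₑ := by
    refine le_trans ?_ (le_biSup (fun θ => ‖fderivWithin ℝ (lam (past Y t ω)) Θ θ‖ₑ)
      (interior_subset hθ))
    rw [fderivWithin_of_mem_nhds (mem_interior_iff_mem_nhds.1 hθ), ← ofReal_norm, ← ofReal_norm]
    refine ENNReal.ofReal_le_ofReal ((ContinuousLinearMap.le_opNorm _ v).trans ?_)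
    exact mul_le_of_le_one_right (norm_nonneg _) hv
  have h3 : ‖resid lam Y t ω θ‖ₑ ≤ ⨆ θ ∈ Θ, ‖resid lam Y t ω θ‖ₑ :=
    le_biSup (fun θ => ‖resid lam Y t ω θ‖ₑ) (interior_subset hθ)
  refine (mul_le_mul' (mul_le_mul' h1 h2) h3).trans_eq ?_
  rw [Xvar]
  ring

variable [MeasurableSpace Ω] {μ : Measure Ω}

/-- The score with the limit weights, evaluated at the estimator, is `o(√T)`. -/
theorem ae_tendsto_score_estimator (hθ₀ : θ₀ ∈ interior Θ)
    (hstar : LocallyStarShapedAt (paramSpace Θ Γ) τ₀)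
    (hP : ∀ τ ∈ paramSpace Θ Γ, (P τ).IsSymm)
    (hC : ∀ t, ∀ᵐ ω ∂μ, ContDiffOn ℝ 2 (lam (past Y t ω)) Θ)
    (hk : ∀ t, ∀ᵐ ω ∂μ, ContDiffOn ℝ 1 (kvec ν P Y t ω) (paramSpace Θ Γ))
    {τhat : ℕ → Ω → Param m q} (hτmem : ∀ᵐ ω ∂μ, ∀ T, 1 ≤ T → τhat T ω ∈ paramSpace Θ Γ)
    (hτlim : ∀ᵐ ω ∂μ, Tendsto (fun T => τhat T ω) atTop (𝓝 τ₀))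
    (hrate : WeightRate μ lam ν P Y Θ Γ τhat τ₀) {θhat : ℕ → Ω → Vec m}
    (hmin : ∀ᵐ ω ∂μ, ∀ T, 1 ≤ T →
      IsArgmin (objective lam Y (estWeights ν P Y (τhat T)) T ω) Θ (θhat T ω))
    (hlim : ∀ᵐ ω ∂μ, Tendsto (fun T => θhat T ω) atTop (𝓝 θ₀)) {v : Vec m} (hv : ‖v‖ ≤ 1) :
    ∀ᵐ ω ∂μ, Tendsto (fun T : ℕ => (√(T : ℝ))⁻¹ * ∑ t ∈ Finset.Icc 1 T,
      wform (invCov ν P τ₀ (past Y t ω)) (fderiv ℝ (lam (past Y t ω)) (θhat T ω) v)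
        (resid lam Y t ω (θhat T ω))) atTop (𝓝 0) := by
  obtain ⟨ε, hε, hseg⟩ := hstar
  obtain ⟨δ, hδ, hrate⟩ := hrate
  filter_upwards [ae_all_iff.2 hC, ae_all_iff.2 hk, hτmem, hτlim, hrate, hmin, hlim]
    with ω h1 h2 h3 h4 ⟨C, h5⟩ h6 h7
  have hb := (tendsto_inv_sqrt_mul_sum_rpow_neg hδ).const_mul |C|
  rw [mul_zero] at hb
  refine squeeze_zero_norm' ?_ hb
  filter_upwards [h5, Metric.tendsto_nhds.1 h4 ε hε, eventually_ge_atTop 1,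
    h7.eventually_mem (isOpen_interior.mem_nhds hθ₀)] with T e1 e2 e3 e4
  have hmem := h3 T e3
  rw [dist_eq_norm] at e2
  have hfoc := sum_wform_eq_zero_of_isArgmin (W := estWeights ν P Y (τhat T))
    (fun t => h1 t) (fun t => isSymm_invCov (hP _ hmem) _) e3 e4 (h6 T e3) v
  -- The score with estimated weights is zero by the first-order condition, so only the effect of
  -- changing the weights remains. It is bounded pathwise, term by term.
  have hdiff : ∑ t ∈ Finset.Icc 1 T, wform (invCov ν P τ₀ (past Y t ω))
      (fderiv ℝ (lam (past Y t ω)) (θhat T ω) v) (resid lam Y t ω (θhat T ω))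
      = -∑ t ∈ Finset.Icc 1 T, (wform (invCov ν P (τhat T ω) (past Y t ω))
          (fderiv ℝ (lam (past Y t ω)) (θhat T ω) v) (resid lam Y t ω (θhat T ω))
        - wform (invCov ν P τ₀ (past Y t ω))
          (fderiv ℝ (lam (past Y t ω)) (θhat T ω) v) (resid lam Y t ω (θhat T ω))) := by
    rw [Finset.sum_sub_distrib]
    have : ∑ t ∈ Finset.Icc 1 T, wform (invCov ν P (τhat T ω) (past Y t ω))
        (fderiv ℝ (lam (past Y t ω)) (θhat T ω) v) (resid lam Y t ω (θhat T ω)) = 0 := hfoc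
    rw [this]
    ring
  rw [hdiff, norm_mul, norm_neg, Real.norm_of_nonneg (by positivity), mul_left_comm]
  gcongr
  rw [Finset.mul_sum]
  refine (norm_sum_le _ _).trans (Finset.sum_le_sum fun t ht => ?_)
  have hle := (enorm_wform_fderiv_sub_le (lam := lam) (h2 t) (hseg _ hmem e2) e4 hv).trans
    (e1 t ht)
  rw [← ofReal_norm] at hle
  have ht0 : (0 : ℝ) ≤ (t : ℝ) ^ (-δ) := by positivity
  have hle' := hle.trans (ENNReal.ofReal_le_ofReal
    (mul_le_mul_of_nonneg_right (le_abs_self C) ht0))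
  exact (ENNReal.ofReal_le_ofReal_iff (by positivity)).1 hle'

end EstimatedWeights

/-! ### The central limit theorem for the score -/

section ScoreCLT

variable {Ω : Type*} [MeasurableSpace Ω] {μ : Measure Ω} {d m : ℕ} {Y : ℤ → Ω → Vec d}
  {Θ : Set (Vec m)} {θ₀ : Vec m} {lam : (ℕ → Vec d) → Vec m → Vec d}
  {W : (ℕ → Vec d) → Matrix (Fin d) (Fin d) ℝ}

/-- The factor is taken over `past Y` and not over `window Y`: the gradient must be known at time `t
- 1` for the score to be a martingale difference. -/
theorem isFactor_fderiv_lam (hlam : ∀ θ ∈ Θ, Measurable fun y => lam y θ)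
    (hθ₀ : θ₀ ∈ interior Θ) (hC : ∀ t, ∀ᵐ ω ∂μ, ContDiffOn ℝ 2 (lam (past Y t ω)) Θ) (v : Vec m) :
    IsFactor μ (past Y) fun t ω => fderiv ℝ (lam (past Y t ω)) θ₀ v :=
  isFactor_fderiv (f := fun θ t ω => lam (past Y t ω) θ)
    (fun θ hθ => isFactor_of_measurable (hlam θ hθ)) (mem_interior_iff_mem_nhds.1 hθ₀)
    (fun t => (hC t).mono fun _ h => differentiableAt_lam h hθ₀) v

theorem isFactor_score (hlam : ∀ θ ∈ Θ, Measurable fun y => lam y θ)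
    (hW : ∀ i j, Measurable fun y => W y i j) (hθ₀ : θ₀ ∈ interior Θ)
    (hC : ∀ t, ∀ᵐ ω ∂μ, ContDiffOn ℝ 2 (lam (past Y t ω)) Θ) (j : Fin m) :
    IsFactor μ (window Y) fun t ω => score lam Y (pastWeights W Y) Θ t ω θ₀ j := by
  obtain ⟨G, hG, hGD⟩ := isFactor_fderiv_lam (μ := μ) (Y := Y) hlam hθ₀ hC
    (EuclideanSpace.single j 1)
  refine ⟨fun s => wform (W s.2) (G s.2) (s.1 - lam s.2 θ₀),
    measurable_wform (fun i j => (hW i j).comp measurable_snd) (hG.comp measurable_snd)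
      (measurable_fst.sub ((hlam θ₀ (interior_subset hθ₀)).comp measurable_snd)), fun t => ?_⟩
  filter_upwards [hGD t] with ω h
  rw [score_apply, fderivWithin_of_mem_nhds (mem_interior_iff_mem_nhds.1 hθ₀), h]
  rfl

/-- The central limit theorem for a linear combination of the scores. -/
theorem tendsto_integral_exp_score [IsProbabilityMeasure μ] (hY : ∀ t, Measurable (Y t))
    (hE : StationaryErgodic μ Y)
    (hlam : ∀ θ ∈ Θ, Measurable fun y => lam y θ) (hmean : MeanModel μ lam Y θ₀)
    (hW : ∀ i j, Measurable fun y => W y i j) (hθ₀ : θ₀ ∈ interior Θ)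
    (hC : ∀ t, ∀ᵐ ω ∂μ, ContDiffOn ℝ 2 (lam (past Y t ω)) Θ) (v : Vec m) {x : ℤ → Ω → ℝ}
    (hx : ∀ t, x t =ᵐ[μ] fun ω => wform (W (past Y t ω)) (fderiv ℝ (lam (past Y t ω)) θ₀ v)
      (resid lam Y t ω θ₀)) (hx2 : Integrable (fun ω => x 0 ω ^ 2) μ) :
    Tendsto (fun T : ℕ => ∫ ω, Complex.exp
      (((√(T : ℝ))⁻¹ * ∑ t ∈ Finset.Icc 1 T, x t ω : ℝ) * Complex.I) ∂μ) atTop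
      (𝓝 (Real.exp (-(∫ ω, x 0 ω ^ 2 ∂μ) / 2) : ℂ)) := by
  obtain ⟨G, hG, hGD⟩ := isFactor_fderiv_lam (μ := μ) (Y := Y) hlam hθ₀ hC v
  have hlam₀ := hlam θ₀ (interior_subset hθ₀)
  set F : Vec d × (ℕ → Vec d) → ℝ := fun s => wform (W s.2) (G s.2) (s.1 - lam s.2 θ₀) with hF
  have hFm : Measurable F := measurable_wform (fun i j => (hW i j).comp measurable_snd)
    (hG.comp measurable_snd) (measurable_fst.sub (hlam₀.comp measurable_snd))
  have hxF : ∀ t, x t =ᵐ[μ] fun ω => F (window Y t ω) := fun t => by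
    filter_upwards [hx t, hGD t] with ω h1 h2
    rw [h1, h2]
    rfl
  have hfac : IsFactor μ (window Y) x := ⟨F, hFm, hxF⟩
  have hid := hfac.identDistrib hY hE
  set ℱ : Filtration ℕ (inferInstance : MeasurableSpace Ω) :=
    ⟨fun k => history Y k, fun _ _ h => history_mono Y (by exact_mod_cast h),
      fun k => history_le hY k⟩ with hℱ
  -- The shift by one makes `X k` known at time `k + 1` and centred given time `k`. The version
  -- through `F` is measurable for the filtration itself, whereas `x` is only a.s. equal to it.
  set X : ℕ → Ω → ℝ := fun k ω => F (window Y (k + 1 : ℕ) ω) with hX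
  have hXx : ∀ k : ℕ, X k =ᵐ[μ] x (k + 1 : ℕ) := fun k => (hxF _).symm
  have hcast : ∀ k : ℕ, ((k + 1 : ℕ) : ℤ) - 1 = k := fun k => by push_cast; ring
  have hXm : ∀ k, Measurable[ℱ (k + 1)] (X k) := fun k => by
    have hw : Measurable[history Y (k + 1 : ℕ)] (window Y (k + 1 : ℕ)) :=
      (measurable_history Y le_rfl).prodMk
        ((measurable_past_history Y _).mono (history_mono Y (by linarith)) le_rfl)
    exact hFm.comp hw
  have h2 : ∀ k, MemLp (X k) 2 μ := fun k => by
    have h0 : MemLp (x 0) 2 μ := (memLp_two_iff_integrable_sq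
      (hfac.aemeasurable (measurable_window hY) 0).aestronglyMeasurable).2 hx2
    exact ((hid (k + 1)).symm.memLp_snd h0).ae_eq (hXx k).symm
  have hcond : ∀ k, μ[X k | ℱ k] =ᵐ[μ] 0 := fun k => by
    have hf : StronglyMeasurable[history Y (((k + 1 : ℕ) : ℤ) - 1)] fun ω =>
        (WithLp.toLp 2 ((G (past Y (k + 1 : ℕ) ω)).ofLp ᵥ* W (past Y (k + 1 : ℕ) ω)) : Vec d) :=
      ((measurable_toLp_vecMul hW hG).comp (measurable_past_history Y _)).stronglyMeasurable
    have heq : X k = fun ω => innerSL ℝ (WithLp.toLp 2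
        ((G (past Y (k + 1 : ℕ) ω)).ofLp ᵥ* W (past Y (k + 1 : ℕ) ω)) : Vec d)
        (resid lam Y (k + 1 : ℕ) ω θ₀) := by
      ext ω
      exact wform_eq_inner _ _ _
    have hXi := (h2 k).integrable one_le_two
    rw [heq] at hXi ⊢
    have := condExp_bilin_eq_zero (innerSL ℝ) hf hXi (integrable_resid hmean _)
      (condExp_resid hY hlam₀ hmean _)
    rwa [hcast] at this
  have hv : ∀ k, ∫ ω, X k ω ^ 2 ∂μ = ∫ ω, x 0 ω ^ 2 ∂μ := fun k => by
    refine (integral_congr_ae ((hXx k).fun_comp (· ^ 2))).trans ?_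
    exact ((hid (k + 1)).comp (measurable_id.pow_const 2)).integral_eq
  have hlln := (hfac.comp (measurable_id.pow_const 2)).ae_tendsto_average hY hE hx2
  have hallX : ∀ᵐ ω ∂μ, ∀ k : ℕ, X k ω = x (k + 1 : ℕ) ω := ae_all_iff.2 hXx
  have hlim : ∀ᵐ ω ∂μ, Tendsto (fun n : ℕ => (∑ j ∈ Finset.range n, X j ω ^ 2) / n) atTop
      (𝓝 (∫ ω, x 0 ω ^ 2 ∂μ)) := by
    filter_upwards [hlln, hallX] with ω e1 e2
    refine e1.congr fun n => ?_
    rw [sum_Icc_one_eq_sum_range, div_eq_inv_mul]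
    simp only [e2, id]
  refine (tendsto_integral_exp_sum_martingaleDiff hXm h2 hcond hv hlim).congr fun n => ?_
  refine integral_congr_ae ?_
  filter_upwards [hallX] with ω e2
  rw [sum_Icc_one_eq_sum_range, div_eq_inv_mul]
  simp only [e2]

end ScoreCLT

/-! ### Inverting the linearization and Slutsky's theorem -/

section Normality

variable {m : ℕ}

/-- If `S_T = H u_T + o(1 + ‖u_T‖)` with `H` invertible, then `u_T` is `H⁻¹ S_T` up to a
relatively negligible error. -/
theorem tendsto_normalized_error {A H : Matrix (Fin m) (Fin m) ℝ} (hAH : A * H = 1)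
    {u S : ℕ → Vec m}
    (h : ∀ η > 0, ∀ᶠ T in atTop, ∀ j, |S T j - (H *ᵥ (u T).ofLp) j| ≤ η * (‖u T‖ + 1)) :
    Tendsto (fun T => (1 + ‖(WithLp.toLp 2 (A *ᵥ (S T).ofLp) : Vec m)‖)⁻¹ •
      (u T - (WithLp.toLp 2 (A *ᵥ (S T).ofLp) : Vec m))) atTop (𝓝 0) := by
  set c : ℝ := ∑ i, ∑ j, |A i j| with hc
  have hc0 : 0 ≤ c := Finset.sum_nonneg fun _ _ => Finset.sum_nonneg fun _ _ => abs_nonneg _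
  rw [Metric.tendsto_nhds]
  intro ε hε
  -- From `‖w‖ ≤ κ (‖u‖ + 1) ≤ κ (‖w‖ + ‖n‖ + 1)`, the bound `κ ≤ 1/2` absorbs `‖w‖` on the left,
  -- and `κ ≤ ε/4` leaves `‖w‖ ≤ (ε/2) (1 + ‖n‖)`.
  set κ := min (1 / 2) (ε / 4) with hκ
  have hκ0 : 0 < κ := by positivity
  have hκ1 : κ ≤ 1 / 2 := min_le_left _ _
  have hκ2 : κ ≤ ε / 4 := min_le_right _ _
  filter_upwards [h (κ / (c + 1)) (by positivity)] with T hT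
  set n : Vec m := WithLp.toLp 2 (A *ᵥ (S T).ofLp) with hn
  set w : Vec m := u T - n with hw
  have hwi : ∀ i, w i = ∑ j, A i j * ((H *ᵥ (u T).ofLp) j - S T j) := fun i => by
    have h1 : (u T).ofLp = A *ᵥ (H *ᵥ (u T).ofLp) := by
      rw [Matrix.mulVec_mulVec, hAH, Matrix.one_mulVec]
    have h2 : w i = (A *ᵥ (H *ᵥ (u T).ofLp)) i - (A *ᵥ (S T).ofLp) i := by
      rw [← h1]
      rfl
    rw [h2]
    simp only [Matrix.mulVec, dotProduct, mul_sub, Finset.sum_sub_distrib]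
  have hwn : ‖w‖ ≤ κ * (‖u T‖ + 1) := by
    calc ‖w‖ ≤ ∑ i, |w i| := norm_le_sum_abs w
      _ ≤ ∑ i, ∑ j, |A i j| * (κ / (c + 1) * (‖u T‖ + 1)) := by
          refine Finset.sum_le_sum fun i _ => ?_
          rw [hwi]
          refine (Finset.abs_sum_le_sum_abs _ _).trans (Finset.sum_le_sum fun j _ => ?_)
          rw [abs_mul, abs_sub_comm]
          gcongr
          exact hT j
      _ = c * (κ / (c + 1)) * (‖u T‖ + 1) := by
          simp only [← Finset.sum_mul, hc]
          ring
      _ ≤ κ * (‖u T‖ + 1) := by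
          gcongr
          rw [mul_div_left_comm]
          exact mul_le_of_le_one_right hκ0.le (div_le_one_of_le₀ (by linarith) (by positivity))
  have hu : ‖u T‖ ≤ ‖w‖ + ‖n‖ := by
    have : u T = w + n := by rw [hw]; abel
    rw [this]
    exact norm_add_le _ _
  have hfin : ‖w‖ ≤ (ε / 2) * (1 + ‖n‖) := by
    nlinarith [norm_nonneg w, norm_nonneg n]
  have hpos : 0 < 1 + ‖n‖ := by positivity
  rw [dist_zero_right, norm_smul, norm_inv, Real.norm_of_nonneg hpos.le,
    inv_mul_lt_iff₀ hpos]
  nlinarith [norm_nonneg n]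

/-- Slutsky's theorem with a relatively negligible error. -/
theorem tendstoInDistribution_of_normalized_error {Ω : Type*} [MeasurableSpace Ω] {μ : Measure Ω}
    [IsProbabilityMeasure μ] {π : Measure (Vec m)} [IsProbabilityMeasure π] {u n : ℕ → Ω → Vec m}
    (hu : ∀ T, AEMeasurable (u T) μ)
    (hn : TendstoInDistribution n atTop (fun x : Vec m => x) (fun _ => μ) π)
    (h : ∀ᵐ ω ∂μ, Tendsto (fun T => (1 + ‖n T ω‖)⁻¹ • (u T ω - n T ω)) atTop (𝓝 0)) :
    TendstoInDistribution u atTop (fun x : Vec m => x) (fun _ => μ) π := by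
  have hnm := hn.forall_aemeasurable
  have hvm : ∀ T, AEMeasurable (fun ω => (1 + ‖n T ω‖)⁻¹ • (u T ω - n T ω)) μ := fun T =>
    ((hnm T).norm.const_add 1).inv.smul ((hu T).sub (hnm T))
  have hv := tendstoInMeasure_of_tendsto_ae (fun T => (hvm T).aestronglyMeasurable) h
  -- This continuous map rebuilds `u` from `n` and the normalized error, and reduces to the first
  -- coordinate when the error is zero.
  have hg : Continuous fun p : Vec m × Vec m => p.1 + (1 + ‖p.1‖) • p.2 := by fun_prop
  have := hn.continuous_comp_prodMk_of_tendstoInMeasure_const hg hv hvm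
  have e1 : (fun (T : ℕ) ω => n T ω + (1 + ‖n T ω‖) • (1 + ‖n T ω‖)⁻¹ • (u T ω - n T ω)) = u := by
    ext1 T
    ext1 ω
    have hpos : 1 + ‖n T ω‖ ≠ 0 := by positivity
    rw [smul_inv_smul₀ hpos]
    abel
  simp only [smul_zero, add_zero] at this
  rwa [e1] at this

variable {Ω : Type*} [MeasurableSpace Ω] {μ : Measure Ω} {d : ℕ}
  {Y : ℤ → Ω → Vec d} {Θ : Set (Vec m)} {θ₀ : Vec m} {lam : (ℕ → Vec d) → Vec m → Vec d}
  {W : (ℕ → Vec d) → Matrix (Fin d) (Fin d) ℝ}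

/-- The normalized score `T^{-1/2} ∑_{t ≤ T} s_t(θ)`. -/
noncomputable def normalizedScore (lam : (ℕ → Vec d) → Vec m → Vec d) (Y : ℤ → Ω → Vec d)
    (W : ℤ → Ω → Matrix (Fin d) (Fin d) ℝ) (Θ : Set (Vec m)) (T : ℕ) (ω : Ω) (θ : Vec m) :
    Vec m :=
  WithLp.toLp 2 fun j => (√(T : ℝ))⁻¹ * ∑ t ∈ Finset.Icc 1 T, score lam Y W Θ t ω θ j

/-- The quadratic form of `I` at `a` is the second moment of the combination `∑ a_j s_j`. This gives
both the variance in the scalar central limit theorem and positive semidefiniteness. -/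
theorem posSemidef_Imat
    (hI : ∀ i j, Integrable (fun ω => score lam Y (pastWeights W Y) Θ 0 ω θ₀ i *
      score lam Y (pastWeights W Y) Θ 0 ω θ₀ j) μ) :
    (∀ a : Fin m → ℝ, Integrable
      (fun ω => (∑ j, a j * score lam Y (pastWeights W Y) Θ 0 ω θ₀ j) ^ 2) μ) ∧
    (∀ a : Fin m → ℝ, ∫ ω, (∑ j, a j * score lam Y (pastWeights W Y) Θ 0 ω θ₀ j) ^ 2 ∂μ
      = a ⬝ᵥ (Imat μ lam Y (pastWeights W Y) Θ θ₀ *ᵥ a)) ∧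
    (Imat μ lam Y (pastWeights W Y) Θ θ₀).PosSemidef := by
  set s : Ω → Fin m → ℝ := fun ω => score lam Y (pastWeights W Y) Θ 0 ω θ₀ with hs
  have hexp : ∀ (a : Fin m → ℝ) ω, (∑ j, a j * s ω j) ^ 2
      = ∑ i, ∑ j, a i * a j * (s ω i * s ω j) := fun a ω => by
    rw [sq, Finset.sum_mul_sum]
    exact Finset.sum_congr rfl fun i _ => Finset.sum_congr rfl fun j _ => by ring
  have hinteg : ∀ a : Fin m → ℝ, Integrable (fun ω => (∑ j, a j * s ω j) ^ 2) μ := fun a => by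
    simp only [hexp]
    exact integrable_finsetSum _ fun i _ => integrable_finsetSum _ fun j _ =>
      (hI i j).const_mul _
  have hval : ∀ a : Fin m → ℝ, ∫ ω, (∑ j, a j * s ω j) ^ 2 ∂μ
      = a ⬝ᵥ (Imat μ lam Y (pastWeights W Y) Θ θ₀ *ᵥ a) := fun a => by
    simp only [hexp]
    rw [integral_finsetSum _ fun i _ => integrable_finsetSum _ fun j _ => (hI i j).const_mul _]
    simp only [dotProduct, Matrix.mulVec, Finset.mul_sum]
    refine Finset.sum_congr rfl fun i _ => ?_
    rw [integral_finsetSum _ fun j _ => (hI i j).const_mul _]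
    refine Finset.sum_congr rfl fun j _ => ?_
    rw [integral_const_mul, Imat, Matrix.of_apply]
    ring
  refine ⟨hinteg, hval, Matrix.PosSemidef.of_dotProduct_mulVec_nonneg ?_ fun a => ?_⟩
  · ext i j
    simp only [Matrix.conjTranspose_apply, Imat, Matrix.of_apply, star_trivial, mul_comm]
  · rw [star_trivial, ← hval]
    exact integral_nonneg fun ω => sq_nonneg _

theorem aemeasurable_mulVec_normalizedScore (hY : ∀ t, Measurable (Y t))
    (hlam : ∀ θ ∈ Θ, Measurable fun y => lam y θ) (hW : ∀ i j, Measurable fun y => W y i j)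
    (hθ₀ : θ₀ ∈ interior Θ) (hC : ∀ t, ∀ᵐ ω ∂μ, ContDiffOn ℝ 2 (lam (past Y t ω)) Θ)
    {A : Matrix (Fin m) (Fin m) ℝ} (T : ℕ) :
    AEMeasurable (fun ω => (WithLp.toLp 2
      (A *ᵥ (normalizedScore lam Y (pastWeights W Y) Θ T ω θ₀).ofLp) : Vec m)) μ := by
  have hsm : ∀ (t : ℤ) (j : Fin m), AEMeasurable
      (fun ω => score lam Y (pastWeights W Y) Θ t ω θ₀ j) μ := fun t j =>
    (isFactor_score hlam hW hθ₀ hC j).aemeasurable (measurable_window hY) t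
  have hsum : ∀ j : Fin m, AEMeasurable (fun ω => (√(T : ℝ))⁻¹ *
      ∑ t ∈ Finset.Icc 1 T, score lam Y (pastWeights W Y) Θ (t : ℕ) ω θ₀ j) μ := fun j =>
    (Finset.aemeasurable_fun_sum (f := fun (t : ℕ) ω =>
      score lam Y (pastWeights W Y) Θ (t : ℤ) ω θ₀ j) _ fun t _ => hsm t j).const_mul _
  have hA : ∀ i : Fin m, AEMeasurable (fun ω => ∑ j, A i j * ((√(T : ℝ))⁻¹ *
      ∑ t ∈ Finset.Icc 1 T, score lam Y (pastWeights W Y) Θ (t : ℕ) ω θ₀ j)) μ := fun i =>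
    Finset.aemeasurable_fun_sum (f := fun (j : Fin m) ω => A i j * ((√(T : ℝ))⁻¹ *
      ∑ t ∈ Finset.Icc 1 T, score lam Y (pastWeights W Y) Θ (t : ℕ) ω θ₀ j)) _
      fun j _ => (hsum j).const_mul _
  exact (PiLp.continuous_toLp 2 fun _ : Fin m => ℝ).measurable.comp_aemeasurable
    (aemeasurable_pi_lambda _ hA)

/-- The central limit theorem for linear images of the normalized score. -/
theorem tendstoInDistribution_normalizedScore [IsProbabilityMeasure μ] (hY : ∀ t, Measurable (Y t))
    (hE : StationaryErgodic μ Y) (hlam : ∀ θ ∈ Θ, Measurable fun y => lam y θ)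
    (hmean : MeanModel μ lam Y θ₀) (hW : ∀ i j, Measurable fun y => W y i j)
    (hθ₀ : θ₀ ∈ interior Θ) (hC : ∀ t, ∀ᵐ ω ∂μ, ContDiffOn ℝ 2 (lam (past Y t ω)) Θ)
    (hI : ∀ i j, Integrable (fun ω => score lam Y (pastWeights W Y) Θ 0 ω θ₀ i *
      score lam Y (pastWeights W Y) Θ 0 ω θ₀ j) μ)
    {A : Matrix (Fin m) (Fin m) ℝ} (hA : A.IsSymm) :
    TendstoInDistribution (fun (T : ℕ) ω => (WithLp.toLp 2
        (A *ᵥ (normalizedScore lam Y (pastWeights W Y) Θ T ω θ₀).ofLp) : Vec m)) atTop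
      (fun x : Vec m => x) (fun _ => μ)
      (multivariateGaussian 0 (A * Imat μ lam Y (pastWeights W Y) Θ θ₀ * A)) := by
  obtain ⟨hinteg, hval, hpsd⟩ := posSemidef_Imat hI
  have hnm := aemeasurable_mulVec_normalizedScore (A := A) hY hlam hW hθ₀ hC
  refine ⟨hnm, by fun_prop, ?_⟩
  refine ProbabilityMeasure.tendsto_iff_tendsto_charFun.2 fun u => ?_
  simp only [ProbabilityMeasure.coe_mk, Measure.map_id']
  have hG : (A * Imat μ lam Y (pastWeights W Y) Θ θ₀ * A).PosSemidef := by
    have := hpsd.mul_mul_conjTranspose_same A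
    rwa [Matrix.conjTranspose_eq_transpose_of_trivial, hA.eq] at this
  rw [charFun_multivariateGaussian hG]
  -- Cramér–Wold: since `A` is symmetric, `⟨A S, u⟩ = ⟨S, A u⟩`, and the scalar theorem applies with
  -- coefficients `A u`.
  set a : Vec m := WithLp.toLp 2 (A *ᵥ u.ofLp) with ha
  have hmain := tendsto_integral_exp_score hY hE hlam hmean hW hθ₀ hC a
    (x := fun t ω => ∑ j, a j * score lam Y (pastWeights W Y) Θ t ω θ₀ j)
    (fun t => Eventually.of_forall fun ω => by
      have := clm_apply_eq_sum (((wformL (W (past Y t ω))).flip (resid lam Y t ω θ₀)).comp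
        (fderiv ℝ (lam (past Y t ω)) θ₀)) a
      simp only [score_apply, fderivWithin_of_mem_nhds (mem_interior_iff_mem_nhds.1 hθ₀)]
      exact this.symm) (hinteg a.ofLp)
  have hquad : a.ofLp ⬝ᵥ (Imat μ lam Y (pastWeights W Y) Θ θ₀ *ᵥ a.ofLp)
      = u.ofLp ⬝ᵥ ((A * Imat μ lam Y (pastWeights W Y) Θ θ₀ * A) *ᵥ u.ofLp) := by
    have h1 : a.ofLp = A *ᵥ u.ofLp := rfl
    have h2 : A *ᵥ u.ofLp = u.ofLp ᵥ* A := by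
      conv_rhs => rw [← hA.eq, Matrix.vecMul_transpose]
    rw [← Matrix.mulVec_mulVec, ← Matrix.mulVec_mulVec, Matrix.dotProduct_mulVec u.ofLp A, ← h2, h1]
  rw [hval, hquad] at hmain
  have hlimit : (Real.exp (-(u.ofLp ⬝ᵥ ((A * Imat μ lam Y (pastWeights W Y) Θ θ₀ * A)
      *ᵥ u.ofLp)) / 2) : ℂ) = Complex.exp ((inner ℝ u (0 : Vec m) : ℝ) * Complex.I
        - ((u.ofLp ⬝ᵥ ((A * Imat μ lam Y (pastWeights W Y) Θ θ₀ * A) *ᵥ u.ofLp) : ℝ) : ℂ) / 2) := by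
    rw [inner_zero_right]
    push_cast
    congr 1
    ring
  rw [hlimit] at hmain
  refine hmain.congr fun T => ?_
  rw [charFun_apply, integral_map (hnm T) (by fun_prop)]
  refine integral_congr_ae (Eventually.of_forall fun ω => ?_)
  simp only
  congr 2
  have h3 : inner ℝ (WithLp.toLp 2
      (A *ᵥ (normalizedScore lam Y (pastWeights W Y) Θ T ω θ₀).ofLp) : Vec m) u
      = a.ofLp ⬝ᵥ (normalizedScore lam Y (pastWeights W Y) Θ T ω θ₀).ofLp := by
    rw [EuclideanSpace.inner_eq_star_dotProduct, star_trivial, Matrix.dotProduct_mulVec, ha]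
    congr 1
    conv_lhs => rw [← hA.eq, Matrix.vecMul_transpose]
  rw [h3]
  congr 1
  simp only [dotProduct, normalizedScore, Finset.mul_sum]
  rw [Finset.sum_comm]
  exact Finset.sum_congr rfl fun j _ => Finset.sum_congr rfl fun t _ => by ring

end Normality

/-! ### Expansion of the score around the estimator -/

section Linearization

variable {Ω : Type*} {d m : ℕ} {Y : ℤ → Ω → Vec d} {Θ : Set (Vec m)} {θ₀ : Vec m}
  {lam : (ℕ → Vec d) → Vec m → Vec d}

/-- The expansion of the score at `θ₀` around the estimator, along a single sample path. -/
theorem eventually_abs_normalizedScore_sub_le {W : ℤ → Ω → Matrix (Fin d) (Fin d) ℝ} {ω : Ω}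
    (hC : ∀ t : ℕ, ContDiffOn ℝ 2 (lam (past Y t ω)) Θ) (hW : ∀ t : ℕ, (W t ω).IsSymm) {ρ : ℝ}
    (hρ : 0 < ρ) (hball : Metric.closedBall θ₀ ρ ⊆ interior Θ) {j : Fin m}
    {h : Fin m → Vec m → ℝ}
    (hu : ∀ i, TendstoUniformlyOn (fun (T : ℕ) θ => (T : ℝ)⁻¹ * ∑ t ∈ Finset.Icc 1 T,
      hessian (loss lam Y W t ω) Θ θ i j) (h i) atTop (Metric.closedBall θ₀ ρ))
    {x : ℕ → Vec m} (hx : Tendsto x atTop (𝓝 θ₀))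
    (hs : Tendsto (fun T : ℕ => (√(T : ℝ))⁻¹ * ∑ t ∈ Finset.Icc 1 T,
      wform (W t ω) (fderiv ℝ (lam (past Y t ω)) (x T) (EuclideanSpace.single j 1))
        (resid lam Y t ω (x T))) atTop (𝓝 0)) {η : ℝ} (hη : 0 < η) :
    ∀ᶠ T : ℕ in atTop, |normalizedScore lam Y W Θ T ω θ₀ j
      - ∑ i, 1 / 2 * h i θ₀ * (√(T : ℝ) • (x T - θ₀)) i| ≤ η * (‖√(T : ℝ) • (x T - θ₀)‖ + 1) := by
  have hθ₀ : θ₀ ∈ interior Θ := hball (Metric.mem_closedBall_self hρ.le)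
  set e : Vec m := EuclideanSpace.single j 1 with he
  -- This average of partial derivatives is `-2` times the averaged score, so `√T / 2` is the factor
  -- that turns it into minus the normalized score.
  set g : ℕ → Vec m → ℝ := fun T θ =>
    (T : ℝ)⁻¹ * ∑ t ∈ Finset.Icc 1 T, fderiv ℝ (loss lam Y W t ω) θ e with hg
  set D : ℕ → Vec m → Vec m →L[ℝ] ℝ := fun T θ =>
    (T : ℝ)⁻¹ • ∑ t ∈ Finset.Icc 1 T, (fderiv ℝ (fderiv ℝ (loss lam Y W t ω)) θ).flip e with hD
  have hgD : ∀ T, ∀ θ ∈ Metric.closedBall θ₀ ρ, HasFDerivAt (g T) (D T θ) θ := fun T θ hθ =>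
    (HasFDerivAt.fun_sum fun t _ => hasFDerivAt_fderiv_loss (hC t) (hball hθ) e).const_mul _
  have hDu : ∀ i, TendstoUniformlyOn (fun T θ => D T θ (EuclideanSpace.single i 1)) (h i) atTop
      (Metric.closedBall θ₀ ρ) := fun i =>
    (hu i).congr (Eventually.of_forall fun T θ hθ => by
      simp only [hD, hessian_eq_of_mem_interior (hball hθ), FunLike.coe_smul,
        Pi.smul_apply, sum_apply, smul_eq_mul, ContinuousLinearMap.flip_apply,
        he])
  have hc : ∀ i, ContinuousOn (h i) (Metric.closedBall θ₀ ρ) := fun i =>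
    (hu i).continuousOn (Frequently.of_forall fun T => continuousOn_const.mul
      (continuousOn_finsetSum _ fun t _ => (continuousOn_hessian_loss (hC t) i j).mono hball))
  have hmem : ∀ᶠ T in atTop, x T ∈ interior Θ := hx (isOpen_interior.mem_nhds hθ₀)
  have hsmall := hs.abs.eventually_le_const (u := η) (by simpa using hη)
  filter_upwards [eventually_abs_sub_linear_le hρ hgD hc hDu hx hη, hmem, hsmall,
    eventually_ge_atTop 1] with T hT hxT hr hT1
  set r := (√(T : ℝ))⁻¹ * ∑ t ∈ Finset.Icc 1 T,
    wform (W t ω) (fderiv ℝ (lam (past Y t ω)) (x T) e) (resid lam Y t ω (x T)) with hrdef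
  have hT0 : (0 : ℝ) < T := by exact_mod_cast hT1
  have hsq : 0 < √(T : ℝ) := Real.sqrt_pos.2 hT0
  have hTinv : (T : ℝ)⁻¹ = (√(T : ℝ))⁻¹ * (√(T : ℝ))⁻¹ := by
    rw [← mul_inv, Real.mul_self_sqrt hT0.le]
  have h1 : √(T : ℝ) / 2 * g T (x T) = -r := by
    simp only [hg, hrdef, fderiv_loss_apply (hC _) (hW _) hxT, ← Finset.mul_sum, hTinv]
    field_simp
  have h2 : √(T : ℝ) / 2 * g T θ₀ = -normalizedScore lam Y W Θ T ω θ₀ j := by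
    simp only [hg, normalizedScore, score_eq (hC _) (hW _) hθ₀, ← Finset.mul_sum, hTinv, ← he]
    field_simp
  have h3 : √(T : ℝ) / 2 * ∑ i, h i θ₀ * (x T - θ₀) i
      = ∑ i, 1 / 2 * h i θ₀ * (√(T : ℝ) • (x T - θ₀)) i := by
    rw [Finset.mul_sum]
    refine Finset.sum_congr rfl fun i _ => ?_
    rw [PiLp.smul_apply, smul_eq_mul]
    ring
  have h4 : normalizedScore lam Y W Θ T ω θ₀ j
      - ∑ i, 1 / 2 * h i θ₀ * (√(T : ℝ) • (x T - θ₀)) i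
      = r + √(T : ℝ) / 2 * (g T (x T) - g T θ₀ - ∑ i, h i θ₀ * (x T - θ₀) i) := by
    rw [mul_sub, mul_sub, h1, h2, h3]
    ring
  rw [h4, norm_smul, Real.norm_of_nonneg hsq.le]
  calc _ ≤ |r| + √(T : ℝ) / 2 * |g T (x T) - g T θ₀ - ∑ i, h i θ₀ * (x T - θ₀) i| := by
        refine (abs_add_le _ _).trans_eq ?_
        rw [abs_mul (√(T : ℝ) / 2), abs_of_pos (half_pos hsq)]
    _ ≤ η + √(T : ℝ) / 2 * (η * ‖x T - θ₀‖) := by gcongr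
    _ ≤ η * (√(T : ℝ) * ‖x T - θ₀‖ + 1) := by
        nlinarith [mul_nonneg hη.le (mul_nonneg hsq.le (norm_nonneg (x T - θ₀)))]

variable [MeasurableSpace Ω] {μ : Measure Ω} [IsProbabilityMeasure μ]
  {W : (ℕ → Vec d) → Matrix (Fin d) (Fin d) ℝ}

/-- The normalized score equals `H √T (θ̂ - θ₀)` up to a relatively negligible error. -/
theorem ae_eventually_abs_normalizedScore_sub_le (hY : ∀ t, Measurable (Y t))
    (hE : StationaryErgodic μ Y) (hlam : ∀ θ ∈ Θ, Measurable fun y => lam y θ)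
    (hW : ∀ i j, Measurable fun y => W y i j) (hWs : ∀ y, (W y).IsSymm)
    (hM : SecondDerivMoment μ lam Y (pastWeights W Y) Θ) (hθ₀ : θ₀ ∈ interior Θ)
    (hH : (Hmat μ lam Y (pastWeights W Y) Θ θ₀).IsSymm) {θhat : ℕ → Ω → Vec m}
    (hlim : ∀ᵐ ω ∂μ, Tendsto (fun T => θhat T ω) atTop (𝓝 θ₀))
    (hs : ∀ j : Fin m, ∀ᵐ ω ∂μ, Tendsto (fun T : ℕ => (√(T : ℝ))⁻¹ * ∑ t ∈ Finset.Icc 1 T,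
      wform (W (past Y t ω)) (fderiv ℝ (lam (past Y t ω)) (θhat T ω)
        (EuclideanSpace.single j 1)) (resid lam Y t ω (θhat T ω))) atTop (𝓝 0)) :
    ∀ᵐ ω ∂μ, ∀ η > 0, ∀ᶠ T : ℕ in atTop, ∀ j,
      |normalizedScore lam Y (pastWeights W Y) Θ T ω θ₀ j
        - (Hmat μ lam Y (pastWeights W Y) Θ θ₀ *ᵥ (√(T : ℝ) • (θhat T ω - θ₀)).ofLp) j|
      ≤ η * (‖√(T : ℝ) • (θhat T ω - θ₀)‖ + 1) := by
  obtain ⟨ρ, hρ, hball⟩ := Metric.nhds_basis_closedBall.mem_iff.1 (isOpen_interior.mem_nhds hθ₀)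
  have hu : ∀ᵐ ω ∂μ, ∀ i j, TendstoUniformlyOn
      (fun (T : ℕ) θ => (T : ℝ)⁻¹ * ∑ t ∈ Finset.Icc 1 T,
        hessian (loss lam Y (pastWeights W Y) t ω) Θ θ i j)
      (fun θ => ∫ ω, hessian (loss lam Y (pastWeights W Y) 0 ω) Θ θ i j ∂μ) atTop
      (Metric.closedBall θ₀ ρ) := ae_all_iff.2 fun i => ae_all_iff.2 fun j =>
    ae_tendstoUniformlyOn_hessian hY hE hlam hW hM (isCompact_closedBall _ _) hball i j
  have hC : ∀ᵐ ω ∂μ, ∀ t : ℕ, ContDiffOn ℝ 2 (lam (past Y t ω)) Θ :=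
    ae_all_iff.2 fun t => (hM t).1
  filter_upwards [hu, hC, hlim, ae_all_iff.2 hs] with ω hu hC hlim hs η hη
  refine eventually_all.2 fun j => ?_
  refine (eventually_abs_normalizedScore_sub_le hC (fun t => hWs _) hρ hball (fun i => hu i j)
    hlim (hs j) hη).mono fun T hT => ?_
  -- Differentiating component `j` in direction `i` produces entry `(i, j)`, while the matrix
  -- product uses entry `(j, i)`; the symmetry of `H` reconciles them.
  have hHj : ∀ i, 1 / 2 * ∫ ω, hessian (loss lam Y (pastWeights W Y) 0 ω) Θ θ₀ i j ∂μ
      = Hmat μ lam Y (pastWeights W Y) Θ θ₀ j i := fun i => hH.apply j i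
  simp only [hHj] at hT
  exact hT

end Linearization

end MWLSE

/-! ### Consistency and asymptotic normality of the two-stage estimator -/

theorem theorem2 {Ω : Type*} [MeasurableSpace Ω] (μ : Measure Ω) [IsProbabilityMeasure μ]
    {d m q : ℕ}
    -- the process and the conditional mean model
    (Y : ℤ → Ω → MWLSE.Vec d) (hY : ∀ t, Measurable (Y t))
    (Θ : Set (MWLSE.Vec m)) (θ₀ : MWLSE.Vec m) (hθ₀ : θ₀ ∈ Θ)
    (lam : (ℕ → MWLSE.Vec d) → MWLSE.Vec m → MWLSE.Vec d)
    (hlam : ∀ θ ∈ Θ, Measurable fun y => lam y θ)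
    (hmean : MWLSE.MeanModel μ lam Y θ₀)
    -- the pseudo-variances and the working correlation matrix
    (Γ : Set (MWLSE.Vec q)) (γ₀ : MWLSE.Vec q) (hγ₀ : γ₀ ∈ Γ)
    (hstar : MWLSE.LocallyStarShapedAt (MWLSE.paramSpace Θ Γ) (MWLSE.stack θ₀ γ₀))
    (ν : (ℕ → MWLSE.Vec d) → MWLSE.Param m q → Fin d → ℝ)
    (hν : ∀ τ ∈ MWLSE.paramSpace Θ Γ, ∀ i, Measurable fun y => ν y τ i)
    (hν0 : ∀ y, ∀ τ ∈ MWLSE.paramSpace Θ Γ, ∀ i, 0 ≤ ν y τ i)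
    (P : MWLSE.Param m q → Matrix (Fin d) (Fin d) ℝ)
    (hP : ∀ τ ∈ MWLSE.paramSpace Θ Γ, MWLSE.IsWorkingCorrelation (P τ))
    -- the first-step weights and the first-step estimator
    (W₁ : (ℕ → MWLSE.Vec d) → Matrix (Fin d) (Fin d) ℝ)
    (hW₁ : ∀ i j, Measurable fun y => W₁ y i j)
    (θhat₁ : ℕ → Ω → MWLSE.Vec m)
    (hθhat₁ : ∀ᵐ ω ∂μ, ∀ T : ℕ, 1 ≤ T →
      MWLSE.IsArgmin (MWLSE.objective lam Y (MWLSE.pastWeights W₁ Y) T ω) Θ (θhat₁ T ω))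
    -- the estimator of the extra parameters
    (γhat : ℕ → Ω → MWLSE.Vec q)
    (hγhat : ∀ᵐ ω ∂μ, ∀ T : ℕ, 1 ≤ T → γhat T ω ∈ Γ)
    -- the two-stage estimator
    (θhat : ℕ → Ω → MWLSE.Vec m) (hθhat_meas : ∀ T, AEMeasurable (θhat T) μ)
    (hθhat : ∀ᵐ ω ∂μ, ∀ T : ℕ, 1 ≤ T →
      MWLSE.IsArgmin
        (MWLSE.objective lam Y
          (MWLSE.estWeights ν P Y fun ω' => MWLSE.stack (θhat₁ T ω') (γhat T ω')) T ω)
        Θ (θhat T ω))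
    -- A1
    (hA1 : MWLSE.StationaryErgodic μ Y)
    -- A2, for the first-step weights and for the limiting second-step weights
    (hA2_cont : ∀ t, ∀ᵐ ω ∂μ, ContinuousOn (lam (MWLSE.past Y t ω)) Θ)
    (hA2_compact : IsCompact Θ)
    (hA2_first : MWLSE.LossMoment μ lam Y (MWLSE.pastWeights W₁ Y) Θ)
    (hA2_second :
      MWLSE.LossMoment μ lam Y (MWLSE.limitWeights ν P Y (MWLSE.stack θ₀ γ₀)) Θ)
    -- A3, for both weights
    (hA3_first : MWLSE.PosDefWeights μ (MWLSE.pastWeights W₁ Y))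
    (hA3_second : MWLSE.PosDefWeights μ (MWLSE.limitWeights ν P Y (MWLSE.stack θ₀ γ₀)))
    -- A4
    (hA4 : MWLSE.Identified μ lam Y Θ θ₀)
    -- B1
    (hB1_diff : ∀ t, ∀ᵐ ω ∂μ,
      ContDiffOn ℝ 1 (MWLSE.kvec ν P Y t ω) (MWLSE.paramSpace Θ Γ))
    (hB1_lim : ∀ᵐ ω ∂μ, Tendsto (fun T => γhat T ω) atTop (𝓝 γ₀))
    -- B2
    (hB2 : ∀ t, ∫⁻ ω, MWLSE.Zvar lam ν P Y Θ Γ t ω ∂μ < ∞) :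
    (∀ᵐ ω ∂μ, Tendsto (fun T => θhat T ω) atTop (𝓝 θ₀)) ∧
    -- A5, A6, A7
    (MWLSE.InfoMatrices μ lam Y (MWLSE.limitWeights ν P Y (MWLSE.stack θ₀ γ₀)) Θ θ₀ →
      MWLSE.SecondDerivMoment μ lam Y (MWLSE.limitWeights ν P Y (MWLSE.stack θ₀ γ₀)) Θ →
      θ₀ ∈ interior Θ →
      -- B3
      MWLSE.WeightRate μ lam ν P Y Θ Γ (fun T ω => MWLSE.stack (θhat₁ T ω) (γhat T ω))
        (MWLSE.stack θ₀ γ₀) →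
      TendstoInDistribution
        (fun (T : ℕ) ω => Real.sqrt (T : ℝ) • (θhat T ω - θ₀)) atTop
        (fun x : MWLSE.Vec m => x) (fun _ => μ)
        (multivariateGaussian 0
          (MWLSE.Gmat μ lam Y (MWLSE.limitWeights ν P Y (MWLSE.stack θ₀ γ₀)) Θ θ₀))) := by
  have hτ₀ : MWLSE.stack θ₀ γ₀ ∈ MWLSE.paramSpace Θ Γ := ⟨hθ₀, hγ₀⟩
  have hWm := MWLSE.measurable_inv_pseudoCov (P := P) (hν _ hτ₀)
  -- In the first step the criterion coincides with the reference criterion, so the required uniform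
  -- closeness is trivial.
  have hθ₁ : ∀ᵐ ω ∂μ, Tendsto (fun T => θhat₁ T ω) atTop (𝓝 θ₀) :=
    MWLSE.ae_tendsto_argmin hY hA1 hθ₀ hlam hmean hW₁ hA2_cont hA2_compact hA2_first hA3_first hA4
      (g := fun T ω => MWLSE.objective lam Y (MWLSE.pastWeights W₁ Y) T ω)
      (Eventually.of_forall fun ω => Metric.tendstoUniformlyOn_iff.2 fun ε hε =>
        Eventually.of_forall fun T θ _ => by simpa using hε) hθhat₁
  have hτmem : ∀ᵐ ω ∂μ, ∀ T : ℕ, 1 ≤ T →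
      MWLSE.stack (θhat₁ T ω) (γhat T ω) ∈ MWLSE.paramSpace Θ Γ := by
    filter_upwards [hθhat₁, hγhat] with ω h1 h2 T hT
    exact ⟨(h1 T hT).1, h2 T hT⟩
  have hτlim : ∀ᵐ ω ∂μ, Tendsto (fun T => MWLSE.stack (θhat₁ T ω) (γhat T ω)) atTop
      (𝓝 (MWLSE.stack θ₀ γ₀)) := by
    filter_upwards [hθ₁, hB1_lim] with ω h1 h2
    exact ((WithLp.prod_continuous_toLp 2 _ _).tendsto _).comp (h1.prodMk_nhds h2)
  have hlim : ∀ᵐ ω ∂μ, Tendsto (fun T => θhat T ω) atTop (𝓝 θ₀) :=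
    MWLSE.ae_tendsto_argmin hY hA1 hθ₀ hlam hmean hWm hA2_cont hA2_compact hA2_second hA3_second
      hA4 (MWLSE.ae_tendstoUniformlyOn_objective_sub hY hA1 hlam hτ₀ hstar hν hA2_cont hB1_diff
        hB2 hτmem hτlim) hθhat
  refine ⟨hlim, fun hA5 hA6 hA7 hB3 => ?_⟩
  have hP' : ∀ τ ∈ MWLSE.paramSpace Θ Γ, (P τ).IsSymm := fun τ hτ => (hP τ hτ).1
  have hC : ∀ t, ∀ᵐ ω ∂μ, ContDiffOn ℝ 2 (lam (MWLSE.past Y t ω)) Θ := fun t => (hA6 t).1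
  obtain ⟨-, hI, hH⟩ := hA5
  -- Positive definiteness includes symmetry here, so no separate exchange of second derivatives is
  -- needed.
  have hHs : (MWLSE.Hmat μ lam Y (MWLSE.limitWeights ν P Y (MWLSE.stack θ₀ γ₀)) Θ θ₀).IsSymm := by
    simpa [Matrix.IsHermitian, Matrix.IsSymm] using hH.isHermitian
  have hlin := MWLSE.ae_eventually_abs_normalizedScore_sub_le
    (W := MWLSE.invCov ν P (MWLSE.stack θ₀ γ₀)) hY hA1 hlam hWm
    (MWLSE.isSymm_invCov (hP' _ hτ₀)) hA6 hA7 hHs hlim fun j =>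
      MWLSE.ae_tendsto_score_estimator hA7 hstar hP' hC hB1_diff hτmem hτlim hB3 hθhat hlim
        (by simp)
  refine MWLSE.tendstoInDistribution_of_normalized_error
    (fun T => ((hθhat_meas T).sub_const θ₀).const_smul (Real.sqrt (T : ℝ)))
    (MWLSE.tendstoInDistribution_normalizedScore hY hA1 hlam hmean hWm hA7 hC hI
      (A := (MWLSE.Hmat μ lam Y (MWLSE.limitWeights ν P Y (MWLSE.stack θ₀ γ₀)) Θ θ₀)⁻¹) hHs.inv) ?_
  filter_upwards [hlin] with ω hω
  exact MWLSE.tendsto_normalized_error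
    (Matrix.nonsing_inv_mul _ (Matrix.isUnit_iff_isUnit_det _ |>.1 hH.isUnit)) hω
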